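/- Let $d\ge 3$ be an integer, $\frac{4}{(4d-3)(d-2)}<a<\frac1{(d-1)(d-2)}$, $a_1:=\frac a2+\frac1{2(d-1)(d-2)}$. Call $\mu$ admissible if $\frac{(d-1)a_1}2+\frac1{2(d-2)}<\mu<\frac1{d-2}$, and for such $\mu$ put $\gamma:=\frac{\mu+1-(d-1)a}{\mu+a}$, $\gamma_1:=\frac{\mu+1-(d-1)a_1}{\mu+a_1}$. Let $\Pi_+:=\{(r,z):r>0,z>0\}$, $\langle r,z\rangle:=(1+r^2+z^2)^{1/2}$, $\langle z\rangle:=(1+z^2)^{1/2}$, $|(r,z)|:=(r^2+z^2)^{1/2}$. **The spaces.** $\mathcal A^0$ is the set of $\psi\in C(\overline{\Pi_+})\cap C^2(\Pi_+)$ with $\psi(0,0)=a$, $0<\psi\le a_1$ on $\overline{\Pi_+}$, and, on $\Pi_+$ (with Euclidean, respectively Hilbert–Schmidt, norms of the gradient and the Hessian), $$|\nabla\psi|\le\tfrac1{10}\langle r,z\rangle^{-1+\frac1{d\mu}}\langle z\rangle^{-\frac1{d\mu}}\psi,\qquad |\langle r,z\rangle\partial_r\psi|\le\tfrac1{10}\psi,$$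 $$|\nabla^2\psi|\le\tfrac1{10}\Big(\langle r,z\rangle^{2-d+\frac1\mu}r^{d-3-\frac{d-1}{d\mu}}\langle z\rangle^{-1-\frac1{d\mu}}+r^{d-3-\gamma}\mathbf 1_{r^2+z^2\le1}\Big)\psi.$$ For $M>1$, $\mathcal A_M$ is the set of $\psi\in\mathcal A^0$ with $M^{-1}\langle r,z\rangle^{d-2-\frac1\mu}\le\psi\le M\langle r,z\rangle^{d-2-\frac1\mu}$ on $\overline{\Pi_+}$. For $M'>1$, $\mathcal B_{M'}$ is the set of $\Omega\in C^1(\Pi_+)$ such that on $\Pi_+$ $$0<\Omega\le M'\min\Big\{r^{-\frac{d-1}{d\mu}}z^{-\frac1{d\mu}},\ zr^{-\gamma}+zr^{-\gamma_1}\Big\},\qquad |r\partial_r\Omega|+|z\partial_z\Omega|\le M'\Omega,$$ and $\Omega\ge\frac1{M'}r^{-\frac{d-1}{d\mu}}z^{-\frac1{d\mu}}$ whenever $2<z<r<2z$. **The data.** Let $\eta\in C^\infty((0,\pi/2);[0,1])$ satisfy $\eta=1$ on $(0,\arctan(2d)]$ and $\eta=0$ on $[\arccos\frac1{3d},\pi/2)$,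 and put $\chi_\mu(\sigma):=\eta(\sigma)+(1-\eta(\sigma))(\cos\sigma)^{1+\frac1{d\mu}}$. Let $\delta_d:=0$ if $d$ is odd and $\delta_d:=1$ if $d$ is even. Let $\Theta\in C^\infty((0,\infty);(0,1])$ satisfy $\lim_{s\to0+}\Theta(s)=0$, $\Theta(s)=1$ for $s\ge1$ and $\Theta(s)=s^{\delta_d+(d-1)/(d\mu)}$ for $0<s\le\frac1{10}$ (so $\Theta$ may depend on $\mu$), and let $K$ be a bound for its logarithmic slope: $|s\Theta'(s)|\le K\Theta(s)$ for all $s>0$. For given $\psi\in\mathcal A_M$ let $\Gamma_0:=\{(r,z)\in\Pi_+: r^2+(\mu+\psi(r,z))^2z^2=1\}$. **Proposition.** There are constants $\lambda_0=\lambda_0(d,a,\mu,M)>1$, $M_1=M_1(d,a,\mu,M)>1$ and $M_0'>1$, where $M_0'$ depends only on $d$ and $a$ (and on the fixed choices of $\eta$ and $K$), not on $\mu$, $M$, $\psi$ or otherwise on $\Theta$, such that the following holds for all admissible $\mu$, all $M>1$, all $\eta$, $\Theta$, $K$ as above, and all $\psi\in\mathcal A_M$. The curve $\Gamma_0$ is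 the graph $\{(r,f_0(r)):0<r<1\}$ of a function $f_0\in C^1((0,1))$; there is a unique $\Omega\in C^1(\Pi_+)$ that solves $$(\mu+\psi+z\partial_z\psi)\,r\partial_r\Omega+(\mu-(d-1)\psi-r\partial_r\psi)\,z\partial_z\Omega=-\Omega\quad\text{in }\Pi_+$$ with $$\Omega(\sin\sigma,f_0(\sin\sigma))=\Theta(\lambda_0\sigma)(\sin\sigma)^{-\frac{d-1}{d\mu}}(\cos\sigma)^{-\frac1{d\mu}}\chi_\mu(\sigma)\quad\text{for all }\sigma\in(0,\pi/2);$$ this $\Omega$ belongs to $\mathcal B_{M_0'}$; and $$\Omega(r,z)\le M_1\,z\,|(r,z)|^{-\frac1\mu-1}\quad\text{for all }(r,z)\in\Pi_+\text{ with }|(r,z)|\ge1.$$ -/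

import Mathlib

open Set Filter Topology
open scoped ContDiff

noncomputable section

namespace EulerProfile

/-- The open quadrant `Π₊ = {(r, z) : r > 0, z > 0}`. -/
def quadrant : Set (ℝ × ℝ) := {p | 0 < p.1 ∧ 0 < p.2}

/-- The closure of `Π₊`. -/
def closedQuadrant : Set (ℝ × ℝ) := {p | 0 ≤ p.1 ∧ 0 ≤ p.2}

/-- `∂_r f`. -/
def dr (f : ℝ × ℝ → ℝ) (p : ℝ × ℝ) : ℝ := deriv (fun t => f (t, p.2)) p.1

/-- `∂_z f`. -/
def dz (f : ℝ × ℝ → ℝ) (p : ℝ × ℝ) : ℝ := deriv (fun t => f (p.1, t)) p.2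

/-- The Euclidean length `|∇_{r,z} f|`. -/
def gradNorm (f : ℝ × ℝ → ℝ) (p : ℝ × ℝ) : ℝ := √(dr f p ^ 2 + dz f p ^ 2)

/-- The Euclidean (Hilbert–Schmidt) length `|∇²_{r,z} f|` of the Hessian matrix. -/
def hessNorm (f : ℝ × ℝ → ℝ) (p : ℝ × ℝ) : ℝ :=
  √(dr (dr f) p ^ 2 + dr (dz f) p ^ 2 + dz (dr f) p ^ 2 + dz (dz f) p ^ 2)

/-- The Euclidean length `|(r, z)|`. -/
def radius (p : ℝ × ℝ) : ℝ := √(p.1 ^ 2 + p.2 ^ 2)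

/-- `⟨r, z⟩ = (1 + r² + z²)^{1/2}`. -/
def bracket (p : ℝ × ℝ) : ℝ := √(1 + p.1 ^ 2 + p.2 ^ 2)

/-- `⟨z⟩ = (1 + z²)^{1/2}`. -/
def bracketOne (z : ℝ) : ℝ := √(1 + z ^ 2)

/-- The admissible range of `a`. The inequality
`1 / (d (d - 2)) < 4 / ((4 d - 3) (d - 2))` is automatic for `d ≥ 3`. -/
def AdmissibleA (d : ℕ) (a : ℝ) : Prop :=
  4 / ((4 * (d : ℝ) - 3) * ((d : ℝ) - 2)) < a ∧ a < 1 / (((d : ℝ) - 1) * ((d : ℝ) - 2))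

/-- `a₁ = a / 2 + 1 / (2 (d - 1) (d - 2))`. -/
def aOne (d : ℕ) (a : ℝ) : ℝ := a / 2 + 1 / (2 * ((d : ℝ) - 1) * ((d : ℝ) - 2))

/-- The admissible range of `μ`. For `d ≥ 3` and admissible `a` the further inequalities
`1/d < 3/(3d-5) < (d-1) a < (d-1) a₁ < (d-1) a₁ / 2 + 1/(2(d-2))` are automatic. -/
def AdmissibleMu (d : ℕ) (a μ : ℝ) : Prop :=
  ((d : ℝ) - 1) * aOne d a / 2 + 1 / (2 * ((d : ℝ) - 2)) < μ ∧ μ < 1 / ((d : ℝ) - 2)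

/-- `(μ + 1 - (d - 1) b) / (μ + b)`: this is `γ` for `b = a` and `γ₁` for `b = a₁`. -/
def gammaExp (d : ℕ) (μ b : ℝ) : ℝ := (μ + 1 - ((d : ℝ) - 1) * b) / (μ + b)

/-- The class `𝒜⁰` of stream functions. -/
structure MemA0 (d : ℕ) (a μ : ℝ) (ψ : ℝ × ℝ → ℝ) : Prop where
  continuousOn : ContinuousOn ψ closedQuadrant
  contDiffOn : ContDiffOn ℝ 2 ψ quadrant
  origin : ψ (0, 0) = a
  pos : ∀ p ∈ closedQuadrant, 0 < ψ p
  le_aOne : ∀ p ∈ closedQuadrant, ψ p ≤ aOne d a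
  grad_le : ∀ p ∈ quadrant, gradNorm ψ p ≤
    1 / 10 * bracket p ^ (-1 + 1 / (d * μ)) * bracketOne p.2 ^ (-(1 / (d * μ))) * ψ p
  dr_le : ∀ p ∈ quadrant, |bracket p * dr ψ p| ≤ 1 / 10 * ψ p
  hess_le : ∀ p ∈ quadrant, hessNorm ψ p ≤
    1 / 10 *
      (bracket p ^ (2 - (d : ℝ) + 1 / μ) * p.1 ^ ((d : ℝ) - 3 - ((d : ℝ) - 1) / (d * μ)) *
          bracketOne p.2 ^ (-1 - 1 / (d * μ)) +
        p.1 ^ ((d : ℝ) - 3 - gammaExp d μ a) *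
          indicator {q : ℝ × ℝ | q.1 ^ 2 + q.2 ^ 2 ≤ 1} (fun _ => (1 : ℝ)) p) * ψ p

/-- The class `𝒜_M`. -/
structure MemA (d : ℕ) (a μ M : ℝ) (ψ : ℝ × ℝ → ℝ) : Prop extends MemA0 d a μ ψ where
  lower : ∀ p ∈ closedQuadrant, M⁻¹ * bracket p ^ ((d : ℝ) - 2 - 1 / μ) ≤ ψ p
  upper : ∀ p ∈ closedQuadrant, ψ p ≤ M * bracket p ^ ((d : ℝ) - 2 - 1 / μ)

/-- The class `ℬ_{M'}` of relative vorticities. -/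
structure MemB (d : ℕ) (a μ M' : ℝ) (Ω : ℝ × ℝ → ℝ) : Prop where
  contDiffOn : ContDiffOn ℝ 1 Ω quadrant
  pos : ∀ p ∈ quadrant, 0 < Ω p
  upper : ∀ p ∈ quadrant, Ω p ≤ M' *
    min (p.1 ^ (-(((d : ℝ) - 1) / (d * μ))) * p.2 ^ (-(1 / (d * μ))))
      (p.2 * p.1 ^ (-gammaExp d μ a) + p.2 * p.1 ^ (-gammaExp d μ (aOne d a)))
  lower : ∀ p : ℝ × ℝ, 2 < p.2 → p.2 < p.1 → p.1 < 2 * p.2 →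
    1 / M' * (p.1 ^ (-(((d : ℝ) - 1) / (d * μ))) * p.2 ^ (-(1 / (d * μ)))) ≤ Ω p
  logDeriv_le : ∀ p ∈ quadrant, |p.1 * dr Ω p| + |p.2 * dz Ω p| ≤ M' * Ω p

/-- `δ_d`: `0` for odd `d` and `1` for even `d`. -/
def parityDelta (d : ℕ) : ℝ := if Even d then 1 else 0

/-- The admissible functions `Θ` in the initial data. -/
structure IsTheta (d : ℕ) (μ : ℝ) (Θ : ℝ → ℝ) : Prop where
  smooth : ContDiffOn ℝ ∞ Θ (Ioi 0)
  pos : ∀ s, 0 < s → 0 < Θ s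
  le_one : ∀ s, 0 < s → Θ s ≤ 1
  tendsto_zero : Tendsto Θ (𝓝[>] 0) (𝓝 0)
  eq_one : ∀ s, 1 ≤ s → Θ s = 1
  vanishing : ∀ s, 0 < s → s ≤ 1 / 10 →
    Θ s = s ^ (parityDelta d + ((d : ℝ) - 1) / (d * μ))

/-- The admissible angular cut-offs `η`. -/
structure IsEta (d : ℕ) (η : ℝ → ℝ) : Prop where
  smooth : ContDiffOn ℝ ∞ η (Ioo 0 (Real.pi / 2))
  mem_Icc : ∀ σ ∈ Ioo 0 (Real.pi / 2), η σ ∈ Icc (0 : ℝ) 1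
  eq_one : ∀ σ, 0 < σ → σ ≤ Real.arctan (2 * d) → η σ = 1
  eq_zero : ∀ σ, Real.arccos (1 / (3 * d)) ≤ σ → σ < Real.pi / 2 → η σ = 0

/-- `χ_μ = η + (1 - η) (cos σ)^{1 + 1/(dμ)}`. -/
def chi (d : ℕ) (μ : ℝ) (η : ℝ → ℝ) (σ : ℝ) : ℝ :=
  η σ + (1 - η σ) * Real.cos σ ^ (1 + 1 / (d * μ))

/-- The initial curve `Γ₀`. -/
def initialCurve (μ : ℝ) (ψ : ℝ × ℝ → ℝ) : Set (ℝ × ℝ) :=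
  {p | p.1 ^ 2 + (μ + ψ p) ^ 2 * p.2 ^ 2 = 1 ∧ 0 < p.1 ∧ 0 < p.2}

/-- The initial value prescribed at the point of `Γ₀` with angle variable `σ`;
`Θ_lam(σ) = Θ(lam * σ)`. -/
def initialValue (d : ℕ) (μ lam : ℝ) (Θ η : ℝ → ℝ) (σ : ℝ) : ℝ :=
  Θ (lam * σ) * Real.sin σ ^ (-(((d : ℝ) - 1) / (d * μ))) *
    Real.cos σ ^ (-(1 / (d * μ))) * chi d μ η σ

/-- `Ω ∈ C¹(Π₊)` solves the transport equation with velocity determined by `ψ`, and takes the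
prescribed initial values on the curve `z = f₀(r)`, `0 < r < 1`. -/
structure IsTransportSolution (d : ℕ) (μ lam : ℝ) (Θ η : ℝ → ℝ) (ψ : ℝ × ℝ → ℝ) (f₀ : ℝ → ℝ)
    (Ω : ℝ × ℝ → ℝ) : Prop where
  contDiffOn : ContDiffOn ℝ 1 Ω quadrant
  transport : ∀ p ∈ quadrant,
    (μ + ψ p + p.2 * dz ψ p) * (p.1 * dr Ω p) +
      (μ - ((d : ℝ) - 1) * ψ p - p.1 * dr ψ p) * (p.2 * dz Ω p) = -Ω p
  initial : ∀ σ ∈ Ioo 0 (Real.pi / 2),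
    Ω (Real.sin σ, f₀ (Real.sin σ)) = initialValue d μ lam Θ η σ

end EulerProfile

end

noncomputable section

namespace EulerProfile

/-! ### Calculus in the plane -/

/-! Put w = (μ + ψ) z and A = ∂_z w = μ + ψ + z ∂_z ψ. If V is the transport field, then V log r = A
and V log w = A (μ - (d - 1) ψ) / (μ + ψ), so derivatives of ψ enter only through the common factor
A. In the coordinates τ = log (r² + w²) / 2 and θ = log (r / w) = log tan σ the characteristics are
therefore graphs over τ that solve the scalar equation dθ/dτ = F = d ψ / D, where D = sin² σ (μ + ψ)
+ cos² σ (μ - (d - 1) ψ). The curve Γ₀ becomes the line τ = 0, and Ω = exp L turns the problem into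
∂_τ L + F ∂_θ L = -q with q = (μ + ψ) / (A D). The function F is bounded and Lipschitz in θ, so its
flow is global, and the method of characteristics (`IsTameField.exists_transport`, then
`ProfileBounds.exists_solution`) gives existence, uniqueness and C¹ regularity.

The constants are uniform in μ, M and ψ because D ≤ 2 < d forces F ≥ ψ. Hence along every
characteristic ∫ ψ g(θ) dτ ≤ ∫ g(θ) dθ, and with g = (sin σ cos σ)^c₀ the right side is at most π /
c₀, whatever the decay of ψ (`ProfileBounds.abs_sub_le_of_weight`). Membership in 𝒜⁰ ensures that
∂_θ F, ∂_θ q and the error terms below are at most a constant times ψ g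
(`ParameterBounds.profileBounds`). So ∂_θ L stays bounded along characteristics, which controls the
logarithmic derivatives of Ω.

The pointwise bounds compare log Ω with explicit functions. The function G = r^{-(d-1)/(dμ)}
w^{-1/(dμ)} satisfies d(log G)/dτ = -1/D exactly, and log Ω - log G has bounded variation once a
bounded correction is subtracted (`ProfileBounds.abs_sub_logG_le`). Comparing G with w r^{-γ₁} for τ
≥ 0 and with w r^{-γ} for τ ≤ 0 gives the second term in the minimum: in the first case ψ ≤ a₁ gives
monotonicity, in the second ψ - a is integrable in τ. Comparing G with w e^{-(1/μ+1)τ} gives the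
decay at infinity, at a cost that depends on M. The scale λ₀ is so large that every characteristic
through the sector z < r < 2z, z > 2, starts on Γ₀ where Θ = 1. It does not affect the constant for
ℬ, since Θ ≤ 1 and the logarithmic slope of Θ is invariant under dilation. -/

lemma dr_eq_fderiv {f : ℝ × ℝ → ℝ} {p : ℝ × ℝ} (hf : DifferentiableAt ℝ f p) :
    dr f p = fderiv ℝ f p (1, 0) := by
  have h : HasDerivAt (fun t : ℝ => (t, p.2)) ((1 : ℝ), (0 : ℝ)) p.1 :=
    (hasDerivAt_id p.1).prodMk (hasDerivAt_const _ _)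
  exact (hf.hasFDerivAt.comp_hasDerivAt p.1 h).deriv

lemma dz_eq_fderiv {f : ℝ × ℝ → ℝ} {p : ℝ × ℝ} (hf : DifferentiableAt ℝ f p) :
    dz f p = fderiv ℝ f p (0, 1) := by
  have h : HasDerivAt (fun t : ℝ => (p.1, t)) ((0 : ℝ), (1 : ℝ)) p.2 :=
    (hasDerivAt_const _ _).prodMk (hasDerivAt_id p.2)
  exact (hf.hasFDerivAt.comp_hasDerivAt p.2 h).deriv

lemma fderiv_apply_eq {f : ℝ × ℝ → ℝ} {p : ℝ × ℝ} (hf : DifferentiableAt ℝ f p) (u v : ℝ) :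
    fderiv ℝ f p (u, v) = dr f p * u + dz f p * v := by
  rw [dr_eq_fderiv hf, dz_eq_fderiv hf]
  have : ((u, v) : ℝ × ℝ) = u • ((1 : ℝ), (0 : ℝ)) + v • ((0 : ℝ), (1 : ℝ)) := by simp
  rw [this, map_add, map_smul, map_smul]
  simp [mul_comm]

lemma hasDerivAt_comp_curve {f : ℝ × ℝ → ℝ} {x y : ℝ → ℝ} {x' y' t : ℝ}
    (hf : DifferentiableAt ℝ f (x t, y t)) (hx : HasDerivAt x x' t) (hy : HasDerivAt y y' t) :
    HasDerivAt (fun s => f (x s, y s)) (dr f (x t, y t) * x' + dz f (x t, y t) * y') t := by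
  have := hf.hasFDerivAt.comp_hasDerivAt t (hx.prodMk hy)
  rwa [fderiv_apply_eq hf] at this

lemma hasDerivAt_dr {f : ℝ × ℝ → ℝ} {p : ℝ × ℝ} (hf : DifferentiableAt ℝ f p) :
    HasDerivAt (fun t => f (t, p.2)) (dr f p) p.1 := by
  simpa using hasDerivAt_comp_curve (x := fun t => t) (y := fun _ => p.2) (t := p.1) hf
    (hasDerivAt_id _) (hasDerivAt_const _ _)

lemma hasDerivAt_dz {f : ℝ × ℝ → ℝ} {p : ℝ × ℝ} (hf : DifferentiableAt ℝ f p) :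
    HasDerivAt (fun t => f (p.1, t)) (dz f p) p.2 := by
  simpa using hasDerivAt_comp_curve (x := fun _ => p.1) (y := fun t => t) (t := p.2) hf
    (hasDerivAt_const _ _) (hasDerivAt_id _)

lemma contDiffOn_dz {f : ℝ × ℝ → ℝ} {U : Set (ℝ × ℝ)} {n m : WithTop ℕ∞} (hU : IsOpen U)
    (hf : ContDiffOn ℝ n f U) (hmn : m + 1 ≤ n) : ContDiffOn ℝ m (dz f) U := by
  have h := (hf.fderiv_of_isOpen hU hmn).clm_apply
    (contDiffOn_const (c := ((0 : ℝ), (1 : ℝ))))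
  refine h.congr fun p hp => dz_eq_fderiv ?_
  exact (hf.differentiableOn (by rintro rfl; simp at hmn)).differentiableAt (hU.mem_nhds hp)

lemma continuous_dz {f : ℝ × ℝ → ℝ} (hf : ContDiff ℝ 1 f) : Continuous (dz f) :=
  contDiff_zero.1 (contDiffOn_univ.1
    (contDiffOn_dz isOpen_univ hf.contDiffOn (by simp)))

/-- Continuity of both partials gives strict differentiability, and the total derivative is
assembled continuously from them. This is how the flow and the integral of the decay rate along it
are shown to be C¹ jointly in time and label. -/
lemma contDiff_one_of_partials {f f₁ f₂ : ℝ × ℝ → ℝ}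
    (h₁ : ∀ p : ℝ × ℝ, HasDerivAt (fun t => f (t, p.2)) (f₁ p) p.1)
    (h₂ : ∀ p : ℝ × ℝ, HasDerivAt (fun t => f (p.1, t)) (f₂ p) p.2)
    (c₁ : Continuous f₁) (c₂ : Continuous f₂) : ContDiff ℝ 1 f := by
  let g : ℝ → ℝ → (ℝ →L[ℝ] ℝ) := fun a b => ContinuousLinearMap.toSpanSingleton ℝ (f₁ (a, b))
  let g' : ℝ → ℝ → (ℝ →L[ℝ] ℝ) := fun a b => ContinuousLinearMap.toSpanSingleton ℝ (f₂ (a, b))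
  have hg : Continuous (Function.uncurry g) :=
    (ContinuousLinearMap.toSpanSingletonCLE (𝕜 := ℝ) (E := ℝ)).continuous.comp c₁
  have hg' : Continuous (Function.uncurry g') :=
    (ContinuousLinearMap.toSpanSingletonCLE (𝕜 := ℝ) (E := ℝ)).continuous.comp c₂
  have key : ∀ u, HasStrictFDerivAt f ((g u.1 u.2).coprod (g' u.1 u.2)) u := fun u =>
    hasStrictFDerivAt_uncurry_coprod (f := fun a b => f (a, b)) (f₁ := g) (f₂ := g')
      (Eventually.of_forall fun v => (h₁ v).hasFDerivAt)
      (Eventually.of_forall fun v => (h₂ v).hasFDerivAt) hg.continuousAt hg'.continuousAt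
  rw [contDiff_one_iff_fderiv]
  refine ⟨fun u => (key u).hasFDerivAt.differentiableAt, ?_⟩
  have : fderiv ℝ f = fun u => (g u.1 u.2).coprod (g' u.1 u.2) :=
    funext fun u => (key u).hasFDerivAt.fderiv
  rw [this]
  exact (ContinuousLinearMap.coprodEquivL ℝ).continuous.comp (hg.prodMk hg')

/-- The shear `(u, v) ↦ (u, b u + a v)` as a linear equivalence. -/
def shearEquiv (b a : ℝ) (ha : a ≠ 0) : (ℝ × ℝ) ≃L[ℝ] (ℝ × ℝ) :=
  ContinuousLinearEquiv.equivOfInverse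
    ((ContinuousLinearMap.fst ℝ ℝ ℝ).prod
      (b • ContinuousLinearMap.fst ℝ ℝ ℝ + a • ContinuousLinearMap.snd ℝ ℝ ℝ))
    ((ContinuousLinearMap.fst ℝ ℝ ℝ).prod
      (a⁻¹ • (ContinuousLinearMap.snd ℝ ℝ ℝ - b • ContinuousLinearMap.fst ℝ ℝ ℝ)))
    (fun p => by ext <;> simp [field]) (fun p => by ext <;> simp [field])

/-- The fibrewise inverse of `(x, y) ↦ (x, f (x, y))` is as smooth as `f`. -/
lemma contDiffOn_fiber_inverse {f g : ℝ × ℝ → ℝ} {U V : Set (ℝ × ℝ)} {n : WithTop ℕ∞}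
    (hn : n ≠ 0) (hU : IsOpen U) (hV : IsOpen V) (hf : ContDiffOn ℝ n f U)
    (hf' : ∀ p ∈ U, dz f p ≠ 0) (hgU : ∀ y ∈ V, (y.1, g y) ∈ U)
    (hfg : ∀ y ∈ V, f (y.1, g y) = y.2)
    (hinj : ∀ p ∈ U, ∀ q ∈ U, p.1 = q.1 → f p = f q → p = q) : ContDiffOn ℝ n g V := by
  intro y hy
  refine ContDiffAt.contDiffWithinAt ?_
  set a : ℝ × ℝ := (y.1, g y)
  have ha : a ∈ U := hgU y hy
  have hfa : ContDiffAt ℝ n f a := hf.contDiffAt (hU.mem_nhds ha)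
  have hda : DifferentiableAt ℝ f a := hfa.differentiableAt hn
  let Φ : ℝ × ℝ → ℝ × ℝ := fun p => (p.1, f p)
  have hΦ : ContDiffAt ℝ n Φ a := contDiffAt_fst.prodMk hfa
  have hΦ' : HasFDerivAt Φ (shearEquiv (dr f a) (dz f a) (hf' a ha) : ℝ × ℝ →L[ℝ] ℝ × ℝ) a := by
    refine (hasFDerivAt_fst.prodMk hda.hasFDerivAt).congr_fderiv ?_
    refine ContinuousLinearMap.ext fun p => Prod.ext rfl ?_
    have := fderiv_apply_eq hda p.1 p.2
    simpa [shearEquiv] using this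
  have hΦa : Φ a = y := Prod.ext rfl (hfg y hy)
  have hinv := hΦ.to_localInverse hΦ' hn
  have hstrict := hΦ.hasStrictFDerivAt' hΦ' hn
  -- The local inverse of (x, y) ↦ (x, f (x, y)) preserves the first coordinate, and by injectivity
  -- on fibres its second coordinate is `g` near `y`.
  have hright := hstrict.eventually_right_inverse
  have htend := hstrict.localInverse_tendsto
  rw [hΦa] at hinv hright htend
  have hev : (fun y => (hΦ.localInverse hΦ' hn y).2) =ᶠ[𝓝 y] g := by
    filter_upwards [hright, htend (hU.mem_nhds ha), hV.mem_nhds hy] with x hx hxU hxV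
    have h1 : Φ (hΦ.localInverse hΦ' hn x) = x := hx
    have h2 : (hΦ.localInverse hΦ' hn x) ∈ U := hxU
    have h4 : (hΦ.localInverse hΦ' hn x).1 = x.1 := (Prod.ext_iff.1 h1).1
    have h5 : f (hΦ.localInverse hΦ' hn x) = x.2 := (Prod.ext_iff.1 h1).2
    have h3 := hinj _ h2 _ (hgU x hxV) h4 (h5.trans (hfg x hxV).symm)
    rw [h3]
  exact (contDiffAt_snd.comp y hinv).congr_of_eventuallyEq hev.symm

/-! ### Scalar ordinary differential equations with bounded, globally Lipschitz right-hand side -/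

/-- A solution `y` of `y' = F(t, y)` on the whole line. -/
def IsTrajectory (F : ℝ × ℝ → ℝ) (y : ℝ → ℝ) : Prop := ∀ t, HasDerivAt y (F (t, y t)) t

/-- The assumptions on the right-hand side of the scalar equation `y' = F(t, y)`. -/
structure IsTameField (F : ℝ × ℝ → ℝ) (C K : ℝ) : Prop where
  contDiff : ContDiff ℝ 1 F
  bound : ∀ p, |F p| ≤ C
  dz_bound : ∀ p, |dz F p| ≤ K

lemma contDiff_lipschitz {F : ℝ × ℝ → ℝ} {K : ℝ} (hF : ContDiff ℝ 1 F)
    (hK : ∀ p, |dz F p| ≤ K) (t : ℝ) : LipschitzWith K.toNNReal (fun y => F (t, y)) := by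
  have hK0 : 0 ≤ K := (abs_nonneg _).trans (hK (0, 0))
  have hd : ∀ y, HasDerivAt (fun y => F (t, y)) (dz F (t, y)) y := fun y =>
    hasDerivAt_dz (p := (t, y)) (hF.differentiable one_ne_zero _)
  refine lipschitzWith_of_nnnorm_deriv_le (fun y => (hd y).differentiableAt) fun y => ?_
  rw [(hd y).deriv, ← NNReal.coe_le_coe, coe_nnnorm, Real.coe_toNNReal _ hK0]
  exact hK _

namespace IsTameField

variable {F : ℝ × ℝ → ℝ} {C K : ℝ}

lemma K_nonneg (hF : IsTameField F C K) : 0 ≤ K := (abs_nonneg _).trans (hF.dz_bound (0, 0))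

lemma C_nonneg (hF : IsTameField F C K) : 0 ≤ C := (abs_nonneg _).trans (hF.bound (0, 0))

lemma hasDerivAt (hF : IsTameField F C K) (t y : ℝ) :
    HasDerivAt (fun y => F (t, y)) (dz F (t, y)) y :=
  hasDerivAt_dz (p := (t, y)) (hF.contDiff.differentiable one_ne_zero _)

lemma unique (hF : IsTameField F C K) {y₁ y₂ : ℝ → ℝ} (h₁ : IsTrajectory F y₁)
    (h₂ : IsTrajectory F y₂) {t₀ : ℝ} (h : y₁ t₀ = y₂ t₀) : y₁ = y₂ :=
  ODE_solution_unique_univ (v := fun t y => F (t, y)) (s := fun _ => univ) (K := K.toNNReal)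
    (fun t => (contDiff_lipschitz hF.contDiff hF.dz_bound t).lipschitzOnWith)
    (fun t => ⟨h₁ t, trivial⟩) (fun t => ⟨h₂ t, trivial⟩) h

lemma exists_on_interval (hF : IsTameField F C K) (t₀ y₀ : ℝ) (T : ℝ) (hT : 0 < T) :
    ∃ y : ℝ → ℝ, y t₀ = y₀ ∧
      ∀ t ∈ Ioo (t₀ - T) (t₀ + T), HasDerivAt y (F (t, y t)) t := by
  have hC := hF.C_nonneg
  -- A field bounded by C cannot leave the ball of radius C T in time T, so the Picard–Lindelöf
  -- interval may be as long as desired.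
  have hpl : IsPicardLindelof (fun t y => F (t, y)) (tmin := t₀ - T) (tmax := t₀ + T)
      ⟨t₀, by constructor <;> linarith⟩ y₀ (C * T).toNNReal 0 C.toNNReal K.toNNReal :=
    { lipschitzOnWith := fun t _ =>
        (contDiff_lipschitz hF.contDiff hF.dz_bound t).lipschitzOnWith
      continuousOn := fun y _ =>
        (hF.contDiff.continuous.comp (by fun_prop : Continuous fun t : ℝ => (t, y))).continuousOn
      norm_le := fun t _ y _ => by
        rw [Real.coe_toNNReal _ hC]; exact hF.bound _
      mul_max_le := by
        rw [Real.coe_toNNReal _ hC, Real.coe_toNNReal _ (by positivity)]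
        simp }
  obtain ⟨y, hy0, hy⟩ := hpl.exists_eq_forall_mem_Icc_hasDerivWithinAt₀
  exact ⟨y, hy0, fun t ht => (hy t (Ioo_subset_Icc_self ht)).hasDerivAt (Icc_mem_nhds ht.1 ht.2)⟩

lemma exists_trajectory (hF : IsTameField F C K) (t₀ y₀ : ℝ) :
    ∃ y : ℝ → ℝ, y t₀ = y₀ ∧ IsTrajectory F y := by
  choose Y hY0 hY using fun n : ℕ => hF.exists_on_interval t₀ y₀ (n + 1) (by positivity)
  have hcons : ∀ n m : ℕ, n ≤ m → ∀ t ∈ Ioo (t₀ - (n + 1)) (t₀ + (n + 1)), Y n t = Y m t := by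
    intro n m hnm
    have hnm' : (n : ℝ) ≤ m := by exact_mod_cast hnm
    refine ODE_solution_unique_of_mem_Ioo (v := fun t y => F (t, y)) (s := fun _ => univ)
      (K := K.toNNReal) (t₀ := t₀)
      (fun t _ => (contDiff_lipschitz hF.contDiff hF.dz_bound t).lipschitzOnWith)
      ⟨by linarith [n.cast_nonneg (α := ℝ)], by linarith [n.cast_nonneg (α := ℝ)]⟩
      (fun t ht => ⟨hY n t ht, trivial⟩)
      (fun t ht => ⟨hY m t ⟨by linarith [ht.1], by linarith [ht.2]⟩, trivial⟩)
      ((hY0 n).trans (hY0 m).symm)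
  have hmem : ∀ t : ℝ, t ∈ Ioo (t₀ - (⌈|t - t₀|⌉₊ + 1 : ℝ)) (t₀ + (⌈|t - t₀|⌉₊ + 1)) := by
    intro t
    have h1 := Nat.le_ceil |t - t₀|
    have h2 := neg_abs_le (t - t₀)
    have h3 := le_abs_self (t - t₀)
    constructor <;> linarith
  -- At each time the first solution whose interval certainly contains that time is used; near t it
  -- agrees with the one chosen at t.
  refine ⟨fun t => Y ⌈|t - t₀|⌉₊ t, by simp [hY0], fun t => ?_⟩
  have hev : (fun s => Y ⌈|s - t₀|⌉₊ s) =ᶠ[𝓝 t] Y ⌈|t - t₀|⌉₊ := by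
    filter_upwards [Ioo_mem_nhds (hmem t).1 (hmem t).2] with s hs
    rcases le_total ⌈|s - t₀|⌉₊ ⌈|t - t₀|⌉₊ with h | h
    · exact hcons _ _ h s (hmem s)
    · exact (hcons _ _ h s hs).symm
  exact (hY _ t (hmem t)).congr_of_eventuallyEq hev

/-- The trajectory with value `ξ` at time `0`. -/
def flow (hF : IsTameField F C K) (ξ : ℝ) : ℝ → ℝ := (hF.exists_trajectory 0 ξ).choose

@[simp] lemma flow_zero (hF : IsTameField F C K) (ξ : ℝ) : hF.flow ξ 0 = ξ :=
  (hF.exists_trajectory 0 ξ).choose_spec.1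

lemma flow_trajectory (hF : IsTameField F C K) (ξ : ℝ) : IsTrajectory F (hF.flow ξ) :=
  (hF.exists_trajectory 0 ξ).choose_spec.2

lemma exists_flow_eq (hF : IsTameField F C K) (t y : ℝ) : ∃ ξ, hF.flow ξ t = y := by
  obtain ⟨u, hu0, hu⟩ := hF.exists_trajectory t y
  refine ⟨u 0, ?_⟩
  rw [hF.unique (hF.flow_trajectory (u 0)) hu (t₀ := 0) (by simp), hu0]

lemma flow_injective (hF : IsTameField F C K) (t : ℝ) :
    Function.Injective fun ξ => hF.flow ξ t := by
  intro ξ ξ' h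
  have := congrFun (hF.unique (hF.flow_trajectory ξ) (hF.flow_trajectory ξ') h) 0
  simpa using this

lemma continuous_flow_time (hF : IsTameField F C K) (ξ : ℝ) : Continuous (hF.flow ξ) :=
  continuous_iff_continuousAt.2 fun t => (hF.flow_trajectory ξ t).continuousAt

/-- The slope of `F` between two trajectories. -/
def flowSlope (hF : IsTameField F C K) (ξ ξ' s : ℝ) : ℝ :=
  (F (s, hF.flow ξ' s) - F (s, hF.flow ξ s)) / (hF.flow ξ' s - hF.flow ξ s)

lemma abs_flowSlope_le (hF : IsTameField F C K) (ξ ξ' s : ℝ) : |hF.flowSlope ξ ξ' s| ≤ K := by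
  have h := (contDiff_lipschitz hF.contDiff hF.dz_bound s).dist_le_mul (hF.flow ξ' s) (hF.flow ξ s)
  rw [Real.coe_toNNReal _ hF.K_nonneg, Real.dist_eq, Real.dist_eq] at h
  rw [flowSlope, abs_div]
  -- This form of the estimate also covers coinciding trajectories, where the slope is 0 / 0 = 0.
  exact div_le_of_le_mul₀ (abs_nonneg _) hF.K_nonneg h

lemma continuous_flowSlope (hF : IsTameField F C K) {ξ ξ' : ℝ} (h : ξ ≠ ξ') :
    Continuous (hF.flowSlope ξ ξ') := by
  have c1 := hF.continuous_flow_time ξ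
  have c2 := hF.continuous_flow_time ξ'
  have c := hF.contDiff.continuous
  refine Continuous.div (by fun_prop) (by fun_prop) fun s hs => h ?_
  exact hF.flow_injective s (sub_eq_zero.1 hs).symm

/-- The difference of two solutions of a scalar equation solves a linear equation whose coefficient
is the slope of F between them. The exact formula yields both the Lipschitz dependence on the label
and its differentiability. -/
lemma flow_sub_flow (hF : IsTameField F C K) {ξ ξ' : ℝ} (h : ξ ≠ ξ') (t : ℝ) :
    hF.flow ξ' t - hF.flow ξ t = (ξ' - ξ) * Real.exp (∫ s in (0 : ℝ)..t, hF.flowSlope ξ ξ' s) := by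
  have hc := hF.continuous_flowSlope h
  have hI : ∀ t, HasDerivAt (fun t => ∫ s in (0 : ℝ)..t, hF.flowSlope ξ ξ' s)
      (hF.flowSlope ξ ξ' t) t := fun t => intervalIntegral.integral_hasDerivAt_right
        (hc.intervalIntegrable _ _) (hc.stronglyMeasurableAtFilter _ _) hc.continuousAt
  have hD : ∀ t, HasDerivAt (fun t => (hF.flow ξ' t - hF.flow ξ t) *
      Real.exp (-∫ s in (0 : ℝ)..t, hF.flowSlope ξ ξ' s)) 0 t := by
    intro t
    have hne : hF.flow ξ' t - hF.flow ξ t ≠ 0 := fun hs =>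
      h (hF.flow_injective t (sub_eq_zero.1 hs).symm)
    refine (((hF.flow_trajectory ξ' t).sub (hF.flow_trajectory ξ t)).mul (hI t).neg.exp).congr_deriv
      ?_
    rw [flowSlope]
    field_simp
    simp
  have hconst := is_const_of_deriv_eq_zero (fun t => (hD t).differentiableAt)
    (fun t => (hD t).deriv) t 0
  simp only [flow_zero, intervalIntegral.integral_same, neg_zero, Real.exp_zero, mul_one] at hconst
  rw [← hconst, mul_assoc, ← Real.exp_add]
  simp

lemma abs_flow_sub_flow_le (hF : IsTameField F C K) (ξ ξ' t : ℝ) :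
    |hF.flow ξ' t - hF.flow ξ t| ≤ |ξ' - ξ| * Real.exp (K * |t|) := by
  rcases eq_or_ne ξ ξ' with rfl | h
  · simp
  rw [hF.flow_sub_flow h, abs_mul, Real.abs_exp]
  gcongr
  have := intervalIntegral.norm_integral_le_of_norm_le_const (a := 0) (b := t) (C := K)
    (f := hF.flowSlope ξ ξ') (fun s _ => hF.abs_flowSlope_le ξ ξ' s)
  rw [sub_zero] at this
  exact (le_abs_self _).trans this

lemma continuous_flow (hF : IsTameField F C K) : Continuous fun p : ℝ × ℝ => hF.flow p.2 p.1 := by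
  rw [continuous_iff_continuousAt]
  rintro ⟨t, ξ⟩
  have h1 : Tendsto (fun p : ℝ × ℝ => hF.flow p.2 p.1 - hF.flow ξ p.1) (𝓝 (t, ξ)) (𝓝 0) := by
    refine squeeze_zero_norm (fun p => hF.abs_flow_sub_flow_le ξ p.2 p.1) ?_
    have : Continuous fun p : ℝ × ℝ => |p.2 - ξ| * Real.exp (K * |p.1|) := by fun_prop
    simpa using this.tendsto (t, ξ)
  have h2 : Tendsto (fun p : ℝ × ℝ => hF.flow ξ p.1) (𝓝 (t, ξ)) (𝓝 (hF.flow ξ t)) :=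
    ((hF.continuous_flow_time ξ).comp continuous_fst).tendsto (t, ξ)
  simpa [ContinuousAt] using h1.add h2

/-- The derivative of the flow with respect to the initial value. -/
def jac (hF : IsTameField F C K) (ξ t : ℝ) : ℝ :=
  Real.exp (∫ s in (0 : ℝ)..t, dz F (s, hF.flow ξ s))

lemma continuous_dz_flow (hF : IsTameField F C K) {q : ℝ × ℝ → ℝ} (hq : ContDiff ℝ 1 q) :
    Continuous fun p : ℝ × ℝ => dz q (p.1, hF.flow p.2 p.1) :=
  (continuous_dz hq).comp (continuous_fst.prodMk hF.continuous_flow)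

lemma continuous_jac (hF : IsTameField F C K) : Continuous fun p : ℝ × ℝ => hF.jac p.2 p.1 := by
  refine Real.continuous_exp.comp ?_
  refine intervalIntegral.continuous_parametric_intervalIntegral_of_continuous
    (f := fun (p : ℝ × ℝ) s => dz F (s, hF.flow p.2 s)) ?_ continuous_fst
  exact (hF.continuous_dz_flow hF.contDiff).comp
    (by fun_prop : Continuous fun x : (ℝ × ℝ) × ℝ => (x.2, x.1.2))

lemma hasDerivAt_jac (hF : IsTameField F C K) (ξ t : ℝ) :
    HasDerivAt (hF.jac ξ) (dz F (t, hF.flow ξ t) * hF.jac ξ t) t := by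
  have hc : Continuous fun s => dz F (s, hF.flow ξ s) :=
    (hF.continuous_dz_flow hF.contDiff).comp (by fun_prop : Continuous fun s : ℝ => (s, ξ))
  have := (intervalIntegral.integral_hasDerivAt_right
        (hc.intervalIntegrable 0 t) (hc.stronglyMeasurableAtFilter _ _) hc.continuousAt).exp
  rw [mul_comm]
  exact this

/-- By `flow_sub_flow` the difference quotient is the exponential of an integral of slopes. The
slopes are bounded by K and converge pointwise to ∂_θ F, so dominated convergence suffices and C¹
regularity of F is enough. -/
lemma hasDerivAt_flow (hF : IsTameField F C K) (ξ t : ℝ) :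
    HasDerivAt (fun ξ => hF.flow ξ t) (hF.jac ξ t) ξ := by
  rw [hasDerivAt_iff_tendsto_slope]
  have hlim : Tendsto (fun ξ' => ∫ s in (0 : ℝ)..t, hF.flowSlope ξ ξ' s) (𝓝[≠] ξ)
      (𝓝 (∫ s in (0 : ℝ)..t, dz F (s, hF.flow ξ s))) := by
    refine intervalIntegral.tendsto_integral_filter_of_dominated_convergence (fun _ => K) ?_
      (Eventually.of_forall fun ξ' => Eventually.of_forall fun s _ => hF.abs_flowSlope_le ξ ξ' s)
      intervalIntegrable_const (Eventually.of_forall fun s _ => ?_)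
    · filter_upwards [self_mem_nhdsWithin] with ξ' hξ'
      exact (hF.continuous_flowSlope (Ne.symm hξ')).aestronglyMeasurable
    · have h1 := hasDerivAt_iff_tendsto_slope.1 (hF.hasDerivAt s (hF.flow ξ s))
      have h2 : Tendsto (fun ξ' => hF.flow ξ' s) (𝓝[≠] ξ) (𝓝[≠] (hF.flow ξ s)) := by
        refine tendsto_nhdsWithin_iff.2 ⟨?_, ?_⟩
        · exact ((hF.continuous_flow.comp
            (by fun_prop : Continuous fun x : ℝ => (s, x))).tendsto ξ).mono_left nhdsWithin_le_nhds
        · filter_upwards [self_mem_nhdsWithin] with ξ' hξ' h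
          exact hξ' (hF.flow_injective s h)
      refine (h1.comp h2).congr fun ξ' => ?_
      simp [slope_def_field, flowSlope]
  refine ((Real.continuous_exp.tendsto _).comp hlim).congr' ?_
  filter_upwards [self_mem_nhdsWithin] with ξ' hξ'
  have : ξ' - ξ ≠ 0 := sub_ne_zero.2 hξ'
  rw [slope_def_field, hF.flow_sub_flow (Ne.symm hξ'), Function.comp]
  field_simp

lemma contDiff_flow (hF : IsTameField F C K) : ContDiff ℝ 1 fun p : ℝ × ℝ => hF.flow p.2 p.1 := by
  refine contDiff_one_of_partials (fun p => hF.flow_trajectory p.2 p.1)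
    (fun p => hF.hasDerivAt_flow p.2 p.1) ?_ hF.continuous_jac
  exact hF.contDiff.continuous.comp (continuous_fst.prodMk hF.continuous_flow)

lemma abs_jac_le (hF : IsTameField F C K) (ξ t : ℝ) : |hF.jac ξ t| ≤ Real.exp (K * |t|) := by
  rw [jac, Real.abs_exp]
  gcongr
  have := intervalIntegral.norm_integral_le_of_norm_le_const (a := 0) (b := t) (C := K)
    (f := fun s => dz F (s, hF.flow ξ s)) (fun s _ => hF.dz_bound _)
  rw [sub_zero] at this
  exact (le_abs_self _).trans this

/-- The label at time `0` of the trajectory through a given point. -/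
def label (hF : IsTameField F C K) (p : ℝ × ℝ) : ℝ := (hF.exists_flow_eq p.1 p.2).choose

@[simp] lemma flow_label (hF : IsTameField F C K) (p : ℝ × ℝ) :
    hF.flow (hF.label p) p.1 = p.2 := (hF.exists_flow_eq p.1 p.2).choose_spec

@[simp] lemma label_flow (hF : IsTameField F C K) (ξ t : ℝ) : hF.label (t, hF.flow ξ t) = ξ :=
  hF.flow_injective t (hF.flow_label (t, hF.flow ξ t))

/-- The label inverts the flow fibrewise in time, and the derivative of the flow in the label is an
exponential, hence never zero. -/
lemma contDiff_label (hF : IsTameField F C K) : ContDiff ℝ 1 hF.label := by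
  refine contDiffOn_univ.1 (contDiffOn_fiber_inverse (f := fun p : ℝ × ℝ => hF.flow p.2 p.1)
    (U := univ) (V := univ) one_ne_zero isOpen_univ isOpen_univ hF.contDiff_flow.contDiffOn
    (fun p _ => ?_) (fun _ _ => trivial) (fun y _ => hF.flow_label y) ?_)
  · change deriv (fun ξ => hF.flow ξ p.1) p.2 ≠ 0
    rw [(hF.hasDerivAt_flow p.2 p.1).deriv]
    exact (Real.exp_pos _).ne'
  · rintro ⟨a, b⟩ _ ⟨a', b'⟩ _ h h'
    obtain rfl : a = a' := h
    exact Prod.ext rfl (hF.flow_injective a h')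

lemma hasDerivAt_integral_flow (hF : IsTameField F C K) {q : ℝ × ℝ → ℝ} {K' : ℝ}
    (hq : ContDiff ℝ 1 q) (hq' : ∀ p, |dz q p| ≤ K') (ξ t : ℝ) :
    HasDerivAt (fun ξ => ∫ s in (0 : ℝ)..t, q (s, hF.flow ξ s))
      (∫ s in (0 : ℝ)..t, dz q (s, hF.flow ξ s) * hF.jac ξ s) ξ := by
  have hK' : 0 ≤ K' := (abs_nonneg _).trans (hq' (0, 0))
  have c0 : ∀ ξ, Continuous fun s => q (s, hF.flow ξ s) := fun ξ =>
    hq.continuous.comp (continuous_id.prodMk (hF.continuous_flow_time ξ))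
  have c1 : Continuous fun s => dz q (s, hF.flow ξ s) * hF.jac ξ s :=
    ((hF.continuous_dz_flow hq).comp (by fun_prop : Continuous fun s : ℝ => (s, ξ))).mul
      (hF.continuous_jac.comp (by fun_prop : Continuous fun s : ℝ => (s, ξ)))
  refine (intervalIntegral.hasDerivAt_integral_of_dominated_loc_of_deriv_le
    (F := fun ξ s => q (s, hF.flow ξ s)) (F' := fun ξ s => dz q (s, hF.flow ξ s) * hF.jac ξ s)
    (bound := fun s => K' * Real.exp (K * |s|)) univ_mem
    (Eventually.of_forall fun ξ => (c0 ξ).aestronglyMeasurable)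
    ((c0 ξ).intervalIntegrable _ _) c1.aestronglyMeasurable
    (Eventually.of_forall fun s _ ξ _ => ?_)
    (Continuous.intervalIntegrable (by fun_prop) _ _)
    (Eventually.of_forall fun s _ ξ _ => ?_)).2
  · rw [Real.norm_eq_abs, abs_mul]
    exact mul_le_mul (hq' _) (hF.abs_jac_le _ _) (abs_nonneg _) hK'
  · have h := hasDerivAt_dz (p := (s, hF.flow ξ s)) (hq.differentiable one_ne_zero _)
    exact h.comp ξ (hF.hasDerivAt_flow ξ s)

/-- The Cauchy problem `∂₁ L + F ∂₂ L = -q`, `L (0, ·) = l₀`, together with the equation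
satisfied by `∂₂ L` along the characteristics. -/
theorem exists_transport (hF : IsTameField F C K) {q : ℝ × ℝ → ℝ} {K' : ℝ} (hq : ContDiff ℝ 1 q)
    (hq' : ∀ p, |dz q p| ≤ K') {l₀ : ℝ → ℝ} (hl₀ : ContDiff ℝ 1 l₀) :
    ∃ L : ℝ × ℝ → ℝ, ContDiff ℝ 1 L ∧ (∀ ξ, L (0, ξ) = l₀ ξ) ∧
      (∀ p, dr L p + F p * dz L p = -q p) ∧
      ∀ ξ t, HasDerivAt (fun t => dz L (t, hF.flow ξ t))
        (-dz q (t, hF.flow ξ t) - dz F (t, hF.flow ξ t) * dz L (t, hF.flow ξ t)) t := by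
  set P : ℝ × ℝ → ℝ := fun p => ∫ s in (0 : ℝ)..p.1, q (s, hF.flow p.2 s) with hPdef
  have cq : ∀ ξ, Continuous fun s => q (s, hF.flow ξ s) := fun ξ =>
    hq.continuous.comp (continuous_id.prodMk (hF.continuous_flow_time ξ))
  have cJ : Continuous fun p : ℝ × ℝ => dz q (p.1, hF.flow p.2 p.1) * hF.jac p.2 p.1 :=
    (hF.continuous_dz_flow hq).mul hF.continuous_jac
  have hP₁ : ∀ p : ℝ × ℝ, HasDerivAt (fun t => P (t, p.2)) (q (p.1, hF.flow p.2 p.1)) p.1 :=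
    fun p => intervalIntegral.integral_hasDerivAt_right ((cq p.2).intervalIntegrable _ _)
      ((cq p.2).stronglyMeasurableAtFilter _ _) (cq p.2).continuousAt
  have hP₂ : ∀ p : ℝ × ℝ, HasDerivAt (fun ξ => P (p.1, ξ))
      (∫ s in (0 : ℝ)..p.1, dz q (s, hF.flow p.2 s) * hF.jac p.2 s) p.2 :=
    fun p => hF.hasDerivAt_integral_flow hq hq' p.2 p.1
  have hP : ContDiff ℝ 1 P := by
    refine contDiff_one_of_partials hP₁ hP₂
      (hq.continuous.comp (continuous_fst.prodMk hF.continuous_flow)) ?_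
    refine intervalIntegral.continuous_parametric_intervalIntegral_of_continuous
      (f := fun (p : ℝ × ℝ) s => dz q (s, hF.flow p.2 s) * hF.jac p.2 s) ?_ continuous_fst
    exact cJ.comp (by fun_prop : Continuous fun x : (ℝ × ℝ) × ℝ => (x.2, x.1.2))
  set L : ℝ × ℝ → ℝ := fun p => l₀ (hF.label p) - P (p.1, hF.label p) with hLdef
  have hL : ContDiff ℝ 1 L :=
    (hl₀.comp hF.contDiff_label).sub (hP.comp (contDiff_fst.prodMk hF.contDiff_label))
  have hLd := hL.differentiable one_ne_zero
  have hLflow : ∀ ξ t, L (t, hF.flow ξ t) = l₀ ξ - P (t, ξ) := by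
    intro ξ t; simp [hLdef]
  -- This differentiates L (t, flow) = l₀ ξ - P (t, ξ) in ξ. The right side is differentiable in t,
  -- so ∂₂ L can be differentiated along characteristics although L is only C¹.
  have hLz : ∀ ξ t, dz L (t, hF.flow ξ t) * hF.jac ξ t = deriv l₀ ξ -
      ∫ s in (0 : ℝ)..t, dz q (s, hF.flow ξ s) * hF.jac ξ s := by
    intro ξ t
    have h1 := (hasDerivAt_dz (p := (t, hF.flow ξ t)) (hLd _)).comp ξ (hF.hasDerivAt_flow ξ t)
    have h2 := ((hl₀.differentiable one_ne_zero ξ).hasDerivAt).sub (hP₂ (t, ξ))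
    refine h1.unique (h2.congr_of_eventuallyEq (Eventually.of_forall fun ξ' => ?_))
    exact hLflow ξ' t
  refine ⟨L, hL, fun ξ => ?_, fun p => ?_, fun ξ t => ?_⟩
  · have := hLflow ξ 0
    simpa [hPdef] using this
  · obtain ⟨ξ, hξ⟩ := hF.exists_flow_eq p.1 p.2
    have h1 := hasDerivAt_comp_curve (x := fun t => t) (t := p.1) (hLd (p.1, hF.flow ξ p.1))
      (hasDerivAt_id _) (hF.flow_trajectory ξ p.1)
    have h2 := (hP₁ (p.1, ξ)).const_sub (l₀ ξ)
    have h3 := h1.unique (h2.congr_of_eventuallyEq (Eventually.of_forall fun t => hLflow ξ t))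
    simp only [hξ, Prod.mk.eta] at h3
    linarith
  · have hJ : ∀ t, hF.jac ξ t ≠ 0 := fun t => (Real.exp_pos _).ne'
    have heq : (fun t => dz L (t, hF.flow ξ t)) = fun t => (deriv l₀ ξ -
        ∫ s in (0 : ℝ)..t, dz q (s, hF.flow ξ s) * hF.jac ξ s) / hF.jac ξ t := by
      funext t
      rw [← hLz, mul_div_cancel_right₀ _ (hJ t)]
    have c1 : Continuous fun s => dz q (s, hF.flow ξ s) * hF.jac ξ s :=
      cJ.comp (by fun_prop : Continuous fun s : ℝ => (s, ξ))
    have h1 := intervalIntegral.integral_hasDerivAt_right (c1.intervalIntegrable 0 t)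
      (c1.stronglyMeasurableAtFilter _ _) c1.continuousAt
    have h2 := (h1.const_sub (deriv l₀ ξ)).div (hF.hasDerivAt_jac ξ t) (hJ t)
    rw [heq]
    refine h2.congr_deriv ?_
    rw [← hLz, div_eq_iff (pow_ne_zero 2 (hJ t))]
    ring

end IsTameField

/-! ### Adapted coordinates -/

lemma isOpen_quadrant : IsOpen quadrant :=
  (isOpen_lt continuous_const continuous_fst).inter (isOpen_lt continuous_const continuous_snd)

/-- The function `w = (μ + ψ) z`. -/
def wFun (μ : ℝ) (ψ : ℝ × ℝ → ℝ) (p : ℝ × ℝ) : ℝ := (μ + ψ p) * p.2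

/-- The coefficient `μ + ψ + z ∂_z ψ`, which is `∂_z w`. -/
def aFun (μ : ℝ) (ψ : ℝ × ℝ → ℝ) (p : ℝ × ℝ) : ℝ := μ + ψ p + p.2 * dz ψ p

/-- The coefficient `μ - (d - 1) ψ`. -/
def hFun (d : ℕ) (μ : ℝ) (ψ : ℝ × ℝ → ℝ) (p : ℝ × ℝ) : ℝ := μ - ((d : ℝ) - 1) * ψ p

/-- `sin² σ = r² / (r² + w²)`. -/
def sinSq (μ : ℝ) (ψ : ℝ × ℝ → ℝ) (p : ℝ × ℝ) : ℝ := p.1 ^ 2 / (p.1 ^ 2 + wFun μ ψ p ^ 2)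

/-- `cos² σ = w² / (r² + w²)`. -/
def cosSq (μ : ℝ) (ψ : ℝ × ℝ → ℝ) (p : ℝ × ℝ) : ℝ := wFun μ ψ p ^ 2 / (p.1 ^ 2 + wFun μ ψ p ^ 2)

/-- `sin σ cos σ = r w / (r² + w²)`. -/
def sinCos (μ : ℝ) (ψ : ℝ × ℝ → ℝ) (p : ℝ × ℝ) : ℝ :=
  p.1 * wFun μ ψ p / (p.1 ^ 2 + wFun μ ψ p ^ 2)

/-- Pointwise bounds on a stream function, uniform over the admissible parameters. -/
structure ProfileBounds (d : ℕ) (μ : ℝ) (ψ : ℝ × ℝ → ℝ) (δ c₀ C : ℝ) : Prop where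
  contDiffOn : ContDiffOn ℝ 2 ψ quadrant
  three_le : 3 ≤ d
  δ_pos : 0 < δ
  c₀_pos : 0 < c₀
  c₀_le : c₀ ≤ 1
  C_pos : 0 < C
  δ_le_μ : δ ≤ μ
  μ_le : μ ≤ 1
  pos : ∀ p ∈ quadrant, 0 < ψ p
  le_half : ∀ p ∈ quadrant, ψ p ≤ 1 / 2
  δ_le_h : ∀ p ∈ quadrant, δ ≤ hFun d μ ψ p
  abs_dr_le : ∀ p ∈ quadrant, |p.1 * dr ψ p| ≤ ψ p / 10
  abs_dz_le : ∀ p ∈ quadrant, |p.2 * dz ψ p| ≤ ψ p / 10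
  cos_dr_le : ∀ p ∈ quadrant, cosSq μ ψ p * |p.1 * dr ψ p| ≤ C * (sinCos μ ψ p ^ c₀ * ψ p)
  sin_dz_le : ∀ p ∈ quadrant, sinSq μ ψ p * |p.2 * dz ψ p| ≤ C * (sinCos μ ψ p ^ c₀ * ψ p)
  cos_drdz_le : ∀ p ∈ quadrant,
    cosSq μ ψ p * |p.1 * p.2 * dr (dz ψ) p| ≤ C * (sinCos μ ψ p ^ c₀ * ψ p)
  sin_dzdz_le : ∀ p ∈ quadrant,
    sinSq μ ψ p * |p.2 ^ 2 * dz (dz ψ) p| ≤ C * (sinCos μ ψ p ^ c₀ * ψ p)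
  dr_dzdz_le : ∀ p ∈ quadrant, cosSq μ ψ p * |p.1 * dr ψ p| * |p.2 ^ 2 * dz (dz ψ) p| ≤
    C * (sinCos μ ψ p ^ c₀ * ψ p)

/-- The angle `σ` as a function of `θ = log tan σ`. -/
def angle (θ : ℝ) : ℝ := Real.arctan (Real.exp θ)

lemma angle_mem (θ : ℝ) : angle θ ∈ Ioo 0 (Real.pi / 2) :=
  ⟨Real.arctan_pos.2 (Real.exp_pos _), Real.arctan_lt_pi_div_two _⟩

lemma sin_angle_pos (θ : ℝ) : 0 < Real.sin (angle θ) :=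
  Real.sin_pos_of_pos_of_lt_pi (angle_mem θ).1 (by linarith [(angle_mem θ).2, Real.pi_pos])

lemma cos_angle_pos (θ : ℝ) : 0 < Real.cos (angle θ) := Real.cos_arctan_pos _

lemma sin_angle (θ : ℝ) : Real.sin (angle θ) = Real.exp θ * Real.cos (angle θ) := by
  have h := Real.tan_arctan (Real.exp θ)
  rw [Real.tan_eq_sin_div_cos, div_eq_iff (Real.cos_arctan_pos _).ne'] at h
  exact h

lemma contDiff_angle {n : WithTop ℕ∞} : ContDiff ℝ n angle :=
  Real.contDiff_arctan.comp Real.contDiff_exp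

lemma hasDerivAt_angle (θ : ℝ) :
    HasDerivAt angle (Real.sin (angle θ) * Real.cos (angle θ)) θ := by
  refine ((Real.hasDerivAt_exp θ).arctan).congr_deriv ?_
  rw [sin_angle, mul_assoc, ← sq, angle, Real.cos_sq_arctan]
  ring

lemma hasDerivAt_sin_angle (θ : ℝ) : HasDerivAt (fun θ => Real.sin (angle θ))
    (Real.sin (angle θ) * Real.cos (angle θ) ^ 2) θ :=
  (hasDerivAt_angle θ).sin.congr_deriv (by ring)

lemma hasDerivAt_cos_angle (θ : ℝ) : HasDerivAt (fun θ => Real.cos (angle θ))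
    (-(Real.cos (angle θ) * Real.sin (angle θ) ^ 2)) θ :=
  (hasDerivAt_angle θ).cos.congr_deriv (by ring)

lemma angle_log_tan {σ : ℝ} (hσ : σ ∈ Ioo 0 (Real.pi / 2)) :
    angle (Real.log (Real.tan σ)) = σ := by
  rw [angle, Real.exp_log (Real.tan_pos_of_pos_of_lt_pi_div_two hσ.1 hσ.2)]
  exact Real.arctan_tan (by linarith [hσ.1, Real.pi_pos]) hσ.2

/-! ### Bounds on the coefficients and solvability of w(r, z) = w in z -/

namespace ProfileBounds

variable {d : ℕ} {μ δ c₀ C : ℝ} {ψ : ℝ × ℝ → ℝ}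

lemma three_le_real (hB : ProfileBounds d μ ψ δ c₀ C) : (3 : ℝ) ≤ d := by exact_mod_cast hB.three_le

lemma μ_pos (hB : ProfileBounds d μ ψ δ c₀ C) : 0 < μ := hB.δ_pos.trans_le hB.δ_le_μ

lemma δ_le_k (hB : ProfileBounds d μ ψ δ c₀ C) {p : ℝ × ℝ} (hp : p ∈ quadrant) :
    δ ≤ μ + ψ p := by linarith [hB.pos p hp, hB.δ_le_μ]

lemma k_pos (hB : ProfileBounds d μ ψ δ c₀ C) {p : ℝ × ℝ} (hp : p ∈ quadrant) :
    0 < μ + ψ p := hB.δ_pos.trans_le (hB.δ_le_k hp)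

lemma k_le (hB : ProfileBounds d μ ψ δ c₀ C) {p : ℝ × ℝ} (hp : p ∈ quadrant) :
    μ + ψ p ≤ 2 := by linarith [hB.le_half p hp, hB.μ_le]

lemma δ_le_a (hB : ProfileBounds d μ ψ δ c₀ C) {p : ℝ × ℝ} (hp : p ∈ quadrant) :
    δ ≤ aFun μ ψ p := by
  have := abs_le.1 (hB.abs_dz_le p hp)
  rw [aFun]; linarith [hB.pos p hp, hB.δ_le_μ]

lemma a_pos (hB : ProfileBounds d μ ψ δ c₀ C) {p : ℝ × ℝ} (hp : p ∈ quadrant) :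
    0 < aFun μ ψ p := hB.δ_pos.trans_le (hB.δ_le_a hp)

lemma a_le (hB : ProfileBounds d μ ψ δ c₀ C) {p : ℝ × ℝ} (hp : p ∈ quadrant) :
    aFun μ ψ p ≤ 2 := by
  have := abs_le.1 (hB.abs_dz_le p hp)
  rw [aFun]; linarith [hB.le_half p hp, hB.μ_le]

lemma h_pos (hB : ProfileBounds d μ ψ δ c₀ C) {p : ℝ × ℝ} (hp : p ∈ quadrant) :
    0 < hFun d μ ψ p := hB.δ_pos.trans_le (hB.δ_le_h p hp)

lemma w_pos (hB : ProfileBounds d μ ψ δ c₀ C) {p : ℝ × ℝ} (hp : p ∈ quadrant) :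
    0 < wFun μ ψ p := mul_pos (hB.k_pos hp) hp.2

lemma differentiableAt (hB : ProfileBounds d μ ψ δ c₀ C) {p : ℝ × ℝ} (hp : p ∈ quadrant) :
    DifferentiableAt ℝ ψ p :=
  (hB.contDiffOn.differentiableOn two_ne_zero).differentiableAt (isOpen_quadrant.mem_nhds hp)

lemma contDiffOn_w (hB : ProfileBounds d μ ψ δ c₀ C) : ContDiffOn ℝ 2 (wFun μ ψ) quadrant :=
  (contDiffOn_const.add hB.contDiffOn).mul contDiffOn_snd

lemma contDiffOn_dzψ (hB : ProfileBounds d μ ψ δ c₀ C) : ContDiffOn ℝ 1 (dz ψ) quadrant :=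
  contDiffOn_dz isOpen_quadrant hB.contDiffOn (by norm_num)

lemma dz_differentiableAt (hB : ProfileBounds d μ ψ δ c₀ C) {p : ℝ × ℝ} (hp : p ∈ quadrant) :
    DifferentiableAt ℝ (dz ψ) p :=
  (hB.contDiffOn_dzψ.differentiableOn one_ne_zero).differentiableAt (isOpen_quadrant.mem_nhds hp)

lemma hasDerivAt_w_z (hB : ProfileBounds d μ ψ δ c₀ C) {p : ℝ × ℝ} (hp : p ∈ quadrant) :
    HasDerivAt (fun t => wFun μ ψ (p.1, t)) (aFun μ ψ p) p.2 := by
  refine (((hasDerivAt_dz (hB.differentiableAt hp)).const_add μ).mul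
    (hasDerivAt_id p.2)).congr_deriv ?_
  simp only [aFun, id, mul_one]; ring

lemma strictMonoOn_w (hB : ProfileBounds d μ ψ δ c₀ C) {r : ℝ} (hr : 0 < r) :
    StrictMonoOn (fun t => wFun μ ψ (r, t)) (Ioi 0) := by
  refine strictMonoOn_of_deriv_pos (convex_Ioi 0) (fun t ht => ?_) fun t ht => ?_
  · exact (hB.hasDerivAt_w_z (p := (r, t)) ⟨hr, ht⟩).continuousAt.continuousWithinAt
  · rw [interior_Ioi] at ht
    rw [(hB.hasDerivAt_w_z (p := (r, t)) ⟨hr, ht⟩).deriv]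
    exact hB.a_pos ⟨hr, ht⟩

lemma exists_z (hB : ProfileBounds d μ ψ δ c₀ C) {r w : ℝ} (hr : 0 < r) (hw : 0 < w) :
    ∃ z, 0 < z ∧ wFun μ ψ (r, z) = w := by
  have hδ := hB.δ_pos
  -- Since δ ≤ μ + ψ ≤ 2, the height sought lies between w / 2 and w / δ.
  have hcont : ContinuousOn (fun t => wFun μ ψ (r, t)) (Icc (w / 2) (w / δ)) := fun t ht =>
    (hB.hasDerivAt_w_z (p := (r, t))
      ⟨hr, lt_of_lt_of_le (by positivity) ht.1⟩).continuousAt.continuousWithinAt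
  have h2 : (r, w / 2) ∈ quadrant := ⟨hr, half_pos hw⟩
  have h3 : (r, w / δ) ∈ quadrant := ⟨hr, div_pos hw hδ⟩
  have hle : w / 2 ≤ w / δ := by
    have : δ ≤ 2 := hB.δ_le_μ.trans (hB.μ_le.trans (by norm_num))
    gcongr
  have hlow : wFun μ ψ (r, w / 2) ≤ w := by
    have := mul_le_mul_of_nonneg_right (hB.k_le h2) (half_pos hw).le
    simp only [wFun]; linarith
  have hupp : w ≤ wFun μ ψ (r, w / δ) := by
    have := mul_le_mul_of_nonneg_right (hB.δ_le_k h3) (div_pos hw hδ).le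
    rw [mul_div_cancel₀ _ hδ.ne'] at this
    exact this
  obtain ⟨z, hz, hzw⟩ := intermediate_value_Icc hle hcont ⟨hlow, hupp⟩
  exact ⟨z, lt_of_lt_of_le (by positivity) hz.1, hzw⟩

end ProfileBounds

open Classical in
/-- The height `z` of the point with given `r` and `w`. -/
def zInv (μ : ℝ) (ψ : ℝ × ℝ → ℝ) (p : ℝ × ℝ) : ℝ :=
  if h : ∃ z, 0 < z ∧ wFun μ ψ (p.1, z) = p.2 then h.choose else 1

/-- The point of the quadrant with coordinates `(τ, θ)`. -/
def toQuad (μ : ℝ) (ψ : ℝ × ℝ → ℝ) (x : ℝ × ℝ) : ℝ × ℝ :=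
  (Real.exp x.1 * Real.sin (angle x.2),
    zInv μ ψ (Real.exp x.1 * Real.sin (angle x.2), Real.exp x.1 * Real.cos (angle x.2)))

/-- The coordinates `(τ, θ) = (log (r² + w²) / 2, log (r / w))`. -/
def ofQuad (μ : ℝ) (ψ : ℝ × ℝ → ℝ) (p : ℝ × ℝ) : ℝ × ℝ :=
  (Real.log (p.1 ^ 2 + wFun μ ψ p ^ 2) / 2, Real.log p.1 - Real.log (wFun μ ψ p))

namespace ProfileBounds

variable {d : ℕ} {μ δ c₀ C : ℝ} {ψ : ℝ × ℝ → ℝ}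

lemma zInv_spec (hB : ProfileBounds d μ ψ δ c₀ C) {p : ℝ × ℝ} (hp : p ∈ quadrant) :
    0 < zInv μ ψ p ∧ wFun μ ψ (p.1, zInv μ ψ p) = p.2 := by
  have h := hB.exists_z hp.1 hp.2
  rw [zInv, dif_pos h]
  exact h.choose_spec

lemma zInv_unique (hB : ProfileBounds d μ ψ δ c₀ C) {r z : ℝ} (hr : 0 < r) (hz : 0 < z) :
    zInv μ ψ (r, wFun μ ψ (r, z)) = z := by
  have h := hB.zInv_spec (p := (r, wFun μ ψ (r, z))) ⟨hr, hB.w_pos (p := (r, z)) ⟨hr, hz⟩⟩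
  exact (hB.strictMonoOn_w hr).injOn h.1 hz h.2

lemma contDiffOn_zInv (hB : ProfileBounds d μ ψ δ c₀ C) : ContDiffOn ℝ 2 (zInv μ ψ) quadrant := by
  refine contDiffOn_fiber_inverse two_ne_zero isOpen_quadrant isOpen_quadrant hB.contDiffOn_w
    (fun p hp => ?_) (fun y hy => ⟨hy.1, (hB.zInv_spec hy).1⟩) (fun y hy => (hB.zInv_spec hy).2) ?_
  · change deriv (fun t => wFun μ ψ (p.1, t)) p.2 ≠ 0
    rw [(hB.hasDerivAt_w_z hp).deriv]
    exact (hB.a_pos hp).ne'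
  · rintro ⟨r, z⟩ hp ⟨r', z'⟩ hq h h'
    obtain rfl : r = r' := h
    exact Prod.ext rfl ((hB.strictMonoOn_w hp.1).injOn hp.2 hq.2 h')

lemma polar_mem (x : ℝ × ℝ) : (Real.exp x.1 * Real.sin (angle x.2),
    Real.exp x.1 * Real.cos (angle x.2)) ∈ quadrant :=
  ⟨mul_pos (Real.exp_pos _) (sin_angle_pos _), mul_pos (Real.exp_pos _) (cos_angle_pos _)⟩

lemma toQuad_mem (hB : ProfileBounds d μ ψ δ c₀ C) (x : ℝ × ℝ) : toQuad μ ψ x ∈ quadrant :=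
  ⟨(polar_mem x).1, (hB.zInv_spec (polar_mem x)).1⟩

lemma toQuad_fst (x : ℝ × ℝ) : (toQuad μ ψ x).1 = Real.exp x.1 * Real.sin (angle x.2) := rfl

lemma w_toQuad (hB : ProfileBounds d μ ψ δ c₀ C) (x : ℝ × ℝ) :
    wFun μ ψ (toQuad μ ψ x) = Real.exp x.1 * Real.cos (angle x.2) :=
  (hB.zInv_spec (polar_mem x)).2

lemma contDiff_toQuad (hB : ProfileBounds d μ ψ δ c₀ C) : ContDiff ℝ 2 (toQuad μ ψ) := by
  have h1 : ContDiff ℝ 2 fun x : ℝ × ℝ => Real.exp x.1 * Real.sin (angle x.2) :=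
    (Real.contDiff_exp.comp contDiff_fst).mul
      (Real.contDiff_sin.comp (contDiff_angle.comp contDiff_snd))
  have h2 : ContDiff ℝ 2 fun x : ℝ × ℝ => Real.exp x.1 * Real.cos (angle x.2) :=
    (Real.contDiff_exp.comp contDiff_fst).mul
      (Real.contDiff_cos.comp (contDiff_angle.comp contDiff_snd))
  exact h1.prodMk (contDiffOn_univ.1
    (hB.contDiffOn_zInv.comp (h1.prodMk h2).contDiffOn fun x _ => polar_mem x))

lemma sq_add_sq_toQuad (hB : ProfileBounds d μ ψ δ c₀ C) (x : ℝ × ℝ) :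
    (toQuad μ ψ x).1 ^ 2 + wFun μ ψ (toQuad μ ψ x) ^ 2 = Real.exp x.1 ^ 2 := by
  rw [hB.w_toQuad, toQuad_fst, mul_pow, mul_pow, ← mul_add, Real.sin_sq_add_cos_sq, mul_one]

lemma sinSq_toQuad (hB : ProfileBounds d μ ψ δ c₀ C) (x : ℝ × ℝ) :
    sinSq μ ψ (toQuad μ ψ x) = Real.sin (angle x.2) ^ 2 := by
  rw [sinSq, hB.sq_add_sq_toQuad, toQuad_fst, mul_pow,
    mul_div_cancel_left₀ _ (pow_ne_zero 2 (Real.exp_pos _).ne')]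

lemma cosSq_toQuad (hB : ProfileBounds d μ ψ δ c₀ C) (x : ℝ × ℝ) :
    cosSq μ ψ (toQuad μ ψ x) = Real.cos (angle x.2) ^ 2 := by
  rw [cosSq, hB.sq_add_sq_toQuad, hB.w_toQuad, mul_pow,
    mul_div_cancel_left₀ _ (pow_ne_zero 2 (Real.exp_pos _).ne')]

lemma sinCos_toQuad (hB : ProfileBounds d μ ψ δ c₀ C) (x : ℝ × ℝ) :
    sinCos μ ψ (toQuad μ ψ x) = Real.sin (angle x.2) * Real.cos (angle x.2) := by
  have := (Real.exp_pos x.1).ne'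
  rw [sinCos, hB.sq_add_sq_toQuad, hB.w_toQuad, toQuad_fst]
  field_simp

lemma ofQuad_toQuad (hB : ProfileBounds d μ ψ δ c₀ C) (x : ℝ × ℝ) :
    ofQuad μ ψ (toQuad μ ψ x) = x := by
  have hs := sin_angle_pos x.2
  have hc := cos_angle_pos x.2
  refine Prod.ext ?_ ?_
  · change Real.log _ / 2 = _
    rw [hB.sq_add_sq_toQuad, Real.log_pow, Real.log_exp]
    push_cast; ring
  · change Real.log _ - Real.log _ = _
    rw [hB.w_toQuad, toQuad_fst, Real.log_mul (Real.exp_pos _).ne' hs.ne',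
      Real.log_mul (Real.exp_pos _).ne' hc.ne', sin_angle, Real.log_mul (Real.exp_pos _).ne' hc.ne',
      Real.log_exp, Real.log_exp]
    ring

lemma toQuad_ofQuad (hB : ProfileBounds d μ ψ δ c₀ C) {p : ℝ × ℝ} (hp : p ∈ quadrant) :
    toQuad μ ψ (ofQuad μ ψ p) = p := by
  have hw := hB.w_pos hp
  have hr := hp.1
  have hρ : 0 < p.1 ^ 2 + wFun μ ψ p ^ 2 := by positivity
  have hexp : Real.exp (ofQuad μ ψ p).1 = √(p.1 ^ 2 + wFun μ ψ p ^ 2) := by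
    rw [ofQuad, Real.sqrt_eq_rpow, Real.rpow_def_of_pos hρ]
    congr 1; ring
  have hq : Real.exp (ofQuad μ ψ p).2 = p.1 / wFun μ ψ p := by
    rw [ofQuad, Real.exp_sub, Real.exp_log hr, Real.exp_log hw]
  have hcos : Real.cos (angle (ofQuad μ ψ p).2) = wFun μ ψ p / √(p.1 ^ 2 + wFun μ ψ p ^ 2) := by
    rw [angle, Real.cos_arctan, hq, div_pow,
      show 1 + p.1 ^ 2 / wFun μ ψ p ^ 2 = (p.1 ^ 2 + wFun μ ψ p ^ 2) / wFun μ ψ p ^ 2 by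
        field_simp; ring, Real.sqrt_div hρ.le, Real.sqrt_sq hw.le, one_div_div]
  have hsq : 0 < √(p.1 ^ 2 + wFun μ ψ p ^ 2) := Real.sqrt_pos.2 hρ
  have h1 : Real.exp (ofQuad μ ψ p).1 * Real.cos (angle (ofQuad μ ψ p).2) = wFun μ ψ p := by
    rw [hexp, hcos]; field_simp
  have h2 : Real.exp (ofQuad μ ψ p).1 * Real.sin (angle (ofQuad μ ψ p).2) = p.1 := by
    rw [sin_angle, mul_left_comm, h1, hq]; field_simp
  rw [toQuad, h1, h2]
  exact Prod.ext rfl (hB.zInv_unique hp.1 hp.2)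

lemma contDiffOn_ofQuad (hB : ProfileBounds d μ ψ δ c₀ C) :
    ContDiffOn ℝ 2 (ofQuad μ ψ) quadrant := by
  have hw := hB.contDiffOn_w
  refine ContDiffOn.prodMk ?_ ?_
  · refine ContDiffOn.div_const (ContDiffOn.log ((contDiffOn_fst.pow 2).add (hw.pow 2))
      fun p hp => ?_) 2
    have := hB.w_pos hp
    positivity
  · exact (contDiffOn_fst.log fun p hp => hp.1.ne').sub (hw.log fun p hp => (hB.w_pos hp).ne')

/-- Differentiation of `toQuad` along a curve in the `(τ, θ)`-plane. -/
lemma hasDerivAt_toQuad_fst {x y : ℝ → ℝ} {x' y' t : ℝ}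
    (hx : HasDerivAt x x' t) (hy : HasDerivAt y y' t) :
    HasDerivAt (fun t => (toQuad μ ψ (x t, y t)).1)
      ((toQuad μ ψ (x t, y t)).1 * (x' + Real.cos (angle (y t)) ^ 2 * y')) t := by
  refine (hx.exp.mul ((hasDerivAt_sin_angle (y t)).comp t hy)).congr_deriv ?_
  simp only [toQuad_fst, Function.comp]; ring

/-- The height is given only implicitly. Differentiating w = e^τ cos σ along the curve gives a
linear equation for z', whose coefficient is ∂_z w > 0. -/
lemma hasDerivAt_toQuad_snd (hB : ProfileBounds d μ ψ δ c₀ C) {x y : ℝ → ℝ} {x' y' t : ℝ}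
    (hx : HasDerivAt x x' t) (hy : HasDerivAt y y' t) {P : ℝ × ℝ} (hP : toQuad μ ψ (x t, y t) = P) :
    HasDerivAt (fun t => (toQuad μ ψ (x t, y t)).2)
      (P.2 * ((μ + ψ P) * (x' - Real.sin (angle (y t)) ^ 2 * y') -
        P.1 * dr ψ P * (x' + Real.cos (angle (y t)) ^ 2 * y')) / aFun μ ψ P) t := by
  subst hP
  set P := toQuad μ ψ (x t, y t)
  have hPq : P ∈ quadrant := hB.toQuad_mem _
  have hz : DifferentiableAt ℝ (fun t => (toQuad μ ψ (x t, y t)).2) t := by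
    have h1 := (hB.contDiff_toQuad.snd.differentiable two_ne_zero (x t, y t)).hasFDerivAt
    exact (h1.comp_hasDerivAt t (hx.prodMk hy)).differentiableAt
  have hr := hasDerivAt_toQuad_fst (μ := μ) (ψ := ψ) hx hy
  have h1 := ((hasDerivAt_comp_curve (f := ψ) (hB.differentiableAt hPq) hr hz.hasDerivAt).const_add
    μ).mul hz.hasDerivAt
  have h2 : HasDerivAt (fun t => Real.exp (x t) * Real.cos (angle (y t)))
      (wFun μ ψ P * (x' - Real.sin (angle (y t)) ^ 2 * y')) t := by
    refine (hx.exp.mul ((hasDerivAt_cos_angle (y t)).comp t hy)).congr_deriv ?_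
    simp only [P, hB.w_toQuad, Function.comp]; ring
  have h3 := h1.unique (h2.congr_of_eventuallyEq (Eventually.of_forall fun s => ?_))
  · refine hz.hasDerivAt.congr_deriv ?_
    rw [eq_div_iff (hB.a_pos hPq).ne']
    simp only [wFun, aFun, P, Prod.mk.eta] at h3 ⊢
    linear_combination h3
  · exact hB.w_toQuad (x s, y s)

end ProfileBounds

/-! ### The characteristic equation in the adapted coordinates -/

/-- `sin² σ (μ + ψ) + cos² σ (μ - (d - 1) ψ)` at the point with coordinates `x = (τ, θ)`. -/
def dnFun (d : ℕ) (μ : ℝ) (ψ : ℝ × ℝ → ℝ) (x : ℝ × ℝ) : ℝ :=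
  μ + ψ (toQuad μ ψ x) - Real.cos (angle x.2) ^ 2 * (d * ψ (toQuad μ ψ x))

/-- The right-hand side of the characteristic equation `dθ/dτ = F(τ, θ)`. -/
def fField (d : ℕ) (μ : ℝ) (ψ : ℝ × ℝ → ℝ) (x : ℝ × ℝ) : ℝ :=
  d * ψ (toQuad μ ψ x) / dnFun d μ ψ x

/-- The decay rate of `log Ω` along characteristics. -/
def qField (d : ℕ) (μ : ℝ) (ψ : ℝ × ℝ → ℝ) (x : ℝ × ℝ) : ℝ :=
  (μ + ψ (toQuad μ ψ x)) / (aFun μ ψ (toQuad μ ψ x) * dnFun d μ ψ x)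

/-- The weight `(sin σ cos σ)^c₀`. -/
def weight (c₀ θ : ℝ) : ℝ := (Real.sin (angle θ) * Real.cos (angle θ)) ^ c₀

lemma sin_mul_cos_angle_pos (θ : ℝ) : 0 < Real.sin (angle θ) * Real.cos (angle θ) :=
  mul_pos (sin_angle_pos θ) (cos_angle_pos θ)

lemma sin_mul_cos_angle_le (θ : ℝ) : Real.sin (angle θ) * Real.cos (angle θ) ≤ 1 :=
  mul_le_one₀ (Real.sin_le_one _) (cos_angle_pos θ).le (Real.cos_le_one _)

lemma weight_pos (c₀ θ : ℝ) : 0 < weight c₀ θ := Real.rpow_pos_of_pos (sin_mul_cos_angle_pos θ) _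

lemma weight_le_one {c₀ : ℝ} (h : 0 ≤ c₀) (θ : ℝ) : weight c₀ θ ≤ 1 :=
  Real.rpow_le_one (sin_mul_cos_angle_pos θ).le (sin_mul_cos_angle_le θ) h

lemma sin_sq_mul_cos_sq_le_weight {c₀ : ℝ} (h : c₀ ≤ 1) (θ : ℝ) :
    Real.sin (angle θ) ^ 2 * Real.cos (angle θ) ^ 2 ≤ weight c₀ θ := by
  rw [← mul_pow, ← Real.rpow_natCast]
  exact Real.rpow_le_rpow_of_exponent_ge (sin_mul_cos_angle_pos θ) (sin_mul_cos_angle_le θ)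
    (by push_cast; linarith)

/-- A bounded primitive of a majorant of `weight c₀`. -/
def potential (c₀ θ : ℝ) : ℝ := 2 / c₀ * Real.arctan (Real.exp (c₀ * θ))

/-- In terms of θ the weight is e^{c₀θ} / (1 + e^{2θ})^c₀, while the potential has derivative 2
e^{c₀θ} / (1 + e^{2c₀θ}). The latter is larger because both 1 and e^{2c₀θ} are at most (1 +
e^{2θ})^c₀. -/
lemma exists_hasDerivAt_potential {c₀ : ℝ} (h0 : 0 < c₀) (θ : ℝ) :
    ∃ D, HasDerivAt (potential c₀) D θ ∧ weight c₀ θ ≤ D := by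
  refine ⟨_, ((((hasDerivAt_id θ).const_mul c₀).exp).arctan).const_mul (2 / c₀), ?_⟩
  have hE := Real.exp_pos θ
  have h1 : weight c₀ θ = Real.exp (c₀ * θ) / (1 + Real.exp θ ^ 2) ^ c₀ := by
    rw [weight, sin_angle, mul_assoc, ← sq, angle, Real.cos_sq_arctan,
      mul_one_div, Real.div_rpow hE.le (by positivity), ← Real.exp_mul, mul_comm θ]
  have h2 : 1 + Real.exp (c₀ * θ) ^ 2 ≤ 2 * (1 + Real.exp θ ^ 2) ^ c₀ := by
    have e1 : (1 : ℝ) ≤ (1 + Real.exp θ ^ 2) ^ c₀ :=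
      Real.one_le_rpow (by nlinarith) h0.le
    have e2 : Real.exp (c₀ * θ) ^ 2 ≤ (1 + Real.exp θ ^ 2) ^ c₀ := by
      have : Real.exp (c₀ * θ) ^ 2 = (Real.exp θ ^ 2) ^ c₀ := by
        rw [← Real.exp_nat_mul, ← Real.exp_nat_mul, ← Real.exp_mul]
        congr 1; ring
      rw [this]
      exact Real.rpow_le_rpow (by positivity) (by linarith) h0.le
    linarith
  rw [h1]
  have hEc := Real.exp_pos (c₀ * θ)
  have hp : 0 < (1 + Real.exp θ ^ 2) ^ c₀ := Real.rpow_pos_of_pos (by positivity) _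
  simp only [id, mul_one]
  have : 2 / c₀ * (1 / (1 + Real.exp (c₀ * θ) ^ 2) * (Real.exp (c₀ * θ) * c₀)) =
      2 * Real.exp (c₀ * θ) / (1 + Real.exp (c₀ * θ) ^ 2) := by field_simp
  rw [this, div_le_div_iff₀ hp (by positivity)]
  nlinarith

lemma potential_mem {c₀ : ℝ} (h0 : 0 < c₀) (θ : ℝ) :
    potential c₀ θ ∈ Icc 0 (Real.pi / c₀) := by
  have h1 := (Real.arctan_pos.2 (Real.exp_pos (c₀ * θ))).le
  have h2 := (Real.arctan_lt_pi_div_two (Real.exp (c₀ * θ))).le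
  refine ⟨by unfold potential; positivity, ?_⟩
  calc potential c₀ θ ≤ 2 / c₀ * (Real.pi / 2) := by unfold potential; gcongr
    _ = _ := by ring

/-! ### Comparison of variations and of the rates in the characteristic equation -/

lemma sub_le_of_deriv_le {f g : ℝ → ℝ} {f' g' : ℝ → ℝ} {s t : ℝ} (hst : s ≤ t)
    (hf : ∀ u, HasDerivAt f (f' u) u) (hg : ∀ u, HasDerivAt g (g' u) u)
    (h : ∀ u ∈ Icc s t, f' u ≤ g' u) : f t - f s ≤ g t - g s := by
  have hm : MonotoneOn (fun u => g u - f u) (Icc s t) := by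
    refine monotoneOn_of_deriv_nonneg (convex_Icc _ _)
      (fun u _ => ((hg u).sub (hf u)).continuousAt.continuousWithinAt)
      (fun u _ => ((hg u).sub (hf u)).differentiableAt.differentiableWithinAt) fun u hu => ?_
    change 0 ≤ deriv (g - f) u
    rw [((hg u).sub (hf u)).deriv]
    exact sub_nonneg.2 (h u (interior_subset hu))
  have := hm (left_mem_Icc.2 hst) (right_mem_Icc.2 hst) hst
  simp only at this
  linarith

lemma abs_sub_le_of_abs_deriv_le {f g : ℝ → ℝ} {f' g' : ℝ → ℝ} {s t : ℝ} (hst : s ≤ t)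
    (hf : ∀ u, HasDerivAt f (f' u) u) (hg : ∀ u, HasDerivAt g (g' u) u)
    (h : ∀ u ∈ Icc s t, |f' u| ≤ g' u) : |f t - f s| ≤ g t - g s := by
  have h1 := sub_le_of_deriv_le hst hf hg fun u hu => (abs_le.1 (h u hu)).2
  have h2 := sub_le_of_deriv_le hst (fun u => (hf u).neg) hg
    fun u hu => by linarith [(abs_le.1 (h u hu)).1]
  rw [abs_le]
  simp only [Pi.neg_apply] at h2
  constructor <;> linarith

/-- The constant in the bounds on `∂_θ F` and `∂_θ q`. -/
def rateConst (d : ℕ) (δ C : ℝ) : ℝ :=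
  (8 * d * C / δ + d * ((1 + d) * (4 * C / δ) + 2 * d)) / δ ^ 2 +
    (60 * C / δ + 4 * ((1 + d) * (4 * C / δ) + 2 * d)) / δ ^ 4

namespace ProfileBounds

variable {d : ℕ} {μ δ c₀ C : ℝ} {ψ : ℝ × ℝ → ℝ}

lemma δ_le_one (hB : ProfileBounds d μ ψ δ c₀ C) : δ ≤ 1 := hB.δ_le_μ.trans hB.μ_le

lemma dn_eq (x : ℝ × ℝ) : dnFun d μ ψ x =
    Real.sin (angle x.2) ^ 2 * (μ + ψ (toQuad μ ψ x)) +
      Real.cos (angle x.2) ^ 2 * hFun d μ ψ (toQuad μ ψ x) := by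
  rw [Real.sin_sq, dnFun, hFun]; ring

lemma δ_le_dn (hB : ProfileBounds d μ ψ δ c₀ C) (x : ℝ × ℝ) : δ ≤ dnFun d μ ψ x := by
  rw [dn_eq]
  have h1 := mul_le_mul_of_nonneg_left (hB.δ_le_k (hB.toQuad_mem x))
    (sq_nonneg (Real.sin (angle x.2)))
  have h2 := mul_le_mul_of_nonneg_left (hB.δ_le_h _ (hB.toQuad_mem x))
    (sq_nonneg (Real.cos (angle x.2)))
  have h3 := Real.sin_sq_add_cos_sq (angle x.2)
  calc δ = Real.sin (angle x.2) ^ 2 * δ + Real.cos (angle x.2) ^ 2 * δ := by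
        rw [← add_mul, h3, one_mul]
    _ ≤ _ := add_le_add h1 h2

lemma dn_pos (hB : ProfileBounds d μ ψ δ c₀ C) (x : ℝ × ℝ) : 0 < dnFun d μ ψ x :=
  hB.δ_pos.trans_le (hB.δ_le_dn x)

lemma dn_le (hB : ProfileBounds d μ ψ δ c₀ C) (x : ℝ × ℝ) : dnFun d μ ψ x ≤ 2 := by
  have h1 := hB.k_le (hB.toQuad_mem x)
  have h2 := hB.pos _ (hB.toQuad_mem x)
  have : 0 ≤ Real.cos (angle x.2) ^ 2 * (d * ψ (toQuad μ ψ x)) := by positivity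
  rw [dnFun]; linarith

/-- The denominator D is at most 2, hence below d. This makes θ increase at least at the rate ψ,
which allows integrals of ψ in τ to be replaced by integrals in θ. -/
lemma ψ_le_fField (hB : ProfileBounds d μ ψ δ c₀ C) (x : ℝ × ℝ) :
    ψ (toQuad μ ψ x) ≤ fField d μ ψ x := by
  have h2 := hB.pos _ (hB.toQuad_mem x)
  have h3 := hB.three_le_real
  rw [fField, le_div_iff₀ (hB.dn_pos x)]
  nlinarith [hB.dn_le x]

lemma fField_pos (hB : ProfileBounds d μ ψ δ c₀ C) (x : ℝ × ℝ) : 0 < fField d μ ψ x :=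
  (hB.pos _ (hB.toQuad_mem x)).trans_le (hB.ψ_le_fField x)

lemma fField_le (hB : ProfileBounds d μ ψ δ c₀ C) (x : ℝ × ℝ) :
    fField d μ ψ x ≤ d / δ * ψ (toQuad μ ψ x) := by
  have h2 := hB.pos _ (hB.toQuad_mem x)
  have h3 := hB.three_le_real
  have hδ := hB.δ_pos
  rw [fField, div_mul_eq_mul_div]
  gcongr
  exact hB.δ_le_dn x

lemma contDiff_ψ_toQuad (hB : ProfileBounds d μ ψ δ c₀ C) :
    ContDiff ℝ 1 fun x => ψ (toQuad μ ψ x) :=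
  contDiffOn_univ.1 ((hB.contDiffOn.comp hB.contDiff_toQuad.contDiffOn
    fun x _ => hB.toQuad_mem x).of_le (by norm_num))

lemma contDiffOn_a (hB : ProfileBounds d μ ψ δ c₀ C) : ContDiffOn ℝ 1 (aFun μ ψ) quadrant :=
  (contDiffOn_const.add (hB.contDiffOn.of_le (by norm_num))).add
    (contDiffOn_snd.mul hB.contDiffOn_dzψ)

lemma contDiff_a_toQuad (hB : ProfileBounds d μ ψ δ c₀ C) :
    ContDiff ℝ 1 fun x => aFun μ ψ (toQuad μ ψ x) :=
  contDiffOn_univ.1 (hB.contDiffOn_a.comp (hB.contDiff_toQuad.of_le (by norm_num)).contDiffOn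
    fun x _ => hB.toQuad_mem x)

lemma contDiff_dn (hB : ProfileBounds d μ ψ δ c₀ C) : ContDiff ℝ 1 (dnFun d μ ψ) :=
  (contDiff_const.add hB.contDiff_ψ_toQuad).sub
    (((Real.contDiff_cos.comp (contDiff_angle.comp contDiff_snd)).pow 2).mul
      (contDiff_const.mul hB.contDiff_ψ_toQuad))

lemma contDiff_fField (hB : ProfileBounds d μ ψ δ c₀ C) : ContDiff ℝ 1 (fField d μ ψ) :=
  (contDiff_const.mul hB.contDiff_ψ_toQuad).div hB.contDiff_dn fun x => (hB.dn_pos x).ne'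

lemma contDiff_qField (hB : ProfileBounds d μ ψ δ c₀ C) : ContDiff ℝ 1 (qField d μ ψ) :=
  (contDiff_const.add hB.contDiff_ψ_toQuad).div (hB.contDiff_a_toQuad.mul hB.contDiff_dn)
    fun x => (mul_pos (hB.a_pos (hB.toQuad_mem x)) (hB.dn_pos x)).ne'

/-- The derivative of `ψ` along a curve in the `(τ, θ)`-plane. -/
lemma hasDerivAt_ψ_toQuad (hB : ProfileBounds d μ ψ δ c₀ C) {x y : ℝ → ℝ} {x' y' t : ℝ}
    (hx : HasDerivAt x x' t) (hy : HasDerivAt y y' t) {P : ℝ × ℝ} (hP : toQuad μ ψ (x t, y t) = P) :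
    HasDerivAt (fun t => ψ (toQuad μ ψ (x t, y t)))
      (P.1 * dr ψ P * (x' + Real.cos (angle (y t)) ^ 2 * y') +
        P.2 * dz ψ P * (((μ + ψ P) * (x' - Real.sin (angle (y t)) ^ 2 * y') -
        P.1 * dr ψ P * (x' + Real.cos (angle (y t)) ^ 2 * y')) / aFun μ ψ P)) t := by
  subst hP
  refine (hasDerivAt_comp_curve (f := ψ) (hB.differentiableAt (hB.toQuad_mem (x t, y t)))
    (hasDerivAt_toQuad_fst (μ := μ) (ψ := ψ) hx hy)
    (hB.hasDerivAt_toQuad_snd hx hy rfl)).congr_deriv ?_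
  simp only [Prod.mk.eta]
  ring

/-- Derivatives of the coefficients with respect to `θ`. -/
lemma exists_deriv_theta (hB : ProfileBounds d μ ψ δ c₀ C) (x : ℝ × ℝ) :
    ∃ ψ' a' : ℝ, HasDerivAt (fun θ => ψ (toQuad μ ψ (x.1, θ))) ψ' x.2 ∧
      HasDerivAt (fun θ => aFun μ ψ (toQuad μ ψ (x.1, θ))) a' x.2 ∧
      |ψ'| ≤ 4 * C / δ * (weight c₀ x.2 * ψ (toQuad μ ψ x)) ∧
      |a'| ≤ 11 * C / δ * (weight c₀ x.2 * ψ (toQuad μ ψ x)) := by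
  obtain ⟨τ, θ⟩ := x
  have hP := hB.toQuad_mem (τ, θ)
  have hx : HasDerivAt (fun _ : ℝ => τ) 0 θ := hasDerivAt_const _ _
  have hy : HasDerivAt (fun t : ℝ => t) 1 θ := hasDerivAt_id _
  have b1 := hB.cos_dr_le _ hP
  have b2 := hB.sin_dz_le _ hP
  have b3 := hB.cos_drdz_le _ hP
  have b4 := hB.sin_dzdz_le _ hP
  have b5 := hB.dr_dzdz_le _ hP
  rw [hB.cosSq_toQuad, hB.sinCos_toQuad] at b1 b3 b5
  rw [hB.sinSq_toQuad, hB.sinCos_toQuad] at b2 b4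
  have hψ := hB.hasDerivAt_ψ_toQuad hx hy rfl
  have hr := hasDerivAt_toQuad_fst (μ := μ) (ψ := ψ) hx hy
  have hz := hB.hasDerivAt_toQuad_snd hx hy rfl
  have hzz := hasDerivAt_comp_curve (f := dz ψ) (hB.dz_differentiableAt hP) hr hz
  have ha := (hψ.const_add μ).add (hz.mul hzz)
  refine ⟨_, _, hψ, ha, ?_⟩
  have hk := hB.k_le hP
  have hk0 := hB.k_pos hP
  have hA := hB.δ_le_a hP
  have hA0 := hB.a_pos hP
  have hδ := hB.δ_pos
  have hδ1 := hB.δ_le_one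
  have hC := hB.C_pos
  have d1 : |(toQuad μ ψ (τ, θ)).2 * dz ψ (toQuad μ ψ (τ, θ))| ≤ 1 := by
    linarith [hB.abs_dz_le _ hP, hB.le_half _ hP]
  have hψpos := hB.pos _ hP
  have hW : 0 ≤ weight c₀ θ * ψ (toQuad μ ψ (τ, θ)) := mul_nonneg (weight_pos _ _).le hψpos.le
  simp only [Prod.mk.eta, zero_add, mul_one, zero_sub, ← weight.eq_1] at *
  set P := toQuad μ ψ (τ, θ)
  set W := weight c₀ θ * ψ P
  set s2 := Real.sin (angle θ) ^ 2
  set c2 := Real.cos (angle θ) ^ 2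
  have hs2 : 0 ≤ s2 := sq_nonneg _
  have hc2 : 0 ≤ c2 := sq_nonneg _
  set X := P.1 * dr ψ P
  set Z := P.2 * dz ψ P
  set k := μ + ψ P
  set A := aFun μ ψ P
  -- `kap` is the θ-derivative of log z at fixed τ. Its numerator has a part carrying sin² σ and a
  -- part carrying cos² σ r ∂_r ψ, whence the two hypotheses in the next claim; for Y = z² ∂_z² ψ
  -- the second one is the field `dr_dzdz_le`.
  set kap := (k * -s2 - X * c2) / A
  have hkap : ∀ Y : ℝ, s2 * |Y| ≤ C * W → c2 * |X| * |Y| ≤ C * W →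
      |Y * kap| ≤ 3 * C / δ * W := by
    intro Y h1 h2
    rw [abs_mul, abs_div, abs_of_pos hA0]
    have e1 : |k * -s2 - X * c2| ≤ 2 * s2 + c2 * |X| := by
      refine (abs_sub _ _).trans (add_le_add ?_ ?_)
      · rw [abs_mul, abs_neg, abs_of_pos hk0, abs_of_nonneg hs2]
        exact mul_le_mul_of_nonneg_right hk hs2
      · rw [abs_mul, abs_of_nonneg hc2, mul_comm]
    calc |Y| * (|k * -s2 - X * c2| / A) ≤ |Y| * ((2 * s2 + c2 * |X|) / δ) := by gcongr
      _ = (2 * (s2 * |Y|) + c2 * |X| * |Y|) / δ := by ring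
      _ ≤ (2 * (C * W) + C * W) / δ := by gcongr
      _ = _ := by ring
  have hδW : C * W ≤ C / δ * W := by
    gcongr
    rw [le_div_iff₀ hδ]
    nlinarith
  have eZ := hkap Z b2 ((mul_le_of_le_one_right (mul_nonneg hc2 (abs_nonneg _)) d1).trans b1)
  have eX : |X * c2| ≤ C / δ * W := by
    rw [abs_mul, abs_of_nonneg hc2, mul_comm]
    exact b1.trans hδW
  have eψ : |X * c2 + Z * kap| ≤ 4 * C / δ * W := by
    refine (abs_add_le _ _).trans ((add_le_add eX eZ).trans (le_of_eq ?_))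
    ring
  refine ⟨eψ, ?_⟩
  have ezz := hkap _ b4 b5
  have erz : |c2 * (P.1 * P.2 * dr (dz ψ) P)| ≤ C / δ * W := by
    rw [abs_mul, abs_of_nonneg hc2]
    exact b3.trans hδW
  have hexp : X * c2 + Z * kap + (P.2 * (k * -s2 - X * c2) / A * dz ψ P + P.2 *
      (dr (dz ψ) P * (P.1 * c2) + dz (dz ψ) P * (P.2 * (k * -s2 - X * c2) / A))) =
      (X * c2 + Z * kap) + Z * kap + c2 * (P.1 * P.2 * dr (dz ψ) P) +
        P.2 ^ 2 * dz (dz ψ) P * kap := by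
    simp only [Z, kap]; ring
  rw [hexp]
  refine (abs_add_le _ _).trans ((add_le_add ((abs_add_le _ _).trans (add_le_add
    ((abs_add_le _ _).trans (add_le_add eψ eZ)) erz)) ezz).trans (le_of_eq ?_))
  ring

end ProfileBounds

/-! ### θ-derivatives of F and q, and bounded variation along characteristics -/

lemma hasDerivAt_cos_angle_sq (θ : ℝ) : HasDerivAt (fun θ => Real.cos (angle θ) ^ 2)
    (-(2 * (Real.sin (angle θ) ^ 2 * Real.cos (angle θ) ^ 2))) θ := by
  refine ((hasDerivAt_cos_angle θ).pow 2).congr_deriv ?_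
  push_cast; ring

namespace ProfileBounds

variable {d : ℕ} {μ δ c₀ C : ℝ} {ψ : ℝ × ℝ → ℝ}

/-- Both fields are quotients with denominators bounded below by powers of δ, and the θ-derivatives
of ψ and A are O(weight · ψ) by `exists_deriv_theta`. The derivative of cos² σ inside D contributes
sin² σ cos² σ ψ, which the weight dominates. -/
lemma abs_dz_fField_and_qField_le (hB : ProfileBounds d μ ψ δ c₀ C) (x : ℝ × ℝ) :
    |dz (fField d μ ψ) x| ≤ rateConst d δ C * (weight c₀ x.2 * ψ (toQuad μ ψ x)) ∧
    |dz (qField d μ ψ) x| ≤ rateConst d δ C * (weight c₀ x.2 * ψ (toQuad μ ψ x)) := by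
  obtain ⟨ψ', a', hψ, ha, bψ, ba⟩ := hB.exists_deriv_theta x
  obtain ⟨τ, θ⟩ := x
  have hP := hB.toQuad_mem (τ, θ)
  have hk := hB.k_le hP
  have hk0 := hB.k_pos hP
  have hA := hB.δ_le_a hP
  have hA0 := hB.a_pos hP
  have hA2 := hB.a_le hP
  have hD := hB.δ_le_dn (τ, θ)
  have hD0 := hB.dn_pos (τ, θ)
  have hD2 := hB.dn_le (τ, θ)
  have hδ := hB.δ_pos
  have hC := hB.C_pos
  have hψpos := hB.pos _ hP
  have hψ2 := hB.le_half _ hP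
  have hd := hB.three_le_real
  have hW : 0 ≤ weight c₀ θ * ψ (toQuad μ ψ (τ, θ)) := mul_nonneg (weight_pos _ _).le hψpos.le
  have hn := ((hψ.const_add μ).sub ((hasDerivAt_cos_angle_sq θ).mul (hψ.const_mul (d : ℝ))))
  have hf := (hψ.const_mul (d : ℝ)).div hn hD0.ne'
  have hq := (hψ.const_add μ).div (ha.mul hn) (mul_pos hA0 hD0).ne'
  have ef : dz (fField d μ ψ) (τ, θ) = _ := hf.deriv
  have eq : dz (qField d μ ψ) (τ, θ) = _ := hq.deriv
  rw [ef, eq]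
  have hsc : Real.sin (angle θ) ^ 2 * Real.cos (angle θ) ^ 2 * ψ (toQuad μ ψ (τ, θ)) ≤
      weight c₀ θ * ψ (toQuad μ ψ (τ, θ)) :=
    mul_le_mul_of_nonneg_right (sin_sq_mul_cos_sq_le_weight hB.c₀_le θ) hψpos.le
  have hc1 : Real.cos (angle θ) ^ 2 ≤ 1 := Real.cos_sq_le_one _
  have hc0 : 0 ≤ Real.cos (angle θ) ^ 2 := sq_nonneg _
  have hs0 : 0 ≤ Real.sin (angle θ) ^ 2 := sq_nonneg _
  change |_ / dnFun d μ ψ (τ, θ) ^ 2| ≤ _ ∧ |_ / (aFun μ ψ (toQuad μ ψ (τ, θ)) *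
    dnFun d μ ψ (τ, θ)) ^ 2| ≤ _
  change |(_ * dnFun d μ ψ (τ, θ) - _) / _| ≤ _ ∧ |(_ * (_ * dnFun d μ ψ (τ, θ)) - _ *
    (_ * dnFun d μ ψ (τ, θ) + _)) / _| ≤ _
  simp only at hf bψ ba hn ⊢
  set P := toQuad μ ψ (τ, θ)
  set W := weight c₀ θ * ψ P
  set s2 := Real.sin (angle θ) ^ 2
  set c2 := Real.cos (angle θ) ^ 2
  set A := aFun μ ψ P
  set D := dnFun d μ ψ (τ, θ)
  set n' := ψ' - (-(2 * (s2 * c2)) * (d * ψ P) + c2 * (d * ψ'))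
  set E := 4 * C / δ with hE
  set N := (1 + d) * E + 2 * d with hN
  have hE0 : 0 ≤ E := by positivity
  have hN0 : 0 ≤ N := by positivity
  have bn : |n'| ≤ N * W := by
    have e : n' = (1 - c2 * d) * ψ' + 2 * d * (s2 * c2 * ψ P) := by simp only [n']; ring
    have e1 : |1 - c2 * d| ≤ 1 + d := by
      rw [abs_le]; constructor <;> nlinarith
    have e2 : |2 * d * (s2 * c2 * ψ P)| ≤ 2 * d * W := by
      rw [abs_of_nonneg (by positivity)]; gcongr
    rw [e]
    refine (abs_add_le _ _).trans ?_
    rw [abs_mul]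
    calc _ ≤ (1 + d) * (E * W) + 2 * d * W := by gcongr
      _ = _ := by ring
  have bψ' : |ψ'| ≤ E * W := bψ
  have hterm1 : 0 ≤ (8 * d * C / δ + d * N) / δ ^ 2 := by positivity
  have hterm2 : 0 ≤ (60 * C / δ + 4 * N) / δ ^ 4 := by positivity
  have hrate : rateConst d δ C = (8 * d * C / δ + d * N) / δ ^ 2 +
    (60 * C / δ + 4 * N) / δ ^ 4 := rfl
  constructor
  · have hnum : |d * ψ' * D - d * ψ P * n'| ≤ (8 * d * C / δ + d * N) * W := by
      refine (abs_sub _ _).trans ?_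
      rw [abs_mul, abs_mul, abs_mul, abs_of_pos hD0, abs_of_nonneg (by positivity : (0 : ℝ) ≤ d),
        abs_of_nonneg (by positivity : (0 : ℝ) ≤ d * ψ P)]
      calc _ ≤ d * (E * W) * 2 + d * 1 * (N * W) := by gcongr; linarith
        _ = _ := by rw [hE]; ring
    rw [abs_div, abs_of_pos (pow_pos hD0 2)]
    calc _ ≤ (8 * d * C / δ + d * N) * W / δ ^ 2 := by gcongr
      _ = (8 * d * C / δ + d * N) / δ ^ 2 * W := by ring
      _ ≤ _ := by rw [hrate]; gcongr; linarith
  · have hnum : |ψ' * (A * D) - (μ + ψ P) * (a' * D + A * n')| ≤ (60 * C / δ + 4 * N) * W := by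
      refine (abs_sub _ _).trans ?_
      rw [abs_mul, abs_mul (μ + ψ P), abs_of_pos hk0, abs_of_pos (mul_pos hA0 hD0)]
      have e3 : |a' * D + A * n'| ≤ 11 * C / δ * W * 2 + 2 * (N * W) := by
        refine (abs_add_le _ _).trans ?_
        rw [abs_mul, abs_mul, abs_of_pos hD0, abs_of_pos hA0]
        gcongr
      calc _ ≤ E * W * (2 * 2) + 2 * (11 * C / δ * W * 2 + 2 * (N * W)) := by gcongr
        _ = _ := by rw [hE]; ring
    rw [abs_div, abs_of_pos (pow_pos (mul_pos hA0 hD0) 2)]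
    calc _ ≤ (60 * C / δ + 4 * N) * W / (δ * δ) ^ 2 := by gcongr
      _ = (60 * C / δ + 4 * N) / δ ^ 4 * W := by ring
      _ ≤ _ := by rw [hrate]; gcongr; linarith

lemma rateConst_nonneg (hB : ProfileBounds d μ ψ δ c₀ C) : 0 ≤ rateConst d δ C := by
  have := hB.δ_pos
  have := hB.C_pos
  unfold rateConst; positivity

lemma weight_mul_ψ_le (hB : ProfileBounds d μ ψ δ c₀ C) (x : ℝ × ℝ) :
    weight c₀ x.2 * ψ (toQuad μ ψ x) ≤ 1 := by
  have h1 := hB.le_half _ (hB.toQuad_mem x)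
  have h2 := hB.pos _ (hB.toQuad_mem x)
  exact mul_le_one₀ (weight_le_one hB.c₀_pos.le _) h2.le (by linarith)

lemma isTameField (hB : ProfileBounds d μ ψ δ c₀ C) :
    IsTameField (fField d μ ψ) (d / δ) (rateConst d δ C) where
  contDiff := hB.contDiff_fField
  bound x := by
    have hδ := hB.δ_pos
    have h1 := hB.le_half _ (hB.toQuad_mem x)
    rw [abs_of_pos (hB.fField_pos x)]
    refine (hB.fField_le x).trans (mul_le_of_le_one_right (by positivity) (by linarith))
  dz_bound x := (hB.abs_dz_fField_and_qField_le x).1.trans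
    (mul_le_of_le_one_right hB.rateConst_nonneg (hB.weight_mul_ψ_le x))

lemma abs_dz_qField_le (hB : ProfileBounds d μ ψ δ c₀ C) (x : ℝ × ℝ) :
    |dz (qField d μ ψ) x| ≤ rateConst d δ C :=
  (hB.abs_dz_fField_and_qField_le x).2.trans
    (mul_le_of_le_one_right hB.rateConst_nonneg (hB.weight_mul_ψ_le x))

/-- A function varying along a characteristic no faster than `c ψ (sin σ cos σ)^c₀` has
bounded variation. -/
lemma abs_sub_le_of_weight (hB : ProfileBounds d μ ψ δ c₀ C) {y : ℝ → ℝ}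
    (hy : IsTrajectory (fField d μ ψ) y) {f f' : ℝ → ℝ} {c : ℝ} (hc : 0 ≤ c)
    (hf : ∀ t, HasDerivAt f (f' t) t)
    (hf' : ∀ t, |f' t| ≤ c * (weight c₀ (y t) * ψ (toQuad μ ψ (t, y t)))) (s t : ℝ) :
    |f t - f s| ≤ c * (Real.pi / c₀) := by
  wlog hst : s ≤ t generalizing s t
  · rw [abs_sub_comm]; exact this t s (le_of_not_ge hst)
  choose D hD hDw using exists_hasDerivAt_potential hB.c₀_pos
  have hg : ∀ u, HasDerivAt (fun u => c * potential c₀ (y u))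
      (c * (D (y u) * fField d μ ψ (u, y u))) u := fun u => ((hD (y u)).comp u (hy u)).const_mul c
  refine (abs_sub_le_of_abs_deriv_le hst hf hg fun u _ => (hf' u).trans ?_).trans ?_
  -- The chain rule gives the potential the factor θ' = F ≥ ψ along the trajectory, so its
  -- derivative dominates weight · ψ.
  · have h1 := hB.ψ_le_fField (u, y u)
    have h2 := hB.pos _ (hB.toQuad_mem (u, y u))
    have h3 := weight_pos c₀ (y u)
    have h4 := hDw (y u)
    gcongr
    exact h3.le.trans h4
  · have h1 := potential_mem hB.c₀_pos (y s)
    have h2 := potential_mem hB.c₀_pos (y t)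
    rw [← mul_sub]
    gcongr
    linarith [h1.1, h2.2]

/-- The bound on the transversal logarithmic derivative along a characteristic. -/
lemma abs_le_of_transport (hB : ProfileBounds d μ ψ δ c₀ C) {y : ℝ → ℝ}
    (hy : IsTrajectory (fField d μ ψ) y) {n : ℝ → ℝ}
    (hn : ∀ t, HasDerivAt n (-dz (qField d μ ψ) (t, y t) - dz (fField d μ ψ) (t, y t) * n t) t)
    (t : ℝ) : |n t| ≤ (1 + |n 0|) * Real.exp (3 * rateConst d δ C * (Real.pi / c₀)) := by
  have hR := hB.rateConst_nonneg
  have hpos : ∀ t, 0 < 1 + n t ^ 2 := fun t => by positivity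
  -- log (1 + n²) is a smooth substitute for log (1 + |n|). The linear equation for n bounds its
  -- derivative by 3 · rate · weight · ψ.
  have hl : ∀ t, HasDerivAt (fun t => Real.log (1 + n t ^ 2)) (((2 : ℕ) : ℝ) * n t ^ (2 - 1) *
      (-dz (qField d μ ψ) (t, y t) - dz (fField d μ ψ) (t, y t) * n t) / (1 + n t ^ 2)) t := fun t =>
    (((hn t).pow 2).const_add 1).log (hpos t).ne'
  have hvar := hB.abs_sub_le_of_weight hy (c := 3 * rateConst d δ C) (by positivity) hl
    (fun t => ?_) 0 t
  · have h1 := (le_abs_self _).trans hvar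
    have h2 : 1 + n t ^ 2 ≤
        (1 + n 0 ^ 2) * Real.exp (3 * rateConst d δ C * (Real.pi / c₀)) := by
      rw [← Real.log_le_log_iff (hpos t) (mul_pos (hpos 0) (Real.exp_pos _)),
        Real.log_mul (hpos 0).ne' (Real.exp_pos _).ne', Real.log_exp]
      linarith
    have hE : 1 ≤ Real.exp (3 * rateConst d δ C * (Real.pi / c₀)) :=
      Real.one_le_exp (by have := hB.c₀_pos; positivity)
    refine abs_le_of_sq_le_sq ?_ (by positivity)
    set E := Real.exp (3 * rateConst d δ C * (Real.pi / c₀))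
    have h3 : 1 + n 0 ^ 2 ≤ (1 + |n 0|) ^ 2 := by nlinarith [abs_nonneg (n 0), sq_abs (n 0)]
    calc n t ^ 2 ≤ (1 + n 0 ^ 2) * E := by linarith
      _ ≤ (1 + |n 0|) ^ 2 * E ^ 2 := by gcongr; nlinarith
      _ = _ := by ring
  · obtain ⟨b1, b2⟩ := hB.abs_dz_fField_and_qField_le (t, y t)
    simp only at b1 b2
    set W := weight c₀ (y t) * ψ (toQuad μ ψ (t, y t))
    have hW : 0 ≤ W := mul_nonneg (weight_pos _ _).le (hB.pos _ (hB.toQuad_mem _)).le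
    rw [abs_div, abs_of_pos (hpos t), div_le_iff₀ (hpos t)]
    have e : |-dz (qField d μ ψ) (t, y t) - dz (fField d μ ψ) (t, y t) * n t| ≤
        rateConst d δ C * W + rateConst d δ C * W * |n t| := by
      refine (abs_sub _ _).trans ?_
      rw [abs_neg, abs_mul]
      gcongr
    have h0 := abs_nonneg (n t)
    simp only [Nat.cast_ofNat, Nat.add_one_sub_one, pow_one, abs_mul, abs_two]
    calc 2 * |n t| * |-dz (qField d μ ψ) (t, y t) - dz (fField d μ ψ) (t, y t) * n t|
        ≤ 2 * |n t| * (rateConst d δ C * W + rateConst d δ C * W * |n t|) := by gcongr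
      _ = rateConst d δ C * W * (2 * |n t| + 2 * |n t| ^ 2) := by ring
      _ ≤ rateConst d δ C * W * (3 * (1 + n t ^ 2)) := by
          gcongr
          nlinarith [sq_abs (n t), sq_nonneg (|n t| - 1)]
      _ = _ := by ring

end ProfileBounds

/-! ### Approximate solutions along characteristics -/

/-- The logarithm of `r^{-(d-1)/(dμ)} w^{-1/(dμ)}`. -/
def logG (d : ℕ) (μ : ℝ) (ψ : ℝ × ℝ → ℝ) (p : ℝ × ℝ) : ℝ :=
  -(((d : ℝ) - 1) / (d * μ)) * Real.log p.1 - 1 / (d * μ) * Real.log (wFun μ ψ p)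

/-- The constant in the comparison of `log Ω` with `logG`. -/
def varConst (δ c₀ C : ℝ) : ℝ :=
  (C / δ ^ 2 + 2 * C / δ ^ 3 + 4 / δ ^ 3) * (Real.pi / c₀) + 2 / δ ^ 2

namespace ProfileBounds

variable {d : ℕ} {μ δ c₀ C : ℝ} {ψ : ℝ × ℝ → ℝ} {y : ℝ → ℝ}

lemma d_pos (hB : ProfileBounds d μ ψ δ c₀ C) : (0 : ℝ) < d := by linarith [hB.three_le_real]

/-- Along characteristics (log r)' = (μ + ψ) / D and, by the next lemma, (log w)' = (μ - (d - 1) ψ)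
/ D. No derivative of ψ appears, and every comparison function is built from these two rates. -/
lemma hasDerivAt_log_r (hB : ProfileBounds d μ ψ δ c₀ C) (hy : IsTrajectory (fField d μ ψ) y)
    (t : ℝ) : HasDerivAt (fun t => Real.log (toQuad μ ψ (t, y t)).1)
      ((μ + ψ (toQuad μ ψ (t, y t))) / dnFun d μ ψ (t, y t)) t := by
  have hr := (hB.toQuad_mem (t, y t)).1
  refine ((hasDerivAt_toQuad_fst (μ := μ) (ψ := ψ) (hasDerivAt_id t) (hy t)).log
    hr.ne').congr_deriv ?_
  have hD := (hB.dn_pos (t, y t)).ne'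
  simp only [id]
  rw [mul_div_cancel_left₀ _ hr.ne', fField]
  field_simp
  rw [dnFun]; ring

lemma hasDerivAt_log_w (hB : ProfileBounds d μ ψ δ c₀ C) (hy : IsTrajectory (fField d μ ψ) y)
    (t : ℝ) : HasDerivAt (fun t => Real.log (wFun μ ψ (toQuad μ ψ (t, y t))))
      (hFun d μ ψ (toQuad μ ψ (t, y t)) / dnFun d μ ψ (t, y t)) t := by
  have h : HasDerivAt (fun t => t + Real.log (Real.cos (angle (y t)))) _ t :=
    (hasDerivAt_id t).add
      (((hasDerivAt_cos_angle (y t)).comp t (hy t)).log (cos_angle_pos (y t)).ne')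
  refine (h.congr_of_eventuallyEq (Eventually.of_forall fun s => ?_)).congr_deriv ?_
  · rw [hB.w_toQuad, Real.log_mul (Real.exp_pos _).ne' (cos_angle_pos _).ne', Real.log_exp]
  · have hD := (hB.dn_pos (t, y t)).ne'
    have hc := (cos_angle_pos (y t)).ne'
    simp only [Function.comp, fField]
    field_simp
    rw [dnFun, hFun, Real.sin_sq]; ring

lemma hasDerivAt_ψ (hB : ProfileBounds d μ ψ δ c₀ C) (hy : IsTrajectory (fField d μ ψ) y)
    (t : ℝ) {P : ℝ × ℝ} (hP : toQuad μ ψ (t, y t) = P) :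
    HasDerivAt (fun t => ψ (toQuad μ ψ (t, y t)))
      ((μ + ψ P) * (P.1 * dr ψ P * (μ + ψ P) + hFun d μ ψ P * (P.2 * dz ψ P)) /
        (aFun μ ψ P * dnFun d μ ψ (t, y t))) t := by
  refine (hB.hasDerivAt_ψ_toQuad (hasDerivAt_id t) (hy t) hP).congr_deriv ?_
  subst hP
  have hD := (hB.dn_pos (t, y t)).ne'
  have hA := (hB.a_pos (hB.toQuad_mem (t, y t))).ne'
  have e1 : 1 + Real.cos (angle (y t)) ^ 2 * fField d μ ψ (t, y t) =
      (μ + ψ (toQuad μ ψ (t, y t))) / dnFun d μ ψ (t, y t) := by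
    rw [fField]; field_simp; rw [dnFun]; ring
  have e2 : 1 - Real.sin (angle (y t)) ^ 2 * fField d μ ψ (t, y t) =
      hFun d μ ψ (toQuad μ ψ (t, y t)) / dnFun d μ ψ (t, y t) := by
    rw [fField]; field_simp; rw [dnFun, hFun, Real.sin_sq]; ring
  rw [e1, e2]
  field_simp
  rw [aFun]; ring

/-- The exponents are chosen so that ψ cancels: (d - 1)(μ + ψ) + (μ - (d - 1) ψ) = d μ. -/
lemma hasDerivAt_logG (hB : ProfileBounds d μ ψ δ c₀ C) (hy : IsTrajectory (fField d μ ψ) y)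
    (t : ℝ) : HasDerivAt (fun t => logG d μ ψ (toQuad μ ψ (t, y t)))
      (-1 / dnFun d μ ψ (t, y t)) t := by
  refine (((hB.hasDerivAt_log_r hy t).const_mul (-(((d : ℝ) - 1) / (d * μ)))).sub
    ((hB.hasDerivAt_log_w hy t).const_mul (1 / (d * μ)))).congr_deriv ?_
  have hD := (hB.dn_pos (t, y t)).ne'
  have hd := hB.d_pos.ne'
  have hμ := hB.μ_pos.ne'
  rw [hFun]
  field_simp
  ring

lemma log_k_div_h_mem (hB : ProfileBounds d μ ψ δ c₀ C) {p : ℝ × ℝ} (hp : p ∈ quadrant) :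
    Real.log ((μ + ψ p) / hFun d μ ψ p) ∈ Icc 0 (2 / δ) := by
  have hh := hB.h_pos hp
  have hk := hB.k_pos hp
  have h1 := hB.pos p hp
  have h3 := hB.three_le_real
  constructor
  · refine Real.log_nonneg ((one_le_div hh).2 ?_)
    rw [hFun]; nlinarith
  · calc Real.log ((μ + ψ p) / hFun d μ ψ p) ≤ (μ + ψ p) / hFun d μ ψ p :=
        (Real.log_le_sub_one_of_pos (div_pos hk hh)).trans (by linarith)
      _ ≤ 2 / δ := by
        have := hB.δ_pos
        gcongr
        · exact hB.k_le hp
        · exact hB.δ_le_h p hp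

/-- Along characteristics `log Ω` stays within a bounded distance of `logG`. -/
lemma abs_sub_logG_le (hB : ProfileBounds d μ ψ δ c₀ C) (hy : IsTrajectory (fField d μ ψ) y)
    {ℓ : ℝ → ℝ} (hℓ : ∀ t, HasDerivAt ℓ (-qField d μ ψ (t, y t)) t) (s t : ℝ) :
    |(ℓ t - logG d μ ψ (toQuad μ ψ (t, y t))) - (ℓ s - logG d μ ψ (toQuad μ ψ (s, y s)))| ≤
      varConst δ c₀ C := by
  have hδ := hB.δ_pos
  have hd := hB.d_pos
  have hμ := hB.μ_pos
  -- The difference log Ω - log G has derivative z ∂_z ψ / (A D), of which only the part with sin² σ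
  -- is O(weight · ψ). The correction removes the part with cos² σ: writing k = μ + ψ and h = μ - (d
  -- - 1) ψ, the derivative of log (k / h) contains d μ z ∂_z ψ / (A D). The remaining terms carry
  -- cos² σ r ∂_r ψ or sin² σ cos² σ F.
  set cor : ℝ → ℝ := fun t => 1 / (d * μ) * (Real.cos (angle (y t)) ^ 2 *
    Real.log ((μ + ψ (toQuad μ ψ (t, y t))) / hFun d μ ψ (toQuad μ ψ (t, y t)))) with hcor
  have hcor' : ∀ t, cor t ∈ Icc 0 (2 / δ ^ 2) := by
    intro t
    have h1 := hB.log_k_div_h_mem (hB.toQuad_mem (t, y t))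
    have h2 : Real.cos (angle (y t)) ^ 2 ≤ 1 := Real.cos_sq_le_one _
    refine ⟨mul_nonneg (by positivity) (mul_nonneg (sq_nonneg _) h1.1), ?_⟩
    have h3 : 1 / (d * μ) ≤ 1 / δ := by
      gcongr
      nlinarith [hB.three_le_real, hB.δ_le_μ]
    calc cor t ≤ 1 / δ * (1 * (2 / δ)) := by
          simp only [hcor]
          gcongr
          · exact mul_nonneg (sq_nonneg _) h1.1
          · exact h1.1
          · exact h1.2
      _ = _ := by field_simp
  have hmain := hB.abs_sub_le_of_weight hy (c := C / δ ^ 2 + 2 * C / δ ^ 3 + 4 / δ ^ 3)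
    (by have := hB.C_pos; positivity)
    (f := fun t => ℓ t - logG d μ ψ (toQuad μ ψ (t, y t)) - cor t)
    (f' := fun t => Real.sin (angle (y t)) ^ 2 *
        ((toQuad μ ψ (t, y t)).2 * dz ψ (toQuad μ ψ (t, y t))) /
        (aFun μ ψ (toQuad μ ψ (t, y t)) * dnFun d μ ψ (t, y t)) -
      Real.cos (angle (y t)) ^ 2 * ((toQuad μ ψ (t, y t)).1 * dr ψ (toQuad μ ψ (t, y t))) *
        (μ + ψ (toQuad μ ψ (t, y t))) / (hFun d μ ψ (toQuad μ ψ (t, y t)) *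
        aFun μ ψ (toQuad μ ψ (t, y t)) * dnFun d μ ψ (t, y t)) +
      1 / (d * μ) * (2 * (Real.sin (angle (y t)) ^ 2 * Real.cos (angle (y t)) ^ 2) *
        fField d μ ψ (t, y t) * Real.log ((μ + ψ (toQuad μ ψ (t, y t))) /
          hFun d μ ψ (toQuad μ ψ (t, y t))))) (fun t => ?_) (fun t => ?_) s t
  · have h1 := hcor' s
    have h2 := hcor' t
    rw [abs_le] at hmain ⊢
    unfold varConst
    constructor <;> linarith [hmain.1, hmain.2, h1.1, h1.2, h2.1, h2.2]
  · have hP := hB.toQuad_mem (t, y t)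
    have hh := hB.h_pos hP
    have hk := hB.k_pos hP
    have hA := hB.a_pos hP
    have hD := hB.dn_pos (t, y t)
    have hψ := hB.hasDerivAt_ψ hy t rfl
    have hlog := ((hψ.const_add μ).div ((hψ.const_mul ((d : ℝ) - 1)).const_sub μ) hh.ne').log
      (div_pos hk hh).ne'
    have hc := (hasDerivAt_cos_angle_sq (y t)).comp t (hy t)
    have hcorD := (hc.mul hlog).const_mul (1 / (d * μ))
    refine (((hℓ t).sub (hB.hasDerivAt_logG hy t)).sub hcorD).congr_deriv ?_
    simp only [Function.comp, Pi.div_apply]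
    rw [qField, Real.sin_sq]
    have hfold : μ - ((d : ℝ) - 1) * ψ (toQuad μ ψ (t, y t)) = hFun d μ ψ (toQuad μ ψ (t, y t)) :=
      rfl
    rw [hfold]
    set P := toQuad μ ψ (t, y t)
    set Lg := Real.log ((μ + ψ P) / hFun d μ ψ P)
    set X := P.1 * dr ψ P
    have hdμ : (d : ℝ) * μ = hFun d μ ψ P + ((d : ℝ) - 1) * (μ + ψ P) := by rw [hFun]; ring
    have hAe : aFun μ ψ P = μ + ψ P + P.2 * dz ψ P := rfl
    set Z := P.2 * dz ψ P
    set k := μ + ψ P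
    set h := hFun d μ ψ P
    set A := aFun μ ψ P
    set D := dnFun d μ ψ (t, y t)
    set Fv := fField d μ ψ (t, y t)
    set c2 := Real.cos (angle (y t)) ^ 2
    -- The identity d μ = h + (d - 1) k collapses the derivative of log (k / h), and its factor d μ
    -- cancels the prefactor 1 / (d μ) of the correction.
    have hfrac : ((k * (X * k + h * Z) / (A * D) * h -
        k * -((d - 1) * (k * (X * k + h * Z) / (A * D)))) / h ^ 2 / (k / h)) =
        d * μ * (X * k + h * Z) / (h * A * D) := by
      rw [hdμ]
      field_simp
      ring
    rw [hfrac]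
    have hZ : Z = A - k := by rw [hAe]; ring
    rw [hZ]
    field_simp
    ring
  · have hP := hB.toQuad_mem (t, y t)
    have hh := hB.h_pos hP
    have hk := hB.k_pos hP
    have hA := hB.a_pos hP
    have hD := hB.dn_pos (t, y t)
    have hδh := hB.δ_le_h _ hP
    have hδA := hB.δ_le_a hP
    have hδD := hB.δ_le_dn (t, y t)
    have hk2 := hB.k_le hP
    have b1 := hB.cos_dr_le _ hP
    have b2 := hB.sin_dz_le _ hP
    rw [hB.cosSq_toQuad, hB.sinCos_toQuad] at b1
    rw [hB.sinSq_toQuad, hB.sinCos_toQuad] at b2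
    have hlog := hB.log_k_div_h_mem hP
    have hF := hB.fField_le (t, y t)
    have hF0 := (hB.fField_pos (t, y t)).le
    have hC := hB.C_pos
    have hψpos := hB.pos _ hP
    have hsc := mul_le_mul_of_nonneg_right (sin_sq_mul_cos_sq_le_weight hB.c₀_le (y t)) hψpos.le
    have hs0 : 0 ≤ Real.sin (angle (y t)) ^ 2 := sq_nonneg _
    have hc0 : 0 ≤ Real.cos (angle (y t)) ^ 2 := sq_nonneg _
    have hμδ := hB.δ_le_μ
    simp only [← weight.eq_1] at b1 b2 ⊢
    set P := toQuad μ ψ (t, y t)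
    set W := weight c₀ (y t) * ψ P
    set s2 := Real.sin (angle (y t)) ^ 2
    set c2 := Real.cos (angle (y t)) ^ 2
    set Lg := Real.log ((μ + ψ P) / hFun d μ ψ P)
    have hW : 0 ≤ W := mul_nonneg (weight_pos _ _).le hψpos.le
    have t1 : |s2 * (P.2 * dz ψ P) / (aFun μ ψ P * dnFun d μ ψ (t, y t))| ≤ C * W / (δ * δ) := by
      rw [abs_div, abs_mul, abs_of_nonneg hs0, abs_of_pos (mul_pos hA hD)]
      gcongr
    have t2 : |c2 * (P.1 * dr ψ P) * (μ + ψ P) /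
        (hFun d μ ψ P * aFun μ ψ P * dnFun d μ ψ (t, y t))| ≤ C * W * 2 / (δ * δ * δ) := by
      rw [abs_div, abs_mul, abs_mul, abs_of_nonneg hc0, abs_of_pos hk,
        abs_of_pos (mul_pos (mul_pos hh hA) hD)]
      gcongr
    have t3 : |1 / (d * μ) * (2 * (s2 * c2) * fField d μ ψ (t, y t) * Lg)| ≤
        1 / (d * δ) * (2 * (d / δ * W) * (2 / δ)) := by
      rw [abs_of_nonneg (mul_nonneg (by positivity) (mul_nonneg (by positivity) hlog.1))]
      have e : s2 * c2 * fField d μ ψ (t, y t) ≤ d / δ * W := by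
        calc s2 * c2 * fField d μ ψ (t, y t) ≤ s2 * c2 * (d / δ * ψ P) := by gcongr
          _ = d / δ * (s2 * c2 * ψ P) := by ring
          _ ≤ _ := by gcongr
      have hl1 := hlog.1
      have hl2 := hlog.2
      rw [mul_assoc 2]
      gcongr
    refine (abs_add_le _ _).trans ((add_le_add ((abs_sub _ _).trans (add_le_add t1 t2)) t3).trans
      (le_of_eq ?_))
    field_simp
    ring

/-- For ψ ≡ b the function w r^{-γ_b} would decay at the rate of G; this is the origin of the
exponent. In general the discrepancy is proportional to ψ - b. -/
lemma hasDerivAt_logG_sub (hB : ProfileBounds d μ ψ δ c₀ C) (hy : IsTrajectory (fField d μ ψ) y)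
    {b : ℝ} (hb : 0 < μ + b) (t : ℝ) :
    HasDerivAt (fun t => logG d μ ψ (toQuad μ ψ (t, y t)) -
      (Real.log (wFun μ ψ (toQuad μ ψ (t, y t))) -
        gammaExp d μ b * Real.log (toQuad μ ψ (t, y t)).1))
      ((1 + d * μ) * (ψ (toQuad μ ψ (t, y t)) - b) / ((μ + b) * dnFun d μ ψ (t, y t))) t := by
  refine ((hB.hasDerivAt_logG hy t).sub ((hB.hasDerivAt_log_w hy t).sub
    ((hB.hasDerivAt_log_r hy t).const_mul _))).congr_deriv ?_
  have hD := (hB.dn_pos (t, y t)).ne'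
  rw [gammaExp, hFun]
  field_simp
  ring

lemma snd_le_exp (hB : ProfileBounds d μ ψ δ c₀ C) (x : ℝ × ℝ) :
    (toQuad μ ψ x).2 ≤ Real.exp x.1 / δ := by
  have h1 := hB.w_toQuad x
  have h2 := hB.toQuad_mem x
  rw [le_div_iff₀ hB.δ_pos]
  calc (toQuad μ ψ x).2 * δ ≤ wFun μ ψ (toQuad μ ψ x) := by
        rw [wFun, mul_comm]; exact mul_le_mul_of_nonneg_right (hB.δ_le_k h2) h2.2.le
    _ ≤ _ := by
        rw [h1]; exact mul_le_of_le_one_right (Real.exp_pos _).le (Real.cos_le_one _)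

lemma fst_le_exp (x : ℝ × ℝ) : (toQuad μ ψ x).1 ≤ Real.exp x.1 :=
  mul_le_of_le_one_right (Real.exp_pos _).le (Real.sin_le_one _)

/-- With ψ ≤ b the discrepancy is nonincreasing in τ, so moving outwards from Γ₀ costs nothing. -/
lemma logG_sub_forward (hB : ProfileBounds d μ ψ δ c₀ C) (hy : IsTrajectory (fField d μ ψ) y)
    {b : ℝ} (hb : 0 < b) (hψb : ∀ p ∈ quadrant, ψ p ≤ b) {t : ℝ} (ht : 0 ≤ t) :
    logG d μ ψ (toQuad μ ψ (t, y t)) - (Real.log (wFun μ ψ (toQuad μ ψ (t, y t))) -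
        gammaExp d μ b * Real.log (toQuad μ ψ (t, y t)).1) ≤
    logG d μ ψ (toQuad μ ψ (0, y 0)) - (Real.log (wFun μ ψ (toQuad μ ψ (0, y 0))) -
        gammaExp d μ b * Real.log (toQuad μ ψ (0, y 0)).1) := by
  have hμ := hB.μ_pos
  have hd := hB.d_pos
  have h := sub_le_of_deriv_le ht (fun u => hB.hasDerivAt_logG_sub hy (add_pos hμ hb) u)
    (fun u => hasDerivAt_const u (0 : ℝ)) fun u _ => ?_
  · simp only [sub_self] at h
    linarith
  · refine div_nonpos_of_nonpos_of_nonneg (mul_nonpos_of_nonneg_of_nonpos (by positivity) ?_)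
      (mul_pos (add_pos hμ hb) (hB.dn_pos _)).le
    linarith [hψb _ (hB.toQuad_mem (u, y u))]

/-- Towards the origin ψ - b = O(r + z) = O(e^τ / δ), which is integrable over τ ≤ 0; this gives a
loss independent of the characteristic. -/
lemma logG_sub_backward (hB : ProfileBounds d μ ψ δ c₀ C) (hy : IsTrajectory (fField d μ ψ) y)
    {b : ℝ} (hb : 0 < b) (hψb : ∀ p ∈ quadrant, |ψ p - b| ≤ p.1 + p.2) {t : ℝ} (ht : t ≤ 0) :
    logG d μ ψ (toQuad μ ψ (t, y t)) - (Real.log (wFun μ ψ (toQuad μ ψ (t, y t))) -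
        gammaExp d μ b * Real.log (toQuad μ ψ (t, y t)).1) ≤
    logG d μ ψ (toQuad μ ψ (0, y 0)) - (Real.log (wFun μ ψ (toQuad μ ψ (0, y 0))) -
        gammaExp d μ b * Real.log (toQuad μ ψ (0, y 0)).1) + 2 * (1 + d) / δ ^ 3 := by
  have hμ := hB.μ_pos
  have hd := hB.d_pos
  have hδ := hB.δ_pos
  have h := abs_sub_le_of_abs_deriv_le ht
    (fun u => hB.hasDerivAt_logG_sub hy (add_pos hμ hb) u)
    (fun u => (Real.hasDerivAt_exp u).const_mul (2 * (1 + d) / δ ^ 3)) fun u _ => ?_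
  · have h1 := (abs_le.1 h).1
    have h2 : 0 ≤ 2 * (1 + d) / δ ^ 3 * Real.exp t := by positivity
    rw [Real.exp_zero] at h1
    linarith
  · have hP := hB.toQuad_mem (u, y u)
    have hD := hB.dn_pos (u, y u)
    have hδD := hB.δ_le_dn (u, y u)
    have hE := Real.exp_pos u
    have e1 : |ψ (toQuad μ ψ (u, y u)) - b| ≤ 2 * Real.exp u / δ := by
      refine (hψb _ hP).trans ?_
      have h1 := hB.snd_le_exp (u, y u)
      have h2 := fst_le_exp (μ := μ) (ψ := ψ) (u, y u)
      have h3 : Real.exp u ≤ Real.exp u / δ := by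
        rw [le_div_iff₀ hδ]; nlinarith [hB.δ_le_one]
      simp only at h1 h2
      rw [mul_div_assoc]; linarith
    rw [abs_div, abs_mul, abs_of_pos (mul_pos (add_pos hμ hb) hD),
      abs_of_pos (by positivity : (0 : ℝ) < 1 + d * μ)]
    have hμ1 := hB.μ_le
    have hδμ := hB.δ_le_μ
    calc _ ≤ (1 + d * 1) * (2 * Real.exp u / δ) / (δ * δ) := by gcongr; linarith
      _ = _ := by field_simp

/-- Variation of functions controlled by a stream function which decays at infinity. -/
lemma abs_sub_le_of_decay (hB : ProfileBounds d μ ψ δ c₀ C) {κ M c : ℝ} (hκ : 0 < κ) (hM : 0 ≤ M)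
    (hc : 0 ≤ c) (hdec : ∀ p ∈ quadrant, ψ p ≤ M * bracket p ^ (-κ)) {f f' : ℝ → ℝ}
    (hf : ∀ t, HasDerivAt f (f' t) t) (hf' : ∀ t, |f' t| ≤ c * ψ (toQuad μ ψ (t, y t)))
    {s t : ℝ} (hst : s ≤ t) : |f t - f s| ≤ c * M * 2 ^ κ / κ * Real.exp (-κ * s) := by
  have hg : ∀ u, HasDerivAt (fun u => -(c * M * 2 ^ κ / κ * Real.exp (-κ * u)))
      (c * M * 2 ^ κ * Real.exp (-κ * u)) u := fun u => by
    refine ((((hasDerivAt_id u).const_mul (-κ)).exp).const_mul (c * M * 2 ^ κ / κ)).neg.congr_deriv ?_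
    simp only [id]; field_simp
  refine (abs_sub_le_of_abs_deriv_le hst hf hg fun u _ => (hf' u).trans ?_).trans ?_
  · have hP := hB.toQuad_mem (u, y u)
    -- Since w ≤ 2 z, one has e^{2τ} = r² + w² ≤ 4 (r² + z²).
    have h1 : Real.exp u / 2 ≤ bracket (toQuad μ ψ (u, y u)) := by
      rw [bracket]
      refine Real.le_sqrt_of_sq_le ?_
      have h2 := hB.sq_add_sq_toQuad (u, y u)
      have h3 := hB.k_le hP
      have h4 := hB.k_pos hP
      have h5 : (μ + ψ (toQuad μ ψ (u, y u))) ^ 2 ≤ 2 ^ 2 := by gcongr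
      simp only [wFun, mul_pow] at h2
      nlinarith [mul_le_mul_of_nonneg_right h5 (sq_nonneg (toQuad μ ψ (u, y u)).2),
        sq_nonneg (toQuad μ ψ (u, y u)).1]
    have h2 : bracket (toQuad μ ψ (u, y u)) ^ (-κ) ≤ 2 ^ κ * Real.exp (-κ * u) := by
      refine (Real.rpow_le_rpow_of_nonpos (by positivity) h1 (by linarith)).trans (le_of_eq ?_)
      rw [Real.div_rpow (Real.exp_pos _).le (by norm_num), ← Real.exp_mul,
        Real.rpow_neg (by norm_num) κ, div_inv_eq_mul, mul_comm, mul_comm u]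
    calc c * ψ (toQuad μ ψ (u, y u)) ≤ c * (M * (2 ^ κ * Real.exp (-κ * u))) := by
          gcongr
          exact (hdec _ hP).trans (by gcongr)
      _ = _ := by ring
  · have : 0 ≤ c * M * 2 ^ κ / κ * Real.exp (-κ * t) := by positivity
    linarith

/-- Where ψ vanishes, (log G)' = -1/μ and (log w)' = 1. The exponent 1/μ + 1 balances these rates,
so what remains is proportional to ψ and integrable at infinity. -/
lemma hasDerivAt_decay_profile (hB : ProfileBounds d μ ψ δ c₀ C)
    (hy : IsTrajectory (fField d μ ψ) y) (t : ℝ) :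
    HasDerivAt (fun t => logG d μ ψ (toQuad μ ψ (t, y t)) -
      (Real.log (wFun μ ψ (toQuad μ ψ (t, y t))) - (1 / μ + 1) * t))
      (ψ (toQuad μ ψ (t, y t)) * (((d : ℝ) - 1) + (1 / μ + 1) *
        (1 - Real.cos (angle (y t)) ^ 2 * d)) / dnFun d μ ψ (t, y t)) t := by
  refine ((hB.hasDerivAt_logG hy t).sub ((hB.hasDerivAt_log_w hy t).sub
    ((hasDerivAt_id t).const_mul _))).congr_deriv ?_
  have hD := (hB.dn_pos (t, y t)).ne'
  have hμ := hB.μ_pos.ne'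
  rw [hFun]
  field_simp
  rw [dnFun]
  ring

lemma abs_decay_profile_deriv_le (hB : ProfileBounds d μ ψ δ c₀ C) (x : ℝ × ℝ) :
    |ψ (toQuad μ ψ x) * (((d : ℝ) - 1) + (1 / μ + 1) *
        (1 - Real.cos (angle x.2) ^ 2 * d)) / dnFun d μ ψ x| ≤
      (d + (1 / δ + 1) * (1 + d)) / δ * ψ (toQuad μ ψ x) := by
  have hP := hB.toQuad_mem x
  have hψ := hB.pos _ hP
  have hδ := hB.δ_pos
  have hμ := hB.μ_pos
  have hd := hB.three_le_real
  have hδμ := hB.δ_le_μ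
  have hδD := hB.δ_le_dn x
  have h1 : |1 - Real.cos (angle x.2) ^ 2 * d| ≤ 1 + (d : ℝ) := by
    have h2 := Real.cos_sq_le_one (angle x.2)
    have h3 := mul_nonneg (sq_nonneg (Real.cos (angle x.2))) (by linarith : (0 : ℝ) ≤ d)
    have h4 := mul_le_mul_of_nonneg_right h2 (by linarith : (0 : ℝ) ≤ d)
    rw [abs_le]; constructor <;> linarith
  rw [abs_div, abs_mul, abs_of_pos hψ, abs_of_pos (hB.dn_pos x), mul_comm, div_mul_eq_mul_div]
  gcongr
  refine (abs_add_le _ _).trans ?_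
  rw [abs_mul, abs_of_nonneg (by linarith : (0 : ℝ) ≤ d - 1),
    abs_of_pos (by positivity : 0 < 1 / μ + 1)]
  gcongr
  linarith

end ProfileBounds

/-! ### The initial data -/

section InitialData

variable {d : ℕ} {μ lam K δ : ℝ} {η Θ : ℝ → ℝ}

lemma sin_pos_of_mem {σ : ℝ} (hσ : σ ∈ Ioo 0 (Real.pi / 2)) : 0 < Real.sin σ :=
  Real.sin_pos_of_pos_of_lt_pi hσ.1 (by linarith [hσ.2, Real.pi_pos])

lemma cos_pos_of_mem {σ : ℝ} (hσ : σ ∈ Ioo 0 (Real.pi / 2)) : 0 < Real.cos σ :=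
  Real.cos_pos_of_mem_Ioo ⟨by linarith [hσ.1, Real.pi_pos], hσ.2⟩

lemma chi_mem (hη : IsEta d η) (hμ : 0 < μ) {σ : ℝ} (hσ : σ ∈ Ioo 0 (Real.pi / 2)) :
    chi d μ η σ ∈ Icc (Real.cos σ ^ (1 + 1 / (d * μ))) 1 := by
  obtain ⟨h0, h1⟩ := hη.mem_Icc σ hσ
  have hc := cos_pos_of_mem hσ
  have hE : Real.cos σ ^ (1 + 1 / (d * μ)) ≤ 1 :=
    Real.rpow_le_one hc.le (Real.cos_le_one _) (by positivity)
  have hE0 : 0 < Real.cos σ ^ (1 + 1 / (d * μ)) := Real.rpow_pos_of_pos hc _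
  unfold chi
  constructor <;> nlinarith

lemma chi_pos (hη : IsEta d η) (hμ : 0 < μ) {σ : ℝ} (hσ : σ ∈ Ioo 0 (Real.pi / 2)) :
    0 < chi d μ η σ :=
  (Real.rpow_pos_of_pos (cos_pos_of_mem hσ) _).trans_le (chi_mem hη hμ hσ).1

/-- The derivative of η is supported in a compact subinterval of (0, π/2). It is therefore bounded,
and cos σ is bounded below wherever it is nonzero. -/
lemma exists_deriv_eta_bound (hη : IsEta d η) (hd : 0 < d) :
    ∃ C, 0 ≤ C ∧ ∀ σ ∈ Ioo 0 (Real.pi / 2),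
      |deriv η σ| ≤ C ∧ (deriv η σ ≠ 0 → 1 / (3 * d) ≤ Real.cos σ) := by
  have hd' : (1 : ℝ) ≤ d := by exact_mod_cast hd
  set s₁ := Real.arctan (2 * d)
  set s₂ := Real.arccos (1 / (3 * d))
  have hs₁ : 0 < s₁ := Real.arctan_pos.2 (by positivity)
  have hs₂ : s₂ < Real.pi / 2 := Real.arccos_lt_pi_div_two.2 (by positivity)
  have hcont : ContinuousOn (deriv η) (Icc s₁ s₂) := by
    have := (hη.smooth.continuousOn_deriv_of_isOpen isOpen_Ioo (by norm_num))
    exact this.mono fun σ hσ => ⟨hs₁.trans_le hσ.1, hσ.2.trans_lt hs₂⟩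
  obtain ⟨C, hC⟩ := isCompact_Icc.exists_bound_of_continuousOn hcont
  have hzero : ∀ σ ∈ Ioo 0 (Real.pi / 2), σ ∉ Icc s₁ s₂ → deriv η σ = 0 := by
    intro σ hσ hn
    rcases lt_or_ge σ s₁ with h | h
    · have : η =ᶠ[𝓝 σ] fun _ => 1 := by
        filter_upwards [Ioo_mem_nhds hσ.1 h] with s hs using hη.eq_one s hs.1 hs.2.le
      rw [this.deriv_eq, deriv_const]
    · have h' : s₂ < σ := by
        by_contra hc
        exact hn ⟨h, not_lt.1 hc⟩
      have : η =ᶠ[𝓝 σ] fun _ => 0 := by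
        filter_upwards [Ioo_mem_nhds h' hσ.2] with s hs using hη.eq_zero s hs.1.le hs.2
      rw [this.deriv_eq, deriv_const]
  refine ⟨max C 0, le_max_right _ _, fun σ hσ => ?_⟩
  by_cases hm : σ ∈ Icc s₁ s₂
  · refine ⟨(hC σ hm).trans (le_max_left _ _), fun _ => ?_⟩
    have := Real.cos_le_cos_of_nonneg_of_le_pi hσ.1.le (Real.arccos_le_pi _) hm.2
    rwa [Real.cos_arccos (by linarith [show (0 : ℝ) ≤ 1 / (3 * d) by positivity])
      (by rw [div_le_one (by positivity)]; linarith)] at this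
  · rw [hzero σ hσ hm]
    simp

/-- The logarithm of the initial value as a function of `θ = log tan σ`. -/
def logInitial (d : ℕ) (μ lam : ℝ) (Θ η : ℝ → ℝ) (θ : ℝ) : ℝ :=
  Real.log (initialValue d μ lam Θ η (angle θ))

lemma initialValue_pos (hη : IsEta d η) (hΘ : IsTheta d μ Θ) (hμ : 0 < μ) (hlam : 0 < lam)
    {σ : ℝ} (hσ : σ ∈ Ioo 0 (Real.pi / 2)) : 0 < initialValue d μ lam Θ η σ :=
  mul_pos (mul_pos (mul_pos (hΘ.pos _ (mul_pos hlam hσ.1))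
    (Real.rpow_pos_of_pos (sin_pos_of_mem hσ) _)) (Real.rpow_pos_of_pos (cos_pos_of_mem hσ) _))
    (chi_pos hη hμ hσ)

lemma logInitial_eq (hη : IsEta d η) (hΘ : IsTheta d μ Θ) (hμ : 0 < μ) (hlam : 0 < lam) (θ : ℝ) :
    logInitial d μ lam Θ η θ = Real.log (Θ (lam * angle θ)) -
      ((d : ℝ) - 1) / (d * μ) * Real.log (Real.sin (angle θ)) -
      1 / (d * μ) * Real.log (Real.cos (angle θ)) + Real.log (chi d μ η (angle θ)) := by
  have h1 := hΘ.pos _ (mul_pos hlam (angle_mem θ).1)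
  have h2 := sin_angle_pos θ
  have h3 := cos_angle_pos θ
  have h4 := chi_pos hη hμ (angle_mem θ)
  have h5 := Real.rpow_pos_of_pos h2 (-(((d : ℝ) - 1) / (d * μ)))
  have h6 := Real.rpow_pos_of_pos h3 (-(1 / (d * μ)))
  rw [logInitial, initialValue, Real.log_mul (by positivity) h4.ne',
    Real.log_mul (by positivity) h6.ne', Real.log_mul h1.ne' h5.ne', Real.log_rpow h2,
    Real.log_rpow h3]
  ring

lemma contDiff_chi_angle (hη : IsEta d η) : ContDiff ℝ 1 fun θ => chi d μ η (angle θ) := by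
  have h1 : ContDiff ℝ 1 fun θ => η (angle θ) :=
    contDiffOn_univ.1 ((hη.smooth.of_le (by norm_cast)).comp contDiff_angle.contDiffOn
      fun θ _ => angle_mem θ)
  have h2 : ContDiff ℝ 1 fun θ => Real.cos (angle θ) ^ (1 + 1 / (d * μ)) :=
    (Real.contDiff_cos.comp contDiff_angle).rpow_const_of_ne fun θ => (cos_angle_pos θ).ne'
  exact h1.add ((contDiff_const.sub h1).mul h2)

lemma contDiff_logInitial (hη : IsEta d η) (hΘ : IsTheta d μ Θ) (hμ : 0 < μ) (hlam : 0 < lam) :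
    ContDiff ℝ 1 (logInitial d μ lam Θ η) := by
  rw [funext (logInitial_eq hη hΘ hμ hlam)]
  have h1 : ContDiff ℝ 1 fun θ => Θ (lam * angle θ) :=
    contDiffOn_univ.1 ((hΘ.smooth.of_le (by norm_cast)).comp
      (contDiff_const.mul contDiff_angle).contDiffOn fun θ _ => mul_pos hlam (angle_mem θ).1)
  exact (((h1.log fun θ => (hΘ.pos _ (mul_pos hlam (angle_mem θ).1)).ne').sub
    (contDiff_const.mul ((Real.contDiff_sin.comp contDiff_angle).log
      fun θ => (sin_angle_pos θ).ne'))).sub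
    (contDiff_const.mul ((Real.contDiff_cos.comp contDiff_angle).log
      fun θ => (cos_angle_pos θ).ne'))).add
    ((contDiff_chi_angle hη).log fun θ => (chi_pos hη hμ (angle_mem θ)).ne')

lemma abs_deriv_chi_angle_le (hη : IsEta d η) (hd : 1 ≤ d) (hδ : 0 < δ) (hδμ : δ ≤ μ) {Cη : ℝ}
    (hC0 : 0 ≤ Cη) (hCη : ∀ σ ∈ Ioo 0 (Real.pi / 2),
      |deriv η σ| ≤ Cη ∧ (deriv η σ ≠ 0 → 1 / (3 * d) ≤ Real.cos σ)) (θ : ℝ) :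
    |deriv (fun θ => chi d μ η (angle θ)) θ| ≤
      (Cη * (3 * d) ^ (1 + 1 / δ) + (1 + 1 / δ)) * chi d μ η (angle θ) := by
  have hμ : 0 < μ := hδ.trans_le hδμ
  have hσ := angle_mem θ
  have hd' : (1 : ℝ) ≤ d := by exact_mod_cast hd
  have hdη : HasDerivAt η (deriv η (angle θ)) (angle θ) :=
    ((hη.smooth.differentiableOn (by simp)).differentiableAt
      (Ioo_mem_nhds hσ.1 hσ.2)).hasDerivAt
  have h1 := hdη.comp θ (hasDerivAt_angle θ)
  have h2 := (hasDerivAt_cos_angle θ).rpow_const (p := 1 + 1 / (d * μ))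
    (Or.inl (cos_angle_pos θ).ne')
  have h3 : HasDerivAt (fun θ => chi d μ η (angle θ)) _ θ := h1.add ((h1.const_sub 1).mul h2)
  rw [h3.deriv]
  have hs := sin_angle_pos θ
  have hc := cos_angle_pos θ
  have hs1 := Real.sin_le_one (angle θ)
  have hc1 := Real.cos_le_one (angle θ)
  obtain ⟨hη0, hη1⟩ := hη.mem_Icc _ hσ
  obtain ⟨hχ1, -⟩ := chi_mem hη hμ hσ
  obtain ⟨hb, hb'⟩ := hCη _ hσ
  have hχ2 : (1 - η (angle θ)) * Real.cos (angle θ) ^ (1 + 1 / (d * μ)) ≤ chi d μ η (angle θ) := by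
    unfold chi; linarith
  have he1 : 1 + 1 / (d * μ) ≤ 1 + 1 / δ := by
    gcongr; nlinarith
  have he0 : 0 < 1 + 1 / (d * μ) := by positivity
  have hpow : Real.cos (angle θ) ^ (1 + 1 / (d * μ) - 1) * Real.cos (angle θ) =
      Real.cos (angle θ) ^ (1 + 1 / (d * μ)) := by
    rw [Real.rpow_sub_one hc.ne', div_mul_cancel₀ _ hc.ne']
  simp only [Function.comp]
  set e := 1 + 1 / (d * μ)
  set s := Real.sin (angle θ)
  set c := Real.cos (angle θ)
  set η' := deriv η (angle θ)
  set χ := chi d μ η (angle θ)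
  have hce : c ^ e ≤ 1 := Real.rpow_le_one hc.le hc1 he0.le
  have hce0 : 0 < c ^ e := Real.rpow_pos_of_pos hc _
  have hχ0 : 0 < χ := hce0.trans_le hχ1
  have hE : (0 : ℝ) ≤ (3 * d : ℝ) ^ (1 + 1 / δ) := by positivity
  -- Where η' ≠ 0, χ is at least a fixed power of 1 / (3d), so η' is controlled by χ itself; the
  -- exponent is replaced by 1 + 1/δ to remove μ.
  have hη' : |η'| ≤ Cη * (3 * d) ^ (1 + 1 / δ) * χ := by
    by_cases h0 : η' = 0
    · rw [h0, abs_zero]; positivity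
    · have h4 := hb' h0
      have h5 : 1 ≤ (3 * d : ℝ) ^ (1 + 1 / δ) * χ := by
        have h6 : ((3 * d : ℝ) ^ (1 + 1 / δ))⁻¹ ≤ c ^ e := by
          rw [← Real.inv_rpow (by positivity), ← one_div]
          calc (1 / (3 * d : ℝ)) ^ (1 + 1 / δ) ≤ (1 / (3 * d : ℝ)) ^ e :=
                Real.rpow_le_rpow_of_exponent_ge (by positivity)
                  (by rw [div_le_one (by positivity)]; linarith) he1
            _ ≤ c ^ e := Real.rpow_le_rpow (by positivity) h4 he0.le
        rw [inv_le_iff_one_le_mul₀ (by positivity)] at h6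
        nlinarith
      nlinarith
  have hexp : η' * (s * c) + (-(η' * (s * c)) * c ^ e + (1 - η (angle θ)) *
      (-(c * s ^ 2) * e * c ^ (e - 1))) =
      η' * (s * c * (1 - c ^ e)) - (1 - η (angle θ)) * c ^ e * (e * s ^ 2) := by
    rw [← hpow]; ring
  rw [hexp]
  refine (abs_sub _ _).trans ?_
  rw [abs_mul η', abs_mul (_ * c ^ e), abs_mul (1 - η (angle θ)),
    abs_of_nonneg (sub_nonneg.2 hη1), abs_of_pos hce0, abs_of_nonneg (by positivity : 0 ≤ e * s ^ 2)]
  refine (add_le_add (?_ : _ ≤ Cη * (3 * d) ^ (1 + 1 / δ) * χ)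
    (?_ : _ ≤ (1 + 1 / δ) * χ)).trans_eq (add_mul _ _ _).symm
  · have h7 : |s * c * (1 - c ^ e)| ≤ 1 := by
      rw [abs_of_nonneg (mul_nonneg (by positivity) (by linarith))]
      exact mul_le_one₀ (mul_le_one₀ hs1 hc.le hc1) (by linarith) (by linarith)
    exact (mul_le_of_le_one_right (abs_nonneg _) h7).trans hη'
  · have h8 : e * s ^ 2 ≤ 1 + 1 / δ :=
      (mul_le_of_le_one_right he0.le (pow_le_one₀ hs.le hs1)).trans he1
    rw [mul_comm (1 + 1 / δ)]
    exact mul_le_mul hχ2 h8 (by positivity) hχ0.le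

lemma abs_deriv_logInitial_le (hη : IsEta d η) (hΘ : IsTheta d μ Θ) (hd : 1 ≤ d) (hδ : 0 < δ)
    (hδμ : δ ≤ μ) (hlam : 0 < lam) (hK : ∀ s : ℝ, 0 < s → |s * deriv Θ s| ≤ K * Θ s) {Cη : ℝ}
    (hC0 : 0 ≤ Cη) (hCη : ∀ σ ∈ Ioo 0 (Real.pi / 2),
      |deriv η σ| ≤ Cη ∧ (deriv η σ ≠ 0 → 1 / (3 * d) ≤ Real.cos σ)) (θ : ℝ) :
    |deriv (logInitial d μ lam Θ η) θ| ≤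
      K + 1 / δ + 1 / δ + (Cη * (3 * d) ^ (1 + 1 / δ) + (1 + 1 / δ)) := by
  have hμ : 0 < μ := hδ.trans_le hδμ
  have hσ := angle_mem θ
  have hd' : (1 : ℝ) ≤ d := by exact_mod_cast hd
  have hΘp := hΘ.pos _ (mul_pos hlam hσ.1)
  have hK' := hK _ (mul_pos hlam hσ.1)
  have hs := sin_angle_pos θ
  have hc := cos_angle_pos θ
  have hχ0 := chi_pos hη hμ hσ
  have hdΘ : HasDerivAt Θ (deriv Θ (lam * angle θ)) (lam * angle θ) :=
    ((hΘ.smooth.differentiableOn (by simp)).differentiableAt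
      (Ioi_mem_nhds (mul_pos hlam hσ.1))).hasDerivAt
  have h1 := (hdΘ.comp θ ((hasDerivAt_angle θ).const_mul lam)).log hΘp.ne'
  have h2 := ((hasDerivAt_sin_angle θ).log hs.ne').const_mul (((d : ℝ) - 1) / (d * μ))
  have h3 := ((hasDerivAt_cos_angle θ).log hc.ne').const_mul (1 / (d * μ))
  have h4 := ((contDiff_chi_angle (μ := μ) hη).differentiable one_ne_zero θ).hasDerivAt.log hχ0.ne'
  have h5 := ((h1.sub h2).sub h3).add h4
  have h6 := h5.congr_of_eventuallyEq
    (Eventually.of_forall fun θ => logInitial_eq hη hΘ hμ hlam θ)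
  rw [h6.deriv]
  have hfrac : 1 / (d * μ) ≤ 1 / δ := by gcongr; nlinarith
  have hfrac2 : ((d : ℝ) - 1) / (d * μ) ≤ 1 / δ := by
    rw [div_le_div_iff₀ (by positivity) hδ]; nlinarith
  refine (abs_add_le _ _).trans (add_le_add ((abs_sub _ _).trans (add_le_add ((abs_sub _ _).trans
    (add_le_add ?_ ?_)) ?_)) ?_)
  -- Since dσ/dθ = sin σ cos σ ≤ σ, the slope of log Θ(λσ) in θ is at most |λσ Θ'(λσ)| / Θ(λσ) ≤ K,
  -- with no trace of λ.
  · have hsc : Real.sin (angle θ) * Real.cos (angle θ) ≤ angle θ :=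
      (mul_le_of_le_one_right hs.le (Real.cos_le_one _)).trans (Real.sin_le hσ.1.le)
    simp only [Function.comp]
    rw [abs_div, abs_of_pos hΘp, div_le_iff₀ hΘp]
    refine le_trans ?_ hK'
    rw [abs_mul, abs_mul (lam * angle θ), abs_of_pos (mul_pos hlam hσ.1),
      abs_of_nonneg (by positivity : 0 ≤ lam * (Real.sin (angle θ) * Real.cos (angle θ)))]
    nlinarith [mul_le_mul_of_nonneg_left hsc
      (mul_nonneg (abs_nonneg (deriv Θ (lam * angle θ))) hlam.le)]
  · rw [mul_div_cancel_left₀ _ hs.ne', abs_of_nonneg (mul_nonneg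
      (div_nonneg (by linarith) (by positivity)) (sq_nonneg _))]
    exact (mul_le_of_le_one_right (div_nonneg (by linarith) (by positivity))
      (Real.cos_sq_le_one _)).trans hfrac2
  · rw [neg_div, mul_div_cancel_left₀ _ hc.ne', mul_neg, abs_neg, abs_of_nonneg (by positivity)]
    exact (mul_le_of_le_one_right (by positivity) (Real.sin_sq_le_one _)).trans hfrac
  · rw [abs_div, abs_of_pos hχ0, div_le_iff₀ hχ0]
    exact abs_deriv_chi_angle_le hη hd hδ hδμ hC0 hCη θ

end InitialData

/-! ### Uniform bounds for the class `𝒜⁰` -/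

lemma quadrant_subset_closedQuadrant : quadrant ⊆ closedQuadrant := fun _ h => ⟨h.1.le, h.2.le⟩

lemma radius_pos {p : ℝ × ℝ} (hp : p ∈ quadrant) : 0 < radius p :=
  Real.sqrt_pos.2 (add_pos (pow_pos hp.1 2) (pow_pos hp.2 2))

lemma bracket_pos (p : ℝ × ℝ) : 0 < bracket p := Real.sqrt_pos.2 (by positivity)

lemma one_le_bracket (p : ℝ × ℝ) : 1 ≤ bracket p :=
  Real.le_sqrt_of_sq_le (by nlinarith [sq_nonneg p.1, sq_nonneg p.2])

lemma bracketOne_pos (z : ℝ) : 0 < bracketOne z := Real.sqrt_pos.2 (by positivity)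

lemma one_le_bracketOne (z : ℝ) : 1 ≤ bracketOne z :=
  Real.le_sqrt_of_sq_le (by nlinarith [sq_nonneg z])

lemma radius_le_bracket (p : ℝ × ℝ) : radius p ≤ bracket p :=
  Real.sqrt_le_sqrt (by linarith)

lemma le_bracketOne (z : ℝ) : z ≤ bracketOne z := Real.le_sqrt_of_sq_le (by linarith)

lemma radius_sq (p : ℝ × ℝ) : radius p ^ 2 = p.1 ^ 2 + p.2 ^ 2 := Real.sq_sqrt (by positivity)

lemma snd_mul_bracket_le {p : ℝ × ℝ} :
    p.2 * bracket p ≤ radius p * bracketOne p.2 := by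
  have h1 : 0 ≤ radius p * bracketOne p.2 :=
    mul_nonneg (Real.sqrt_nonneg _) (Real.sqrt_nonneg _)
  refine le_of_abs_le (abs_le_of_sq_le_sq ?_ h1)
  rw [mul_pow, mul_pow, radius_sq, bracket, bracketOne, Real.sq_sqrt (by positivity),
    Real.sq_sqrt (by positivity)]
  nlinarith [sq_nonneg p.1]

/-- Numerical consequences of admissibility, with constants uniform in `μ`. -/
structure ParameterBounds (d : ℕ) (a μ δ c₀ : ℝ) : Prop where
  three_le : 3 ≤ d
  δ_pos : 0 < δ
  c₀_pos : 0 < c₀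
  c₀_le : c₀ ≤ 1
  μ_le : μ ≤ 1
  a_pos : 0 < a
  a_le_aOne : a ≤ aOne d a
  aOne_le : aOne d a ≤ 1 / 2
  δ_le : δ ≤ μ - ((d : ℝ) - 1) * aOne d a
  exp_z : c₀ ≤ 1 - 1 / (d * μ)
  exp_r : c₀ ≤ (d : ℝ) - 2 - ((d : ℝ) - 1) / (d * μ)
  exp_origin : c₀ ≤ (d : ℝ) - 2 - gammaExp d μ a
  exp_decay : (d : ℝ) - 2 < 1 / μ

/-- Everything rests on x = d (d - 2) a > 1, which follows from the lower bound on a, together with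
μ > (d - 1) a. All margins are then bounded below by multiples of 1 - 1/x, uniformly up to the
endpoints of the range of μ. -/
lemma exists_parameterBounds {d : ℕ} (hd : 3 ≤ d) {a : ℝ} (ha : AdmissibleA d a) :
    ∃ δ c₀, 0 < δ ∧ 0 < c₀ ∧ c₀ ≤ 1 ∧
      ∀ μ, AdmissibleMu d a μ → ParameterBounds d a μ δ c₀ := by
  have hD : (3 : ℝ) ≤ d := by exact_mod_cast hd
  obtain ⟨ha1, ha2⟩ := ha
  have hD1 : (0 : ℝ) < (d : ℝ) - 1 := by linarith
  have hD2 : (0 : ℝ) < (d : ℝ) - 2 := by linarith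
  have hD3 : (0 : ℝ) < 4 * (d : ℝ) - 3 := by linarith
  have ha0 : 0 < a := lt_trans (by positivity) ha1
  have ha2' : a * (((d : ℝ) - 1) * ((d : ℝ) - 2)) < 1 := by
    rwa [lt_div_iff₀ (by positivity)] at ha2
  set x := (d : ℝ) * (d - 2) * a with hx
  have hx1 : 1 < x := by
    rw [div_lt_iff₀ (by positivity)] at ha1
    have : 4 < (4 - 3 / (d : ℝ)) * x := by
      have e : (4 - 3 / (d : ℝ)) * x = a * ((4 * (d : ℝ) - 3) * ((d : ℝ) - 2)) := by
        rw [hx]; field_simp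
      linarith
    have h3 : 0 < 3 / (d : ℝ) := by positivity
    nlinarith
  have hx0 : 0 < x := by linarith
  have hinv : 1 / x < 1 := by rw [div_lt_one hx0]; exact hx1
  have hinv0 : 0 < 1 / x := by positivity
  have hmid : 1 / (2 * ((d : ℝ) - 1) * ((d : ℝ) - 2)) = 1 / (((d : ℝ) - 1) * ((d : ℝ) - 2)) / 2 := by
    field_simp
  have haOne1 : a < aOne d a := by rw [aOne, hmid]; linarith
  have haOne2 : aOne d a < 1 / (((d : ℝ) - 1) * ((d : ℝ) - 2)) := by rw [aOne, hmid]; linarith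
  have haOne3 : ((d : ℝ) - 1) * aOne d a < 1 / ((d : ℝ) - 2) := by
    rw [lt_div_iff₀ (by positivity)] at haOne2 ⊢
    linarith
  have hhalf : 1 / (2 * ((d : ℝ) - 2)) = 1 / ((d : ℝ) - 2) / 2 := by field_simp
  -- δ is the value of μ - (d - 1) a₁ at the lower end of the admissible range of μ. The factor 1/2
  -- in c₀ pays for the denominator μ + a ≤ 2 in the exponent at the origin.
  refine ⟨1 / (2 * ((d : ℝ) - 2)) - ((d : ℝ) - 1) * aOne d a / 2, (1 - 1 / x) / 2, ?_, by linarith,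
    by linarith, fun μ hμ => ?_⟩
  · rw [hhalf]; linarith
  obtain ⟨hμ1, hμ2⟩ := hμ
  have hμa1 : ((d : ℝ) - 1) * aOne d a < μ := by rw [hhalf] at hμ1; linarith
  have hμa : ((d : ℝ) - 1) * a < μ := by nlinarith
  have hμ0 : 0 < μ := lt_trans (by positivity) hμa
  have hμle : μ ≤ 1 := hμ2.le.trans (by rw [div_le_one hD2]; linarith)
  have hmu2 : μ * ((d : ℝ) - 2) < 1 := by rwa [lt_div_iff₀ hD2] at hμ2
  exact
  { three_le := hd
    δ_pos := by rw [hhalf]; linarith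
    c₀_pos := by linarith
    c₀_le := by linarith
    μ_le := hμle
    a_pos := ha0
    a_le_aOne := haOne1.le
    aOne_le := haOne2.le.trans (by
      rw [div_le_div_iff₀ (by positivity) (by norm_num)]; nlinarith)
    δ_le := by linarith
    exp_z := by
      have : 1 / (d * μ) ≤ 1 / x := by
        gcongr
        rw [hx]; nlinarith
      linarith
    exp_r := by
      have h1 : ((d : ℝ) - 1) / (d * μ) ≤ ((d : ℝ) - 2) * (1 / x) := by
        rw [hx, div_le_iff₀ (by positivity)]
        have : ((d : ℝ) - 2) * (1 / ((d : ℝ) * (d - 2) * a)) * (d * μ) = μ / a := by field_simp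
        rw [this, le_div_iff₀ ha0]
        exact hμa.le
      nlinarith
    exp_origin := by
      have h1 : (d : ℝ) - 2 - gammaExp d μ a =
          (((d : ℝ) - 3) * μ + (2 * d - 3) * a - 1) / (μ + a) := by
        rw [gammaExp]
        field_simp
        ring
      have h2 : 1 - 1 / x ≤ x - 1 := by
        have : 1 / x * x = 1 := by field_simp
        nlinarith
      rw [h1, le_div_iff₀ (by positivity)]
      -- Inserting μ ≥ (d - 1) a gives (d - 3)(d - 1) + (2d - 3) = d (d - 2), hence x.
      have h3 : x - 1 ≤ ((d : ℝ) - 3) * μ + (2 * d - 3) * a - 1 := by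
        rw [hx]; nlinarith
      have h4 : μ + a ≤ 2 := by nlinarith
      nlinarith
    exp_decay := by rw [lt_div_iff₀ hμ0]; linarith }

/-- All quantities are positive, so after taking logarithms the claim is linear: log (v b / bz) ≤ 0
is used with weight 1 + ε, and log (n / b) ≤ 0 with weight 1 + e. -/
lemma weight_transport_bound {u v n b bz ε e : ℝ} (hu : 0 < u) (hv : 0 < v) (hn : 0 < n)
    (hb : 0 < b) (hbz : 0 < bz) (h1 : v * n * b ≤ n * bz) (h2 : n ≤ b) (he : 0 ≤ e) (hp : e ≤ ε) :
    u * v ^ 2 * n ^ 2 * (b ^ (ε - e) * (u * n) ^ (e - 1) * bz ^ (-1 - ε)) ≤ u ^ e * v ^ (1 - ε) := by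
  obtain ⟨U, rfl⟩ : ∃ U, Real.exp U = u := ⟨_, Real.exp_log hu⟩
  obtain ⟨V, rfl⟩ : ∃ U, Real.exp U = v := ⟨_, Real.exp_log hv⟩
  obtain ⟨N, rfl⟩ : ∃ U, Real.exp U = n := ⟨_, Real.exp_log hn⟩
  obtain ⟨B, rfl⟩ : ∃ U, Real.exp U = b := ⟨_, Real.exp_log hb⟩
  obtain ⟨Z, rfl⟩ : ∃ U, Real.exp U = bz := ⟨_, Real.exp_log hbz⟩
  simp only [← Real.exp_add, ← Real.exp_mul, ← Real.exp_nat_mul, Real.exp_le_exp] at *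
  push_cast
  have h3 : V + N - Z ≤ N - B := by linarith
  have h4 := mul_le_mul_of_nonneg_right h3 (by linarith : 0 ≤ 1 + ε)
  have h5 := mul_nonneg (sub_nonneg.2 h2) (by linarith : 0 ≤ 1 + ε - (ε - e))
  nlinarith

lemma mul_rpow_le_of_le {u v e₁ e₂ c₀ : ℝ} (hu : 0 < u) (hu1 : u ≤ 1) (hv : 0 < v) (hv1 : v ≤ 1)
    (h₁ : c₀ ≤ e₁) (h₂ : c₀ ≤ e₂) : u ^ e₁ * v ^ e₂ ≤ (u * v) ^ c₀ := by
  rw [Real.mul_rpow hu.le hv.le]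
  exact mul_le_mul (Real.rpow_le_rpow_of_exponent_ge hu hu1 h₁)
    (Real.rpow_le_rpow_of_exponent_ge hv hv1 h₂) (Real.rpow_nonneg hv.le _)
    (Real.rpow_nonneg hu.le _)

lemma abs_dr_le_gradNorm (f : ℝ × ℝ → ℝ) (p : ℝ × ℝ) : |dr f p| ≤ gradNorm f p :=
  Real.abs_le_sqrt (by nlinarith [sq_nonneg (dz f p)])

lemma abs_dz_le_gradNorm (f : ℝ × ℝ → ℝ) (p : ℝ × ℝ) : |dz f p| ≤ gradNorm f p :=
  Real.abs_le_sqrt (by nlinarith [sq_nonneg (dr f p)])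

lemma abs_drdz_le_hessNorm (f : ℝ × ℝ → ℝ) (p : ℝ × ℝ) : |dr (dz f) p| ≤ hessNorm f p :=
  Real.abs_le_sqrt (by
    nlinarith [sq_nonneg (dr (dr f) p), sq_nonneg (dz (dr f) p), sq_nonneg (dz (dz f) p)])

lemma abs_dzdz_le_hessNorm (f : ℝ × ℝ → ℝ) (p : ℝ × ℝ) : |dz (dz f) p| ≤ hessNorm f p :=
  Real.abs_le_sqrt (by
    nlinarith [sq_nonneg (dr (dr f) p), sq_nonneg (dz (dr f) p), sq_nonneg (dr (dz f) p)])

/-! ### From the class 𝒜⁰ to the weighted bounds -/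

section MemA0Bounds

variable {d : ℕ} {a μ δ c₀ : ℝ} {ψ : ℝ × ℝ → ℝ} {p : ℝ × ℝ}

namespace ParameterBounds

lemma three_le_real (hb : ParameterBounds d a μ δ c₀) : (3 : ℝ) ≤ d := by exact_mod_cast hb.three_le

lemma δ_le_μ (hb : ParameterBounds d a μ δ c₀) : δ ≤ μ := by
  have h1 := hb.three_le_real
  have h2 := hb.δ_le
  have h3 := hb.a_pos
  have h4 := hb.a_le_aOne
  nlinarith

lemma μ_pos (hb : ParameterBounds d a μ δ c₀) : 0 < μ := hb.δ_pos.trans_le hb.δ_le_μ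

/-- The weighted size of the Hessian of a member of `𝒜⁰`. -/
lemma hess_bound (hb : ParameterBounds d a μ δ c₀) (hψ : MemA0 d a μ ψ) {u v n : ℝ}
    (hp : p ∈ quadrant) (hu : 0 < u) (hu1 : u ≤ 1) (hv : 0 < v) (hv1 : v ≤ 1) (hn : 0 < n)
    (hpu : p.1 = u * n) (hpv : p.2 = v * n) (hnr : n = radius p) :
    u * v ^ 2 * n ^ 2 * hessNorm ψ p ≤ (u * v) ^ c₀ * ψ p := by
  have hψ0 := hψ.pos p (quadrant_subset_closedQuadrant hp)
  have hμ := hb.μ_pos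
  have hd := hb.three_le_real
  set ε := 1 / (d * μ) with hε
  set e := (d : ℝ) - 2 - ((d : ℝ) - 1) / (d * μ) with he
  have h1 : (2 : ℝ) - d + 1 / μ = ε - e := by rw [hε, he]; field_simp; ring
  -- Here ε - e = 1/μ - (d - 2), positive by admissibility of μ.
  have hee : e ≤ ε := by linarith [hb.exp_decay]
  have hT1 : u * v ^ 2 * n ^ 2 * (bracket p ^ (2 - (d : ℝ) + 1 / μ) *
      p.1 ^ ((d : ℝ) - 3 - ((d : ℝ) - 1) / (d * μ)) * bracketOne p.2 ^ (-1 - 1 / (d * μ))) ≤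
      (u * v) ^ c₀ := by
    rw [h1, show (d : ℝ) - 3 - ((d : ℝ) - 1) / (d * μ) = e - 1 by rw [he]; ring, hpu]
    refine (weight_transport_bound hu hv hn (bracket_pos p) (bracketOne_pos _) ?_ ?_
      (hb.c₀_pos.le.trans hb.exp_r) hee).trans (mul_rpow_le_of_le hu hu1 hv hv1 hb.exp_r hb.exp_z)
    · rw [← hpv]
      have := snd_mul_bracket_le (p := p)
      rwa [← hnr] at this
    · rw [hnr]; exact radius_le_bracket p
  have hT2 : u * v ^ 2 * n ^ 2 * (p.1 ^ ((d : ℝ) - 3 - gammaExp d μ a) *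
        indicator {q : ℝ × ℝ | q.1 ^ 2 + q.2 ^ 2 ≤ 1} (fun _ => (1 : ℝ)) p) ≤ (u * v) ^ c₀ := by
    by_cases hmem : p.1 ^ 2 + p.2 ^ 2 ≤ 1
    · have hn1 : n ≤ 1 := by
        rw [hnr, radius]; exact Real.sqrt_le_one.2 hmem
      rw [indicator_of_mem (by exact hmem), mul_one, hpu]
      set e₂ := (d : ℝ) - 2 - gammaExp d μ a with he₂
      rw [show (d : ℝ) - 3 - gammaExp d μ a = e₂ - 1 by rw [he₂]; ring,
        Real.mul_rpow hu.le hn.le, Real.rpow_sub_one hu.ne', Real.rpow_sub_one hn.ne']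
      have e3 : u * v ^ 2 * n ^ 2 * (u ^ e₂ / u * (n ^ e₂ / n)) = u ^ e₂ * v ^ 2 * (n * n ^ e₂) := by
        field_simp
      have e4 : n * n ^ e₂ ≤ 1 := mul_le_one₀ hn1 (Real.rpow_nonneg hn.le _)
        (Real.rpow_le_one hn.le hn1 (hb.c₀_pos.le.trans hb.exp_origin))
      rw [e3]
      refine (mul_le_of_le_one_right (by positivity) e4).trans ?_
      rw [← Real.rpow_natCast v 2]
      exact mul_rpow_le_of_le hu hu1 hv hv1 hb.exp_origin (by push_cast; linarith [hb.c₀_le])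
    · rw [indicator_of_notMem (by exact hmem), mul_zero, mul_zero]
      positivity
  have hmul := mul_le_mul_of_nonneg_left (hψ.hess_le p hp)
    (by positivity : 0 ≤ u * v ^ 2 * n ^ 2)
  refine hmul.trans ?_
  calc _ = 1 / 10 * (u * v ^ 2 * n ^ 2 * (bracket p ^ (2 - (d : ℝ) + 1 / μ) *
          p.1 ^ ((d : ℝ) - 3 - ((d : ℝ) - 1) / (d * μ)) * bracketOne p.2 ^ (-1 - 1 / (d * μ))) +
        u * v ^ 2 * n ^ 2 * (p.1 ^ ((d : ℝ) - 3 - gammaExp d μ a) *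
          indicator {q : ℝ × ℝ | q.1 ^ 2 + q.2 ^ 2 ≤ 1} (fun _ => (1 : ℝ)) p)) * ψ p := by ring
    _ ≤ 1 / 10 * ((u * v) ^ c₀ + (u * v) ^ c₀) * ψ p := by gcongr
    _ ≤ _ := by
      have : 0 < (u * v) ^ c₀ := Real.rpow_pos_of_pos (by positivity) _
      nlinarith [mul_pos this hψ0]

lemma abs_dr_bound (hψ : MemA0 d a μ ψ) {u n : ℝ} (hp : p ∈ quadrant) (hu : 0 < u)
    (hpu : p.1 = u * n) (hnr : n = radius p) : |p.1 * dr ψ p| ≤ u * (ψ p / 10) := by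
  have h := hψ.dr_le p hp
  rw [abs_mul, abs_of_pos (bracket_pos p)] at h
  rw [abs_mul, abs_of_pos hp.1, hpu, mul_assoc]
  have : n * |dr ψ p| ≤ bracket p * |dr ψ p| := by
    gcongr
    rw [hnr]; exact radius_le_bracket p
  gcongr
  linarith

/-- The radius n is at most ⟨r, z⟩ and z is at most ⟨z⟩; both exponents are negative, so all powers
of n cancel and a positive power of z / n is left. -/
lemma abs_dz_bound (hb : ParameterBounds d a μ δ c₀) (hψ : MemA0 d a μ ψ) {v n : ℝ}
    (hp : p ∈ quadrant) (hv : 0 < v) (hn : 0 < n) (hpv : p.2 = v * n) (hnr : n = radius p) :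
    |p.2 * dz ψ p| ≤ v ^ (1 - 1 / (d * μ)) * (ψ p / 10) := by
  have h := (abs_dz_le_gradNorm ψ p).trans (hψ.grad_le p hp)
  have hμ := hb.μ_pos
  have hd := hb.three_le_real
  have hψ0 := hψ.pos p (quadrant_subset_closedQuadrant hp)
  set ε := 1 / (d * μ) with hε
  have hε0 : 0 ≤ ε := by positivity
  have hε1 : 0 ≤ 1 - ε := hb.c₀_pos.le.trans hb.exp_z
  have key : p.2 * (bracket p ^ (-1 + ε) * bracketOne p.2 ^ (-ε)) ≤ v ^ (1 - ε) := by
    have e1 : n * bracket p ^ (-1 + ε) ≤ n ^ ε := by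
      have : bracket p ^ (-1 + ε) ≤ n ^ (-1 + ε) :=
        Real.rpow_le_rpow_of_nonpos hn (by rw [hnr]; exact radius_le_bracket p) (by linarith)
      calc n * bracket p ^ (-1 + ε) ≤ n * n ^ (-1 + ε) := by gcongr
        _ = n ^ ε := by rw [Real.rpow_add hn, Real.rpow_neg_one]; field_simp
    have e2 : bracketOne p.2 ^ (-ε) ≤ p.2 ^ (-ε) :=
      Real.rpow_le_rpow_of_nonpos hp.2 (le_bracketOne _) (by linarith)
    have e3 := Real.rpow_nonneg (bracketOne_pos p.2).le (-ε)
    calc p.2 * (bracket p ^ (-1 + ε) * bracketOne p.2 ^ (-ε))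
        = v * (n * bracket p ^ (-1 + ε)) * bracketOne p.2 ^ (-ε) := by
          nth_rewrite 1 [hpv]; ring
      _ ≤ v * n ^ ε * p.2 ^ (-ε) := by gcongr
      _ = v ^ (1 - ε) := by
          rw [hpv, Real.mul_rpow hv.le hn.le, Real.rpow_neg hn.le, Real.rpow_sub hv,
            Real.rpow_one, Real.rpow_neg hv.le]
          have := (Real.rpow_pos_of_pos hn ε).ne'
          field_simp
  rw [abs_mul, abs_of_pos hp.2]
  calc p.2 * |dz ψ p| ≤ p.2 * (1 / 10 * bracket p ^ (-1 + ε) * bracketOne p.2 ^ (-ε) * ψ p) := by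
        have := hp.2.le
        gcongr
    _ = p.2 * (bracket p ^ (-1 + ε) * bracketOne p.2 ^ (-ε)) * (ψ p / 10) := by ring
    _ ≤ _ := by gcongr

/-- With r = u n, z = v n, n = |(r, z)|, the angles of (r, z) and (r, w) are comparable because δ ≤
μ + ψ ≤ 2. It therefore suffices to bound v² or u² times each quantity by (u v)^c₀ ψ. The estimates
in 𝒜⁰ leave powers of u and v with exponents at least c₀, uniformly in n. -/
lemma profileBounds (hb : ParameterBounds d a μ δ c₀) (hψ : MemA0 d a μ ψ) :
    ProfileBounds d μ ψ δ c₀ (16 / δ ^ 3) := by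
  have hδ := hb.δ_pos
  have hδμ := hb.δ_le_μ
  have hμ1 := hb.μ_le
  have hd := hb.three_le_real
  have hpos : ∀ p ∈ quadrant, 0 < ψ p := fun p hp => hψ.pos p (quadrant_subset_closedQuadrant hp)
  have hle : ∀ p ∈ quadrant, ψ p ≤ aOne d a := fun p hp =>
    hψ.le_aOne p (quadrant_subset_closedQuadrant hp)
  have hhalf : ∀ p ∈ quadrant, ψ p ≤ 1 / 2 := fun p hp => (hle p hp).trans hb.aOne_le
  -- polar decomposition `r = u n`, `z = v n`, compared with the angle of `(r, w)`
  have polar : ∀ p ∈ quadrant, ∃ u v n : ℝ, 0 < u ∧ u ≤ 1 ∧ 0 < v ∧ v ≤ 1 ∧ 0 < n ∧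
      p.1 = u * n ∧ p.2 = v * n ∧ n = radius p ∧
      (∀ Y, 0 ≤ Y → v ^ 2 * Y ≤ (u * v) ^ c₀ * ψ p →
        cosSq μ ψ p * Y ≤ 16 / δ ^ 3 * (sinCos μ ψ p ^ c₀ * ψ p)) ∧
      (∀ Y, 0 ≤ Y → u ^ 2 * Y ≤ (u * v) ^ c₀ * ψ p →
        sinSq μ ψ p * Y ≤ 16 / δ ^ 3 * (sinCos μ ψ p ^ c₀ * ψ p)) := by
    intro p hp
    have hn := radius_pos hp
    have hr := hp.1
    have hz := hp.2
    have hsq := radius_sq p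
    have hψp := hpos p hp
    have hψh := hhalf p hp
    have hk : δ ≤ μ + ψ p := by linarith
    have hk2 : μ + ψ p ≤ 2 := by linarith
    set n := radius p
    have hu1 : p.1 / n ≤ 1 := by
      rw [div_le_one hn]; nlinarith
    have hv1 : p.2 / n ≤ 1 := by
      rw [div_le_one hn]; nlinarith
    have hδ1 : δ ≤ 1 := hδμ.trans hμ1
    set k := μ + ψ p with hkdef
    have hk0 : 0 < k := hδ.trans_le hk
    have hρ : wFun μ ψ p = k * p.2 := rfl
    have hlow : δ ^ 2 * n ^ 2 ≤ p.1 ^ 2 + (k * p.2) ^ 2 := by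
      have h1 : δ ^ 2 ≤ 1 := pow_le_one₀ hδ.le hδ1
      have h2 : δ ^ 2 ≤ k ^ 2 := by gcongr
      rw [hsq, mul_pow]
      nlinarith [sq_nonneg p.1, sq_nonneg p.2]
    have hupp : p.1 ^ 2 + (k * p.2) ^ 2 ≤ 4 * n ^ 2 := by
      have h2 : k ^ 2 ≤ 2 ^ 2 := by gcongr
      rw [hsq, mul_pow]
      nlinarith [sq_nonneg p.1, sq_nonneg p.2]
    have hcos : cosSq μ ψ p ≤ 4 / δ ^ 2 * (p.2 / n) ^ 2 := by
      rw [cosSq, hρ]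
      calc (k * p.2) ^ 2 / (p.1 ^ 2 + (k * p.2) ^ 2) ≤ (2 * p.2) ^ 2 / (δ ^ 2 * n ^ 2) := by gcongr
        _ = _ := by field_simp; ring
    have hsin : sinSq μ ψ p ≤ 4 / δ ^ 2 * (p.1 / n) ^ 2 := by
      rw [sinSq, hρ]
      calc p.1 ^ 2 / (p.1 ^ 2 + (k * p.2) ^ 2) ≤ (2 * p.1) ^ 2 / (δ ^ 2 * n ^ 2) := by
            gcongr; linarith
        _ = _ := by field_simp; ring
    have hprod : p.1 / n * (p.2 / n) ≤ 4 / δ * sinCos μ ψ p := by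
      rw [sinCos, hρ]
      calc p.1 / n * (p.2 / n) = 4 / δ * (p.1 * (δ * p.2) / (4 * n ^ 2)) := by field_simp
        _ ≤ 4 / δ * (p.1 * (k * p.2) / (p.1 ^ 2 + (k * p.2) ^ 2)) := by gcongr
    have hsc0 : 0 < sinCos μ ψ p := by rw [sinCos, hρ]; positivity
    -- (4/δ)^c₀ ≤ 4/δ, since 4/δ ≥ 1 and c₀ ≤ 1; one factor 4/δ here and one 4/δ² from the squares
    -- give 16/δ³.
    have hweight : (p.1 / n * (p.2 / n)) ^ c₀ ≤ 4 / δ * sinCos μ ψ p ^ c₀ := by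
      refine (Real.rpow_le_rpow (by positivity) hprod hb.c₀_pos.le).trans ?_
      rw [Real.mul_rpow (by positivity) hsc0.le]
      have h4 : 1 ≤ 4 / δ := by rw [le_div_iff₀ hδ]; linarith
      gcongr
      exact (Real.rpow_le_rpow_of_exponent_le h4 hb.c₀_le).trans_eq (Real.rpow_one _)
    refine ⟨p.1 / n, p.2 / n, n, div_pos hr hn, hu1, div_pos hz hn, hv1, hn, by field_simp,
      by field_simp, rfl, fun Y hY h => ?_, fun Y hY h => ?_⟩
    · calc cosSq μ ψ p * Y ≤ 4 / δ ^ 2 * (p.2 / n) ^ 2 * Y := by gcongr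
        _ = 4 / δ ^ 2 * ((p.2 / n) ^ 2 * Y) := by ring
        _ ≤ 4 / δ ^ 2 * (4 / δ * sinCos μ ψ p ^ c₀ * ψ p) :=
          mul_le_mul_of_nonneg_left (h.trans (by gcongr)) (by positivity)
        _ = _ := by field_simp; ring
    · calc sinSq μ ψ p * Y ≤ 4 / δ ^ 2 * (p.1 / n) ^ 2 * Y := by gcongr
        _ = 4 / δ ^ 2 * ((p.1 / n) ^ 2 * Y) := by ring
        _ ≤ 4 / δ ^ 2 * (4 / δ * sinCos μ ψ p ^ c₀ * ψ p) :=
          mul_le_mul_of_nonneg_left (h.trans (by gcongr)) (by positivity)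
        _ = _ := by field_simp; ring
  have huv : ∀ u v : ℝ, 0 < u → u ≤ 1 → 0 < v → v ≤ 1 → u * v ≤ (u * v) ^ c₀ := by
    intro u v hu hu1 hv hv1
    have := mul_rpow_le_of_le hu hu1 hv hv1 hb.c₀_le hb.c₀_le
    simpa using this
  refine ⟨hψ.contDiffOn, hb.three_le, hδ, hb.c₀_pos, hb.c₀_le, by positivity, hδμ, hμ1, hpos, hhalf,
    fun p hp => ?_, fun p hp => ?_, fun p hp => ?_, fun p hp => ?_, fun p hp => ?_, fun p hp => ?_,
    fun p hp => ?_, fun p hp => ?_⟩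
  all_goals
    obtain ⟨u, v, n, hu, hu1, hv, hv1, hn, hpu, hpv, hnr, hcos, hsin⟩ := polar p hp
    have hψp := hpos p hp
  · have h1 := hb.δ_le
    have h2 := hle p hp
    rw [hFun]; nlinarith
  · refine (abs_dr_bound hψ hp hu hpu hnr).trans ?_
    nlinarith
  · refine (hb.abs_dz_bound hψ hp hv hn hpv hnr).trans ?_
    exact mul_le_of_le_one_left (by positivity)
      (Real.rpow_le_one hv.le hv1 (hb.c₀_pos.le.trans hb.exp_z))
  · refine hcos _ (abs_nonneg _) ?_
    have h1 := abs_dr_bound hψ hp hu hpu hnr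
    have h2 := huv u v hu hu1 hv hv1
    calc v ^ 2 * |p.1 * dr ψ p| ≤ v ^ 2 * (u * (ψ p / 10)) := by gcongr
      _ = v * (u * v) * (ψ p / 10) := by ring
      _ ≤ 1 * (u * v) ^ c₀ * ψ p := by gcongr; linarith
      _ = _ := by ring
  · refine hsin _ (abs_nonneg _) ?_
    have h1 := hb.abs_dz_bound hψ hp hv hn hpv hnr
    have h2 := mul_rpow_le_of_le (e₁ := 2) hu hu1 hv hv1 (by linarith [hb.c₀_le]) hb.exp_z
    calc u ^ 2 * |p.2 * dz ψ p| ≤ u ^ 2 * (v ^ (1 - 1 / (d * μ)) * (ψ p / 10)) := by gcongr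
      _ = u ^ (2 : ℝ) * v ^ (1 - 1 / (d * μ)) * (ψ p / 10) := by
          rw [← Real.rpow_natCast u 2]; push_cast; ring
      _ ≤ (u * v) ^ c₀ * ψ p := by gcongr; linarith
  all_goals
    have hH := hb.hess_bound hψ hp hu hu1 hv hv1 hn hpu hpv hnr
    have hzz := abs_dzdz_le_hessNorm ψ p
    have hrz := abs_drdz_le_hessNorm ψ p
    have hH0 : 0 ≤ hessNorm ψ p := Real.sqrt_nonneg _
  · refine hcos _ (abs_nonneg _) (le_trans ?_ hH)
    rw [abs_mul, abs_of_pos (mul_pos hp.1 hp.2), hpu, hpv]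
    calc v ^ 2 * (u * n * (v * n) * |dr (dz ψ) p|) ≤ v ^ 2 * (u * n * (1 * n) * hessNorm ψ p) := by
          gcongr
      _ = _ := by ring
  · refine hsin _ (abs_nonneg _) (le_trans ?_ hH)
    rw [abs_mul, abs_of_pos (pow_pos hp.2 2), hpv]
    calc u ^ 2 * ((v * n) ^ 2 * |dz (dz ψ) p|) ≤ u * 1 * ((v * n) ^ 2 * hessNorm ψ p) := by
          rw [sq u]; gcongr
      _ = _ := by ring
  · rw [mul_assoc]
    refine hcos _ (by positivity) (le_trans ?_ hH)
    have h1 := abs_dr_bound hψ hp hu hpu hnr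
    have h2 : u * (ψ p / 10) ≤ u * 1 := by
      gcongr; linarith [hhalf p hp]
    rw [abs_mul (p.2 ^ 2), abs_of_pos (pow_pos hp.2 2), hpv]
    calc v ^ 2 * (|p.1 * dr ψ p| * ((v * n) ^ 2 * |dz (dz ψ) p|))
        ≤ 1 ^ 2 * (u * 1 * ((v * n) ^ 2 * hessNorm ψ p)) := by
          gcongr
          exact h1.trans h2
      _ = _ := by ring

end ParameterBounds

end MemA0Bounds

/-! ### The transport equation in the adapted coordinates -/

namespace ProfileBounds

variable {d : ℕ} {μ δ c₀ C : ℝ} {ψ : ℝ × ℝ → ℝ} {p : ℝ × ℝ} {y : ℝ → ℝ}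

lemma ofQuad_snd_eq_angle (hB : ProfileBounds d μ ψ δ c₀ C) (hp : p ∈ quadrant) :
    Real.sin (angle (ofQuad μ ψ p).2) ^ 2 = sinSq μ ψ p ∧
      Real.cos (angle (ofQuad μ ψ p).2) ^ 2 = cosSq μ ψ p := by
  rw [← hB.sinSq_toQuad, ← hB.cosSq_toQuad, hB.toQuad_ofQuad hp]
  exact ⟨rfl, rfl⟩

lemma hasDerivAt_w_r (hB : ProfileBounds d μ ψ δ c₀ C) (hp : p ∈ quadrant) :
    HasDerivAt (fun t => wFun μ ψ (t, p.2)) (dr ψ p * p.2) p.1 :=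
  ((hasDerivAt_dr (hB.differentiableAt hp)).const_add μ).mul_const p.2

/-- The radial derivative in the adapted coordinates. -/
lemma mul_dr_comp_ofQuad (hB : ProfileBounds d μ ψ δ c₀ C) (hp : p ∈ quadrant) {f : ℝ × ℝ → ℝ}
    (hf : Differentiable ℝ f) :
    p.1 * dr (fun p => f (ofQuad μ ψ p)) p =
      dr f (ofQuad μ ψ p) * (sinSq μ ψ p + cosSq μ ψ p * (p.1 * dr ψ p / (μ + ψ p))) +
        dz f (ofQuad μ ψ p) * (1 - p.1 * dr ψ p / (μ + ψ p)) := by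
  have hw := hB.w_pos hp
  have hr := hp.1
  have hz := hp.2
  have hk := hB.k_pos hp
  have hρ : 0 < p.1 ^ 2 + wFun μ ψ p ^ 2 := by positivity
  have h1 := hB.hasDerivAt_w_r hp
  have h2 := ((((hasDerivAt_id p.1).pow 2).add (h1.pow 2)).log hρ.ne').div_const 2
  have h3 := ((hasDerivAt_id p.1).log hr.ne').sub (h1.log hw.ne')
  have h4 := (hasDerivAt_comp_curve (f := f) (hf _) h2 h3).deriv
  have h5 : dr (fun p => f (ofQuad μ ψ p)) p = dr f (ofQuad μ ψ p) *
      (((2 : ℕ) * p.1 ^ (2 - 1) * 1 + (2 : ℕ) * wFun μ ψ p ^ (2 - 1) * (dr ψ p * p.2)) /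
        (p.1 ^ 2 + wFun μ ψ p ^ 2) / 2) +
      dz f (ofQuad μ ψ p) * (1 / p.1 - dr ψ p * p.2 / wFun μ ψ p) := h4
  rw [h5, sinSq, cosSq]
  generalize dr f (ofQuad μ ψ p) = a
  generalize dz f (ofQuad μ ψ p) = b
  have e : wFun μ ψ p = (μ + ψ p) * p.2 := rfl
  have hρ' := hρ
  rw [e] at hρ' ⊢
  push_cast
  field_simp

/-- The vertical derivative in the adapted coordinates. -/
lemma mul_dz_comp_ofQuad (hB : ProfileBounds d μ ψ δ c₀ C) (hp : p ∈ quadrant) {f : ℝ × ℝ → ℝ}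
    (hf : Differentiable ℝ f) :
    p.2 * dz (fun p => f (ofQuad μ ψ p)) p =
      (dr f (ofQuad μ ψ p) * cosSq μ ψ p - dz f (ofQuad μ ψ p)) * (aFun μ ψ p / (μ + ψ p)) := by
  have hw := hB.w_pos hp
  have hr := hp.1
  have hz := hp.2
  have hk := hB.k_pos hp
  have hρ : 0 < p.1 ^ 2 + wFun μ ψ p ^ 2 := by positivity
  have h1 := hB.hasDerivAt_w_z hp
  have h2 := (((hasDerivAt_const p.2 (p.1 ^ 2)).add (h1.pow 2)).log hρ.ne').div_const 2
  have h3 := (hasDerivAt_const p.2 (Real.log p.1)).sub (h1.log hw.ne')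
  have h4 := (hasDerivAt_comp_curve (f := f) (hf _) h2 h3).deriv
  have h5 : dz (fun p => f (ofQuad μ ψ p)) p = dr f (ofQuad μ ψ p) *
      ((0 + (2 : ℕ) * wFun μ ψ p ^ (2 - 1) * aFun μ ψ p) / (p.1 ^ 2 + wFun μ ψ p ^ 2) / 2) +
      dz f (ofQuad μ ψ p) * (0 - aFun μ ψ p / wFun μ ψ p) := h4
  rw [h5, cosSq]
  generalize dr f (ofQuad μ ψ p) = a
  generalize dz f (ofQuad μ ψ p) = b
  have e : wFun μ ψ p = (μ + ψ p) * p.2 := rfl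
  have hρ' := hρ
  rw [e] at hρ' ⊢
  push_cast
  field_simp
  ring

/-- The transport operator in the adapted coordinates. -/
lemma transport_comp_ofQuad (hB : ProfileBounds d μ ψ δ c₀ C) (hp : p ∈ quadrant)
    {f : ℝ × ℝ → ℝ} (hf : Differentiable ℝ f)
    (h : dr f (ofQuad μ ψ p) + fField d μ ψ (ofQuad μ ψ p) * dz f (ofQuad μ ψ p) =
      -qField d μ ψ (ofQuad μ ψ p)) :
    (μ + ψ p + p.2 * dz ψ p) * (p.1 * dr (fun p => f (ofQuad μ ψ p)) p) +
      (μ - ((d : ℝ) - 1) * ψ p - p.1 * dr ψ p) * (p.2 * dz (fun p => f (ofQuad μ ψ p)) p) =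
        -1 := by
  rw [hB.mul_dr_comp_ofQuad hp hf, hB.mul_dz_comp_ofQuad hp hf]
  obtain ⟨-, ec⟩ := hB.ofQuad_snd_eq_angle hp
  have hs : sinSq μ ψ p = 1 - cosSq μ ψ p := by
    have hw := hB.w_pos hp
    have hr := hp.1
    rw [sinSq, cosSq, eq_sub_iff_add_eq, ← add_div, div_self]
    positivity
  have hD := (hB.dn_pos (ofQuad μ ψ p)).ne'
  have hk := (hB.k_pos hp).ne'
  have hA := (hB.a_pos hp).ne'
  have hDe : dnFun d μ ψ (ofQuad μ ψ p) = μ + ψ p - cosSq μ ψ p * (d * ψ p) := by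
    rw [dnFun, hB.toQuad_ofQuad hp, ec]
  rw [fField, qField, hB.toQuad_ofQuad hp] at h
  rw [← aFun.eq_1]
  set a := dr f (ofQuad μ ψ p)
  set b := dz f (ofQuad μ ψ p)
  have h' : dnFun d μ ψ (ofQuad μ ψ p) * aFun μ ψ p * a + aFun μ ψ p * (d * ψ p) * b =
      -(μ + ψ p) := by
    field_simp at h
    linear_combination h
  rw [hDe] at h'
  rw [hs]
  field_simp
  linear_combination h'

/-- A solution of the transport equation along a characteristic. -/
lemma hasDerivAt_along (hB : ProfileBounds d μ ψ δ c₀ C) (hy : IsTrajectory (fField d μ ψ) y)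
    {Ω : ℝ × ℝ → ℝ} (hΩ : DifferentiableOn ℝ Ω quadrant)
    (htr : ∀ p ∈ quadrant, (μ + ψ p + p.2 * dz ψ p) * (p.1 * dr Ω p) +
      (μ - ((d : ℝ) - 1) * ψ p - p.1 * dr ψ p) * (p.2 * dz Ω p) = -Ω p) (t : ℝ) :
    HasDerivAt (fun t => Ω (toQuad μ ψ (t, y t)))
      (-qField d μ ψ (t, y t) * Ω (toQuad μ ψ (t, y t))) t := by
  have hP := hB.toQuad_mem (t, y t)
  refine (hasDerivAt_comp_curve (f := Ω)
    (hΩ.differentiableAt (isOpen_quadrant.mem_nhds (hB.toQuad_mem (t, y t))))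
    (hasDerivAt_toQuad_fst (μ := μ) (ψ := ψ) (hasDerivAt_id t) (hy t))
    (hB.hasDerivAt_toQuad_snd (hasDerivAt_id t) (hy t) rfl)).congr_deriv ?_
  have hD := (hB.dn_pos (t, y t)).ne'
  have hA := (hB.a_pos hP).ne'
  have e1 : 1 + Real.cos (angle (y t)) ^ 2 * fField d μ ψ (t, y t) =
      (μ + ψ (toQuad μ ψ (t, y t))) / dnFun d μ ψ (t, y t) := by
    rw [fField]; field_simp; rw [dnFun]; ring
  have e2 : 1 - Real.sin (angle (y t)) ^ 2 * fField d μ ψ (t, y t) =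
      hFun d μ ψ (toQuad μ ψ (t, y t)) / dnFun d μ ψ (t, y t) := by
    rw [fField]; field_simp; rw [dnFun, hFun, Real.sin_sq]; ring
  simp only [id, Prod.mk.eta, e1, e2, qField]
  have h := htr _ hP
  rw [← aFun.eq_1] at h
  set P := toQuad μ ψ (t, y t)
  rw [hFun]
  field_simp
  linear_combination (μ + ψ P) * h

end ProfileBounds

/-! ### Bounds along a characteristic -/

/-- Either χ is the pure power of cos σ, or 3d cos σ ≥ 1 ≥ χ. Thus χ absorbs the singularity (cos
σ)^{-1/(dμ)} of the data and leaves a factor cos σ, which becomes the factor z in the bounds for Ω.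
-/
lemma log_chi_le {d : ℕ} {μ : ℝ} {η : ℝ → ℝ} (hη : IsEta d η) (hd : 0 < d) (hμ : 0 < μ)
    {σ : ℝ} (hσ : σ ∈ Ioo 0 (Real.pi / 2)) :
    Real.log (chi d μ η σ) ≤
      (1 + 1 / (d * μ)) * (Real.log (3 * d) + Real.log (Real.cos σ)) := by
  have hc := cos_pos_of_mem hσ
  have hd' : (1 : ℝ) ≤ d := by exact_mod_cast hd
  have hE : (0 : ℝ) < 1 + 1 / (d * μ) := by positivity
  rcases le_or_gt (Real.arccos (1 / (3 * d))) σ with h | h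
  · have : chi d μ η σ = Real.cos σ ^ (1 + 1 / (d * μ)) := by
      simp [chi, hη.eq_zero σ h hσ.2]
    rw [this, Real.log_rpow hc]
    have : 0 ≤ Real.log (3 * d) := Real.log_nonneg (by linarith)
    gcongr
    linarith
  · have h1 : 1 / (3 * d) ≤ Real.cos σ := by
      have h2 := Real.cos_le_cos_of_nonneg_of_le_pi hσ.1.le (Real.arccos_le_pi _) h.le
      rwa [Real.cos_arccos (by have : (0 : ℝ) ≤ 1 / (3 * d) := by positivity
                               linarith)
        (by rw [div_le_one (by positivity)]; linarith)] at h2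
    have h2 := Real.log_nonpos (chi_pos hη hμ hσ).le (chi_mem hη hμ hσ).2
    have h3 : 0 ≤ Real.log (3 * d) + Real.log (Real.cos σ) := by
      rw [← Real.log_mul (by positivity) hc.ne']
      refine Real.log_nonneg ?_
      rw [div_le_iff₀ (by positivity)] at h1
      linarith
    exact h2.trans (mul_nonneg hE.le h3)

/-- Jordan's inequality gives 5πλ sin σ ≥ 10 λσ. For λσ ≤ 1/10 the explicit power applies and the
parity exponent only helps; for λσ > 1/10 the right side is nonnegative while Θ ≤ 1. So Θ absorbs
the singularity (sin σ)^{-(d-1)/(dμ)}, at the price of a power of λ. -/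
lemma log_theta_le {d : ℕ} {μ lam : ℝ} {Θ : ℝ → ℝ} (hΘ : IsTheta d μ Θ) (hd : 1 ≤ d) (hμ : 0 < μ)
    (hlam : 0 < lam) {σ : ℝ} (hσ : σ ∈ Ioo 0 (Real.pi / 2)) :
    Real.log (Θ (lam * σ)) ≤ ((d : ℝ) - 1) / (d * μ) *
      (Real.log (5 * Real.pi * lam) + Real.log (Real.sin σ)) := by
  have hs := sin_pos_of_mem hσ
  have hσ0 := hσ.1
  have hd' : (1 : ℝ) ≤ d := by exact_mod_cast hd
  have hα : 0 ≤ ((d : ℝ) - 1) / (d * μ) := div_nonneg (by linarith) (by positivity)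
  have hls : 0 < lam * σ := mul_pos hlam hσ0
  have hπ := Real.pi_pos
  have h1 : 2 / Real.pi * σ ≤ Real.sin σ := Real.mul_le_sin hσ0.le hσ.2.le
  have h2 : 10 * (lam * σ) ≤ 5 * Real.pi * lam * Real.sin σ := by
    calc 10 * (lam * σ) = 5 * Real.pi * lam * (2 / Real.pi * σ) := by field_simp; ring
      _ ≤ _ := by gcongr
  rw [← Real.log_mul (by positivity) hs.ne']
  rcases le_or_gt (lam * σ) (1 / 10) with h | h
  · rw [hΘ.vanishing _ hls h, Real.log_rpow hls]
    have h3 : Real.log (lam * σ) ≤ 0 := Real.log_nonpos hls.le (by linarith)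
    have h4 : 0 ≤ parityDelta d := by unfold parityDelta; split_ifs <;> norm_num
    have h5 : Real.log (lam * σ) ≤ Real.log (5 * Real.pi * lam * Real.sin σ) :=
      Real.log_le_log hls (by linarith)
    nlinarith [mul_nonneg h4 (neg_nonneg.2 h3)]
  · exact (Real.log_nonpos (hΘ.pos _ hls).le (hΘ.le_one _ hls)).trans
      (mul_nonneg hα (Real.log_nonneg (by linarith)))

/-- The gradient has length at most 1, and the mean value theorem applies on the ray to the origin:
ψ is continuous up to the origin and differentiable on the open segment. -/
lemma MemA0.abs_sub_le {d : ℕ} {a μ δ c₀ : ℝ} {ψ : ℝ × ℝ → ℝ} (hb : ParameterBounds d a μ δ c₀)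
    (hψ : MemA0 d a μ ψ) {p : ℝ × ℝ} (hp : p ∈ quadrant) : |ψ p - a| ≤ p.1 + p.2 := by
  have hdiff : ∀ q ∈ quadrant, DifferentiableAt ℝ ψ q := fun q hq =>
    (hb.profileBounds hψ).differentiableAt hq
  have hμ := hb.μ_pos
  have hd := hb.three_le_real
  have hgrad : ∀ q ∈ quadrant, gradNorm ψ q ≤ 1 := fun q hq => by
    have h1 : bracket q ^ (-1 + 1 / (d * μ)) ≤ 1 :=
      Real.rpow_le_one_of_one_le_of_nonpos (one_le_bracket q) (by
        linarith [hb.exp_z, hb.c₀_pos])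
    have h2 : bracketOne q.2 ^ (-(1 / (d * μ))) ≤ 1 :=
      Real.rpow_le_one_of_one_le_of_nonpos (one_le_bracketOne _)
        (neg_nonpos.2 (by positivity))
    have h3 := Real.rpow_nonneg (bracket_pos q).le (-1 + 1 / (d * μ))
    have h4 := Real.rpow_nonneg (bracketOne_pos q.2).le (-(1 / (d * μ)))
    have h5 := hψ.pos q (quadrant_subset_closedQuadrant hq)
    have h6 := hψ.le_aOne q (quadrant_subset_closedQuadrant hq)
    have h7 := hb.aOne_le
    have h8 := mul_le_one₀ h1 h4 h2
    have h9 := mul_nonneg h3 h4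
    refine (hψ.grad_le q hq).trans ?_
    nlinarith
  have hmem : ∀ t ∈ Ioo (0 : ℝ) 1, (t * p.1, t * p.2) ∈ quadrant := fun t ht =>
    ⟨mul_pos ht.1 hp.1, mul_pos ht.1 hp.2⟩
  have hd' : ∀ t ∈ Ioo (0 : ℝ) 1, HasDerivAt (fun t => ψ (t * p.1, t * p.2))
      (dr ψ (t * p.1, t * p.2) * p.1 + dz ψ (t * p.1, t * p.2) * p.2) t := fun t ht => by
    refine hasDerivAt_comp_curve (hdiff _ (hmem t ht)) ?_ ?_
    · simpa using (hasDerivAt_id t).mul_const p.1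
    · simpa using (hasDerivAt_id t).mul_const p.2
  have hcont : ContinuousOn (fun t : ℝ => ψ (t * p.1, t * p.2)) (Icc 0 1) :=
    hψ.continuousOn.comp (by fun_prop) fun t ht =>
      ⟨mul_nonneg ht.1 hp.1.le, mul_nonneg ht.1 hp.2.le⟩
  obtain ⟨t, ht, he⟩ := exists_hasDerivAt_eq_slope _ _ zero_lt_one hcont hd'
  simp only [one_mul, zero_mul, sub_zero, div_one, hψ.origin, Prod.mk.eta] at he
  rw [← he]
  have h1 := (abs_dr_le_gradNorm ψ _).trans (hgrad _ (hmem t ht))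
  have h2 := (abs_dz_le_gradNorm ψ _).trans (hgrad _ (hmem t ht))
  refine (abs_add_le _ _).trans (add_le_add ?_ ?_)
  · rw [abs_mul, abs_of_pos hp.1]; exact mul_le_of_le_one_left hp.1.le h1
  · rw [abs_mul, abs_of_pos hp.2]; exact mul_le_of_le_one_left hp.2.le h2

/-- After clearing denominators the difference is (dμ + 1)(μ - (d - 1) b). The inequality lets (sin
σ)^γ beat the singularity of the data on Γ₀ without any help from Θ, so λ does not enter. -/
lemma ParameterBounds.le_gammaExp {d : ℕ} {a μ δ c₀ b : ℝ} (hb : ParameterBounds d a μ δ c₀)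
    (h0 : 0 < b) (h1 : b ≤ aOne d a) : ((d : ℝ) - 1) / (d * μ) ≤ gammaExp d μ b := by
  have hd := hb.three_le_real
  have hμ := hb.μ_pos
  have h2 : 0 ≤ μ - ((d : ℝ) - 1) * b := by
    have h3 := mul_le_mul_of_nonneg_left h1 (by linarith : (0 : ℝ) ≤ (d : ℝ) - 1)
    linarith [hb.δ_le, hb.δ_pos]
  rw [gammaExp, div_le_div_iff₀ (by positivity) (by positivity)]
  nlinarith [mul_nonneg (by positivity : (0 : ℝ) ≤ d * μ + 1) h2]

lemma ParameterBounds.one_div_le {d : ℕ} {a μ δ c₀ : ℝ} (hb : ParameterBounds d a μ δ c₀) :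
    1 / (d * μ) ≤ 1 := by linarith [hb.exp_z, hb.c₀_pos]

/-- The data of a solution along a single characteristic: `y` is the characteristic and `ℓ` the
logarithm of the solution on it. -/
structure IsProfileAlong (d : ℕ) (μ lam : ℝ) (Θ η : ℝ → ℝ) (ψ : ℝ × ℝ → ℝ) (y ℓ : ℝ → ℝ) :
    Prop where
  trajectory : IsTrajectory (fField d μ ψ) y
  hasDerivAt : ∀ t, HasDerivAt ℓ (-qField d μ ψ (t, y t)) t
  initial : ℓ 0 = logInitial d μ lam Θ η (y 0)

lemma logG_zero {d : ℕ} {μ δ c₀ C : ℝ} {ψ : ℝ × ℝ → ℝ} (hB : ProfileBounds d μ ψ δ c₀ C) (ξ : ℝ) :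
    logG d μ ψ (toQuad μ ψ (0, ξ)) = -(((d : ℝ) - 1) / (d * μ)) * Real.log (Real.sin (angle ξ)) -
      1 / (d * μ) * Real.log (Real.cos (angle ξ)) := by
  rw [logG, hB.w_toQuad, ProfileBounds.toQuad_fst]
  simp only [Real.exp_zero, one_mul]

namespace ProfileBounds

variable {d : ℕ} {μ δ c₀ C : ℝ} {ψ : ℝ × ℝ → ℝ} {p : ℝ × ℝ} {y ℓ Θ η : ℝ → ℝ} {lam : ℝ}

lemma varConst_nonneg (hB : ProfileBounds d μ ψ δ c₀ C) : 0 ≤ varConst δ c₀ C := by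
  have h1 := hB.δ_pos
  have h2 := hB.c₀_pos
  have h3 := hB.C_pos
  have h4 := Real.pi_pos
  unfold varConst
  positivity

lemma abs_log_w_sub_le (hB : ProfileBounds d μ ψ δ c₀ C) (hp : p ∈ quadrant) :
    |Real.log (wFun μ ψ p) - Real.log p.2| ≤ Real.log (2 / δ) := by
  have hδ := hB.δ_pos
  have hk := hB.k_pos hp
  rw [wFun, Real.log_mul hk.ne' hp.2.ne', add_sub_cancel_right, Real.log_div two_ne_zero hδ.ne',
    abs_le]
  have h1 := Real.log_le_log hk (hB.k_le hp)
  have h2 := Real.log_le_log hδ (hB.δ_le_k hp)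
  have h3 := Real.log_nonpos hδ.le hB.δ_le_one
  have h4 := Real.log_nonneg (one_le_two (α := ℝ))
  constructor <;> linarith

lemma abs_fst_sub_log_radius_le (hB : ProfileBounds d μ ψ δ c₀ C) (hp : p ∈ quadrant) :
    |(ofQuad μ ψ p).1 - Real.log (radius p)| ≤ Real.log (2 / δ) := by
  have hδ := hB.δ_pos
  have hr := hp.1
  have hz := hp.2
  have hn : 0 < p.1 ^ 2 + p.2 ^ 2 := by positivity
  have h0 : Real.log (radius p) = Real.log (p.1 ^ 2 + p.2 ^ 2) / 2 := by
    rw [radius, Real.log_sqrt hn.le]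
  have hk := hB.k_le hp
  have hk' := hB.δ_le_k hp
  have hk0 := hB.k_pos hp
  have hδ1 := hB.δ_le_one
  have e : wFun μ ψ p ^ 2 = (μ + ψ p) ^ 2 * p.2 ^ 2 := by rw [wFun, mul_pow]
  have k1 : (μ + ψ p) ^ 2 ≤ 2 ^ 2 := by gcongr
  have k2 : δ ^ 2 ≤ (μ + ψ p) ^ 2 := by gcongr
  have k3 : δ ^ 2 ≤ 1 := pow_le_one₀ hδ.le hδ1
  have h1 : δ ^ 2 * (p.1 ^ 2 + p.2 ^ 2) ≤ p.1 ^ 2 + wFun μ ψ p ^ 2 := by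
    rw [e]; nlinarith [sq_nonneg p.1, sq_nonneg p.2]
  have h2 : p.1 ^ 2 + wFun μ ψ p ^ 2 ≤ 2 ^ 2 * (p.1 ^ 2 + p.2 ^ 2) := by
    rw [e]; nlinarith [sq_nonneg p.1, sq_nonneg p.2]
  have l1 := Real.log_le_log (by positivity) h1
  have l2 := Real.log_le_log (by positivity) h2
  rw [Real.log_mul (by positivity) hn.ne', Real.log_pow] at l1 l2
  have h3 := Real.log_nonpos hδ.le hB.δ_le_one
  have h4 := Real.log_nonneg (one_le_two (α := ℝ))
  rw [h0, ofQuad, Real.log_div two_ne_zero hδ.ne', abs_le]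
  push_cast at l1 l2
  constructor <;> linarith

/-- Along a characteristic, `log Ω - logG` stays close to its initial value. -/
lemma abs_sub_logG_initial_le (hB : ProfileBounds d μ ψ δ c₀ C)
    (h : IsProfileAlong d μ lam Θ η ψ y ℓ)
    (hη : IsEta d η) (hΘ : IsTheta d μ Θ) (hlam : 0 < lam) (t : ℝ) :
    |ℓ t - logG d μ ψ (toQuad μ ψ (t, y t)) - (Real.log (Θ (lam * angle (y 0))) +
      Real.log (chi d μ η (angle (y 0))))| ≤ varConst δ c₀ C := by
  have h1 := hB.abs_sub_logG_le h.trajectory h.hasDerivAt 0 t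
  rw [h.initial, logInitial_eq hη hΘ hB.μ_pos hlam, logG_zero hB] at h1
  convert h1 using 2
  ring

lemma le_logG (hB : ProfileBounds d μ ψ δ c₀ C) (h : IsProfileAlong d μ lam Θ η ψ y ℓ)
    (hη : IsEta d η) (hΘ : IsTheta d μ Θ) (hlam : 0 < lam) (t : ℝ) :
    ℓ t ≤ logG d μ ψ (toQuad μ ψ (t, y t)) + varConst δ c₀ C := by
  have h1 := (abs_le.1 (hB.abs_sub_logG_initial_le h hη hΘ hlam t)).2
  have hσ := angle_mem (y 0)
  have hls := mul_pos hlam hσ.1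
  have h2 := Real.log_nonpos (hΘ.pos _ hls).le (hΘ.le_one _ hls)
  have h3 := Real.log_nonpos (chi_pos hη hB.μ_pos hσ).le (chi_mem hη hB.μ_pos hσ).2
  linarith

/-- The bound by `z r^{-γ}`, where `γ` is the exponent belonging to `b`, with a loss `E`. -/
lemma le_gamma_profile (hB : ProfileBounds d μ ψ δ c₀ C) (h : IsProfileAlong d μ lam Θ η ψ y ℓ)
    (hη : IsEta d η) (hΘ : IsTheta d μ Θ) (hlam : 0 < lam) (hdμ : 1 / (d * μ) ≤ 1) {b E : ℝ}
    (hγ : ((d : ℝ) - 1) / (d * μ) ≤ gammaExp d μ b) {t : ℝ}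
    (hE : logG d μ ψ (toQuad μ ψ (t, y t)) - (Real.log (wFun μ ψ (toQuad μ ψ (t, y t))) -
        gammaExp d μ b * Real.log (toQuad μ ψ (t, y t)).1) ≤
      logG d μ ψ (toQuad μ ψ (0, y 0)) - (Real.log (wFun μ ψ (toQuad μ ψ (0, y 0))) -
        gammaExp d μ b * Real.log (toQuad μ ψ (0, y 0)).1) + E) :
    ℓ t ≤ Real.log (toQuad μ ψ (t, y t)).2 - gammaExp d μ b * Real.log (toQuad μ ψ (t, y t)).1 +
      (Real.log (2 / δ) + varConst δ c₀ C + 2 * Real.log (3 * d) + E) := by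
  have h1 := (abs_le.1 (hB.abs_sub_logG_initial_le h hη hΘ hlam t)).2
  have hσ := angle_mem (y 0)
  have hls := mul_pos hlam hσ.1
  have h2 := Real.log_nonpos (hΘ.pos _ hls).le (hΘ.le_one _ hls)
  have h3 := log_chi_le hη (by have := hB.three_le; omega) hB.μ_pos hσ
  have h4 := (abs_le.1 (hB.abs_log_w_sub_le (hB.toQuad_mem (t, y t)))).2
  rw [logG_zero hB, hB.w_toQuad (0, y 0), toQuad_fst (0, y 0)] at hE
  simp only [Real.exp_zero, one_mul] at hE
  have h5 := Real.log_nonpos (sin_angle_pos (y 0)).le (Real.sin_le_one _)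
  have h6 : 0 ≤ Real.log (3 * d) := Real.log_nonneg (by linarith [hB.three_le_real])
  have h7 := mul_nonneg (sub_nonneg.2 hγ) (neg_nonneg.2 h5)
  have h8 := mul_le_mul_of_nonneg_right hdμ h6
  nlinarith

/-- The decay bound away from the origin. -/
lemma le_decay_profile (hB : ProfileBounds d μ ψ δ c₀ C) (h : IsProfileAlong d μ lam Θ η ψ y ℓ)
    (hη : IsEta d η) (hΘ : IsTheta d μ Θ) (hlam : 0 < lam) (hdμ : 1 / (d * μ) ≤ 1)
    {κ M : ℝ} (hκ : 0 < κ) (hM : 0 ≤ M) (hdec : ∀ p ∈ quadrant, ψ p ≤ M * bracket p ^ (-κ)) {t : ℝ}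
    (ht : 1 ≤ radius (toQuad μ ψ (t, y t))) :
    ℓ t ≤ Real.log (toQuad μ ψ (t, y t)).2 -
      (1 / μ + 1) * Real.log (radius (toQuad μ ψ (t, y t))) +
      ((1 / μ + 2) * Real.log (2 / δ) + varConst δ c₀ C + 2 * Real.log (3 * d) +
        |((d : ℝ) - 1) / (d * μ) * Real.log (5 * Real.pi * lam)| +
        (d + (1 / δ + 1) * (1 + d)) / δ * M * 2 ^ κ / κ * Real.exp (κ * Real.log (2 / δ))) := by
  have hδ := hB.δ_pos
  have hμ := hB.μ_pos
  have hd := hB.three_le_real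
  have h1 := (abs_le.1 (hB.abs_sub_logG_initial_le h hη hΘ hlam t)).2
  have hσ := angle_mem (y 0)
  have h2 := log_theta_le hΘ (by have := hB.three_le; omega) hμ hlam hσ
  have h3 := log_chi_le hη (by have := hB.three_le; omega) hB.μ_pos hσ
  have hP := hB.toQuad_mem (t, y t)
  have h4 := (abs_le.1 (hB.abs_log_w_sub_le hP)).2
  have h5 := hB.abs_fst_sub_log_radius_le hP
  rw [hB.ofQuad_toQuad] at h5
  have h5' := (abs_le.1 h5).1
  have h6 : 0 ≤ Real.log (3 * d) := Real.log_nonneg (by linarith)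
  have h7 : 0 ≤ Real.log (radius (toQuad μ ψ (t, y t))) := Real.log_nonneg ht
  have h8 := mul_le_mul_of_nonneg_right hdμ h6
  have hΛ : 0 ≤ Real.log (2 / δ) := (abs_nonneg _).trans h5
  set D := (d + (1 / δ + 1) * (1 + d)) / δ * M * 2 ^ κ / κ with hD
  have hc0 : 0 ≤ (d + (1 / δ + 1) * (1 + d)) / δ := by positivity
  have hD0 : 0 ≤ D := by positivity
  -- A point with |(r, z)| ≥ 1 has τ ≥ -log (2/δ), so whether τ is positive or negative the segment
  -- joining it to Γ₀ lies in this half-line, where ψ is integrable in τ.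
  have hvar : ∀ {s u : ℝ}, s ≤ u → -Real.log (2 / δ) ≤ s → _ := fun {s u} hsu hs =>
    (hB.abs_sub_le_of_decay hκ hM hc0 hdec (hB.hasDerivAt_decay_profile h.trajectory)
      (fun t => hB.abs_decay_profile_deriv_le (t, y t)) hsu).trans
      (mul_le_mul_of_nonneg_left (Real.exp_le_exp.2
        (by nlinarith : -κ * s ≤ κ * Real.log (2 / δ))) hD0)
  have h9 : logG d μ ψ (toQuad μ ψ (t, y t)) - (Real.log (wFun μ ψ (toQuad μ ψ (t, y t))) -
      (1 / μ + 1) * t) ≤ logG d μ ψ (toQuad μ ψ (0, y 0)) -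
      (Real.log (wFun μ ψ (toQuad μ ψ (0, y 0))) - (1 / μ + 1) * 0) +
        D * Real.exp (κ * Real.log (2 / δ)) := by
    rcases le_total 0 t with h0 | h0
    · have := (abs_le.1 (hvar h0 (by linarith))).2
      linarith
    · have := (abs_le.1 (hvar h0 (by linarith))).1
      linarith
  rw [logG_zero hB, hB.w_toQuad (0, y 0)] at h9
  simp only [Real.exp_zero, one_mul] at h9
  have h10 := le_abs_self (((d : ℝ) - 1) / (d * μ) * Real.log (5 * Real.pi * lam))
  have h11 : -(1 / μ + 1) * t ≤ (1 / μ + 1) * (Real.log (2 / δ) -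
      Real.log (radius (toQuad μ ψ (t, y t)))) := by
    have : 0 < 1 / μ + 1 := by positivity
    simp only at h5'
    nlinarith
  simp only at h5'
  nlinarith

end ProfileBounds

/-! ### The solution of the transport problem -/

/-- The parametrization of the initial curve. -/
def initialHeight (μ : ℝ) (ψ : ℝ × ℝ → ℝ) (r : ℝ) : ℝ := zInv μ ψ (r, √(1 - r ^ 2))

/-- The dilation factor in the initial data. -/
def dilation (d : ℕ) (δ μ M : ℝ) : ℝ :=
  4 * Real.exp |d / δ * M * 2 ^ (1 / μ - ((d : ℝ) - 2)) / (1 / μ - ((d : ℝ) - 2))|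

lemma one_lt_dilation (d : ℕ) (δ μ M : ℝ) : 1 < dilation d δ μ M := by
  have := Real.one_le_exp
    (abs_nonneg (d / δ * M * 2 ^ (1 / μ - ((d : ℝ) - 2)) / (1 / μ - ((d : ℝ) - 2))))
  rw [dilation]; linarith

/-- From sin σ ≤ σ and sin σ = e^θ cos σ with cos σ ≥ 1/2 at the smallest allowed θ, one gets σ ≥
e^{-Q} / 4; hence the factor 4 in `dilation`. -/
lemma one_le_dilation_mul_angle {Q θ : ℝ} (hQ : 0 ≤ Q) (hθ : -Real.log 2 - Q ≤ θ) :
    1 ≤ 4 * Real.exp Q * angle θ := by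
  have h1 : angle (-Real.log 2 - Q) ≤ angle θ :=
    Real.arctan_strictMono.monotone (Real.exp_le_exp.2 hθ)
  have h2 := Real.sin_le (angle_mem (-Real.log 2 - Q)).1.le
  have h3 : Real.exp (-Real.log 2 - Q) = 1 / (2 * Real.exp Q) := by
    rw [Real.exp_sub, Real.exp_neg, Real.exp_log two_pos]; field_simp
  have hE := Real.one_le_exp hQ
  have h4 : 1 / 2 ≤ Real.cos (angle (-Real.log 2 - Q)) := by
    rw [angle, Real.cos_arctan]
    refine one_div_le_one_div_of_le (Real.sqrt_pos.2 (by positivity)) ?_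
    refine Real.sqrt_le_iff.2 ⟨by norm_num, ?_⟩
    have : Real.exp (-Real.log 2 - Q) ≤ 1 :=
      Real.exp_le_one_iff.2 (by linarith [Real.log_nonneg (one_le_two (α := ℝ))])
    nlinarith [Real.exp_pos (-Real.log 2 - Q)]
  rw [sin_angle, h3] at h2
  have h5 : 1 / (2 * Real.exp Q) * (1 / 2) ≤ angle θ :=
    (mul_le_mul_of_nonneg_left h4 (by positivity)).trans (h2.trans h1)
  calc (1 : ℝ) = 4 * Real.exp Q * (1 / (2 * Real.exp Q) * (1 / 2)) := by field_simp; norm_num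
    _ ≤ _ := by gcongr

namespace ProfileBounds

variable {d : ℕ} {μ δ c₀ C : ℝ} {ψ : ℝ × ℝ → ℝ} {p : ℝ × ℝ} {y ℓ Θ η : ℝ → ℝ} {lam : ℝ}

lemma sqrt_mem {r : ℝ} (hr : r ∈ Ioo (0 : ℝ) 1) : (r, √(1 - r ^ 2)) ∈ quadrant :=
  ⟨hr.1, Real.sqrt_pos.2 (by nlinarith [hr.1, hr.2])⟩

lemma contDiffOn_initialHeight (hB : ProfileBounds d μ ψ δ c₀ C) :
    ContDiffOn ℝ 1 (initialHeight μ ψ) (Ioo 0 1) := by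
  have h1 : ContDiffOn ℝ 2 (fun r : ℝ => (r, √(1 - r ^ 2))) (Ioo 0 1) := by
    refine contDiffOn_id.prodMk (ContDiffOn.sqrt (by fun_prop) fun r hr => ?_)
    exact (Real.sqrt_pos.1 (sqrt_mem hr).2).ne'
  exact (hB.contDiffOn_zInv.comp h1 fun r hr => sqrt_mem hr).of_le (by norm_num)

/-- For 0 < r < 1 the equation says w = √(1 - r²), and w is strictly increasing in z, so each such r
carries exactly one point. -/
lemma initialCurve_eq (hB : ProfileBounds d μ ψ δ c₀ C) :
    initialCurve μ ψ = {p | p.1 ∈ Ioo 0 1 ∧ p.2 = initialHeight μ ψ p.1} := by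
  ext p
  constructor
  · rintro ⟨h, hr, hz⟩
    have hw := hB.w_pos (p := p) ⟨hr, hz⟩
    rw [← mul_pow, ← wFun.eq_1] at h
    have hw2 : wFun μ ψ p = √(1 - p.1 ^ 2) := by
      rw [← h, add_sub_cancel_left, Real.sqrt_sq hw.le]
    refine ⟨⟨hr, by nlinarith⟩, ?_⟩
    rw [initialHeight, ← hw2]
    exact (hB.zInv_unique hr hz).symm
  · rintro ⟨hr, hz⟩
    have h := hB.zInv_spec (sqrt_mem hr)
    have hp : (p.1, zInv μ ψ (p.1, √(1 - p.1 ^ 2))) = p := Prod.ext rfl hz.symm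
    simp only [hp] at h
    refine ⟨?_, hr.1, by rw [hz]; exact h.1⟩
    rw [← mul_pow, ← wFun.eq_1, h.2, Real.sq_sqrt (Real.sqrt_pos.1 (sqrt_mem hr).2).le]
    ring

lemma toQuad_zero (θ : ℝ) : toQuad μ ψ (0, θ) =
    (Real.sin (angle θ), initialHeight μ ψ (Real.sin (angle θ))) := by
  have : √(1 - Real.sin (angle θ) ^ 2) = Real.cos (angle θ) := by
    rw [← Real.cos_sq', Real.sqrt_sq (cos_angle_pos θ).le]
  simp only [toQuad, initialHeight, Real.exp_zero, one_mul, this]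

/-- Existence and uniqueness for the transport problem, with the solution given along
characteristics. -/
lemma exists_solution (hB : ProfileBounds d μ ψ δ c₀ C) (hη : IsEta d η) (hΘ : IsTheta d μ Θ)
    (hlam : 0 < lam) {N₀ : ℝ} (hN : ∀ θ, |deriv (logInitial d μ lam Θ η) θ| ≤ N₀) :
    ∃ L : ℝ × ℝ → ℝ, ContDiff ℝ 1 L ∧
      IsTransportSolution d μ lam Θ η ψ (initialHeight μ ψ) (fun p => Real.exp (L (ofQuad μ ψ p))) ∧
      (∀ Ω', IsTransportSolution d μ lam Θ η ψ (initialHeight μ ψ) Ω' →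
        EqOn Ω' (fun p => Real.exp (L (ofQuad μ ψ p))) quadrant) ∧
      (∀ t θ, ∃ y, y t = θ ∧ IsProfileAlong d μ lam Θ η ψ y fun s => L (s, y s)) ∧
      (∀ x, |dz L x| ≤ (1 + N₀) * Real.exp (3 * rateConst d δ C * (Real.pi / c₀))) ∧
      (∀ x, dr L x + fField d μ ψ x * dz L x = -qField d μ ψ x) := by
  have hF := hB.isTameField
  obtain ⟨L, hL, hL0, hLt, hLz⟩ := hF.exists_transport hB.contDiff_qField hB.abs_dz_qField_le
    (contDiff_logInitial hη hΘ hB.μ_pos hlam)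
  have hLd : Differentiable ℝ L := hL.differentiable one_ne_zero
  have halong : ∀ t θ, ∃ ξ, hF.flow ξ t = θ ∧
      IsProfileAlong d μ lam Θ η ψ (hF.flow ξ) fun s => L (s, hF.flow ξ s) := by
    intro t θ
    obtain ⟨ξ, hξ⟩ := hF.exists_flow_eq t θ
    refine ⟨ξ, hξ, hF.flow_trajectory ξ, fun s => ?_, hL0 _⟩
    refine (hasDerivAt_comp_curve (f := L) (hLd _) (hasDerivAt_id s)
      (hF.flow_trajectory ξ s)).congr_deriv ?_
    rw [← hLt]
    simp only [id]
    ring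
  have hsol : IsTransportSolution d μ lam Θ η ψ (initialHeight μ ψ)
      (fun p => Real.exp (L (ofQuad μ ψ p))) := by
    have hcomp : ContDiffOn ℝ 1 (fun p => L (ofQuad μ ψ p)) quadrant :=
      hL.comp_contDiffOn (hB.contDiffOn_ofQuad.of_le (by norm_num))
    refine ⟨hcomp.exp, fun p hp => ?_, fun σ hσ => ?_⟩
    · have hd := (hcomp.differentiableOn one_ne_zero).differentiableAt (isOpen_quadrant.mem_nhds hp)
      have e1 : dr (fun p => Real.exp (L (ofQuad μ ψ p))) p =
          Real.exp (L (ofQuad μ ψ p)) * dr (fun p => L (ofQuad μ ψ p)) p :=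
        (hasDerivAt_dr hd).exp.deriv
      have e2 : dz (fun p => Real.exp (L (ofQuad μ ψ p))) p =
          Real.exp (L (ofQuad μ ψ p)) * dz (fun p => L (ofQuad μ ψ p)) p :=
        (hasDerivAt_dz hd).exp.deriv
      have h := hB.transport_comp_ofQuad hp hLd (hLt _)
      rw [e1, e2]
      linear_combination Real.exp (L (ofQuad μ ψ p)) * h
    · have h1 := angle_log_tan hσ
      have h2 := toQuad_zero (μ := μ) (ψ := ψ) (Real.log (Real.tan σ))
      rw [h1] at h2
      rw [← h2, hB.ofQuad_toQuad, hL0, logInitial, h1,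
        Real.exp_log (initialValue_pos hη hΘ hB.μ_pos hlam hσ)]
  refine ⟨L, hL, hsol, fun Ω' hΩ' p hp => ?_, fun t θ => ?_, fun x => ?_, hLt⟩
  · obtain ⟨ξ, hξ, hpr⟩ := halong (ofQuad μ ψ p).1 (ofQuad μ ψ p).2
    set y := hF.flow ξ
    have h1 := fun t => hB.hasDerivAt_along hpr.trajectory
      (hΩ'.contDiffOn.differentiableOn one_ne_zero) hΩ'.transport t
    -- The quotient Ω' e^{-L} is constant along the characteristic, so it equals its value 1 on Γ₀;
    -- no sign of Ω' is needed.
    have h2 : ∀ t, HasDerivAt (fun t => Ω' (toQuad μ ψ (t, y t)) * Real.exp (-L (t, y t))) 0 t :=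
      fun t => ((h1 t).mul (hpr.hasDerivAt t).neg.exp).congr_deriv (by
        simp only [Pi.neg_apply]; ring)
    have h3 := is_const_of_deriv_eq_zero (fun t => (h2 t).differentiableAt)
      (fun t => (h2 t).deriv) (ofQuad μ ψ p).1 0
    simp only [hξ, Prod.mk.eta, hB.toQuad_ofQuad hp, hL0] at h3
    have h4 := hΩ'.initial _ (angle_mem (y 0))
    rw [toQuad_zero, h4, logInitial, Real.exp_neg _,
      Real.exp_neg (Real.log _), Real.exp_log (initialValue_pos hη hΘ hB.μ_pos hlam (angle_mem _)),
      mul_inv_cancel₀ (initialValue_pos hη hΘ hB.μ_pos hlam (angle_mem _)).ne',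
      mul_inv_eq_one₀ (Real.exp_pos _).ne'] at h3
    exact h3
  · obtain ⟨ξ, h⟩ := halong t θ
    exact ⟨_, h⟩
  · obtain ⟨ξ, hξ⟩ := hF.exists_flow_eq x.1 x.2
    have h := hB.abs_le_of_transport (hF.flow_trajectory ξ) (hLz ξ) x.1
    rw [hξ, hF.flow_zero] at h
    refine h.trans (mul_le_mul_of_nonneg_right ?_ (Real.exp_pos _).le)
    have e : dz L (0, ξ) = deriv (logInitial d μ lam Θ η) ξ := by
      have : (fun t => L ((0 : ℝ), t)) = logInitial d μ lam Θ η := funext hL0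
      rw [dz, this]
    rw [e]
    linarith [hN ξ]

/-- The logarithmic derivatives of the solution. -/
lemma logDeriv_le (hB : ProfileBounds d μ ψ δ c₀ C) {L : ℝ × ℝ → ℝ} (hL : ContDiff ℝ 1 L) {N : ℝ}
    (hN : ∀ x, |dz L x| ≤ N) (hLt : ∀ x, dr L x + fField d μ ψ x * dz L x = -qField d μ ψ x)
    (hp : p ∈ quadrant) :
    |p.1 * dr (fun p => Real.exp (L (ofQuad μ ψ p))) p| +
      |p.2 * dz (fun p => Real.exp (L (ofQuad μ ψ p))) p| ≤
        4 * (2 / δ ^ 2 + (d / δ + 1) * N) * Real.exp (L (ofQuad μ ψ p)) := by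
  have hLd : Differentiable ℝ L := hL.differentiable one_ne_zero
  have hcomp : ContDiffOn ℝ 1 (fun p => L (ofQuad μ ψ p)) quadrant :=
    hL.comp_contDiffOn (hB.contDiffOn_ofQuad.of_le (by norm_num))
  have hd := (hcomp.differentiableOn one_ne_zero).differentiableAt (isOpen_quadrant.mem_nhds hp)
  have e1 : p.1 * dr (fun p => Real.exp (L (ofQuad μ ψ p))) p =
      Real.exp (L (ofQuad μ ψ p)) * (p.1 * dr (fun p => L (ofQuad μ ψ p)) p) := by
    rw [mul_left_comm]; congr 1; exact (hasDerivAt_dr hd).exp.deriv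
  have e2 : p.2 * dz (fun p => Real.exp (L (ofQuad μ ψ p))) p =
      Real.exp (L (ofQuad μ ψ p)) * (p.2 * dz (fun p => L (ofQuad μ ψ p)) p) := by
    rw [mul_left_comm]; congr 1; exact (hasDerivAt_dz hd).exp.deriv
  rw [e1, e2, abs_mul (Real.exp _), abs_mul (Real.exp _), Real.abs_exp, ← mul_add, mul_comm]
  refine mul_le_mul_of_nonneg_right ?_ (Real.exp_pos _).le
  rw [hB.mul_dr_comp_ofQuad hp hLd, hB.mul_dz_comp_ofQuad hp hLd]
  set x := ofQuad μ ψ p with hx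
  have hδ := hB.δ_pos
  have hP := hB.toQuad_mem x
  have hψ := hB.pos p hp
  have hk := hB.k_pos hp
  have hX : |p.1 * dr ψ p / (μ + ψ p)| ≤ 1 := by
    rw [abs_div, abs_of_pos hk, div_le_one hk]
    linarith [hB.abs_dr_le p hp, hB.μ_pos]
  have hA : |aFun μ ψ p / (μ + ψ p)| ≤ 2 := by
    rw [abs_of_pos (div_pos (hB.a_pos hp) hk), div_le_iff₀ hk, aFun]
    linarith [(abs_le.1 (hB.abs_dz_le p hp)).2, hB.μ_pos]
  obtain ⟨es, ec⟩ := hB.ofQuad_snd_eq_angle hp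
  have hs : |sinSq μ ψ p| ≤ 1 := by
    rw [← es, abs_of_nonneg (sq_nonneg _)]; exact Real.sin_sq_le_one _
  have hc : |cosSq μ ψ p| ≤ 1 := by
    rw [← ec, abs_of_nonneg (sq_nonneg _)]; exact Real.cos_sq_le_one _
  have hsc : |sinSq μ ψ p + cosSq μ ψ p * (p.1 * dr ψ p / (μ + ψ p))| ≤ 2 := by
    refine (abs_add_le _ _).trans ?_
    rw [abs_mul]
    have := mul_le_one₀ hc (abs_nonneg _) hX
    linarith
  have hX1 : |1 - p.1 * dr ψ p / (μ + ψ p)| ≤ 2 := by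
    refine (abs_sub _ _).trans ?_
    rw [abs_one]; linarith
  have hF0 := hB.fField_pos x
  have hF : fField d μ ψ x ≤ d / δ := by
    refine (hB.fField_le x).trans (mul_le_of_le_one_right ?_ ?_)
    · have := hB.three_le_real; positivity
    · linarith [hB.le_half _ hP]
  have hq : |qField d μ ψ x| ≤ 2 / δ ^ 2 := by
    have hA0 := hB.a_pos hP
    have hD0 := hB.dn_pos x
    have hk0 := hB.k_pos hP
    rw [qField, abs_of_pos (by positivity)]
    have h1 := hB.δ_le_a hP
    have h2 := hB.δ_le_dn x
    rw [sq]
    gcongr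
    exact hB.k_le hP
  have hN0 : 0 ≤ N := (abs_nonneg _).trans (hN x)
  -- The derivative in τ is recovered from the equation, ∂_τ L = -q - F ∂_θ L.
  have hdr : |dr L x| ≤ 2 / δ ^ 2 + d / δ * N := by
    have : dr L x = -qField d μ ψ x - fField d μ ψ x * dz L x := by linarith [hLt x]
    rw [this]
    refine (abs_sub _ _).trans ?_
    rw [abs_neg, abs_mul, abs_of_pos hF0]
    gcongr
    exact hN x
  have hdz := hN x
  have t1 : |dr L x * (sinSq μ ψ p + cosSq μ ψ p * (p.1 * dr ψ p / (μ + ψ p))) +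
      dz L x * (1 - p.1 * dr ψ p / (μ + ψ p))| ≤ |dr L x| * 2 + |dz L x| * 2 := by
    refine (abs_add_le _ _).trans ?_
    rw [abs_mul, abs_mul]
    gcongr
  have t2 : |(dr L x * cosSq μ ψ p - dz L x) * (aFun μ ψ p / (μ + ψ p))| ≤
      (|dr L x| + |dz L x|) * 2 := by
    rw [abs_mul]
    refine mul_le_mul ((abs_sub _ _).trans ?_) hA (abs_nonneg _) (by positivity)
    rw [abs_mul]
    gcongr
    exact mul_le_of_le_one_right (abs_nonneg _) hc
  linarith

end ProfileBounds

/-! ### Membership in `ℬ` and decay -/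

/-- The constant in the pointwise bounds, as a function of the bound `N` for `∂_θ L`. -/
def profileConst (d : ℕ) (δ c₀ C N : ℝ) : ℝ :=
  2 + Real.exp (Real.log (2 / δ) + varConst δ c₀ C + 2 * Real.log (3 * d) + 2 * (1 + d) / δ ^ 3) +
    4 * (2 / δ ^ 2 + (d / δ + 1) * N)

/-- The constant in the decay bound. -/
def decayConst (d : ℕ) (δ c₀ C lam μ M : ℝ) : ℝ :=
  1 + Real.exp ((1 / μ + 2) * Real.log (2 / δ) + varConst δ c₀ C + 2 * Real.log (3 * d) +
        |((d : ℝ) - 1) / (d * μ) * Real.log (5 * Real.pi * lam)| +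
        (d + (1 / δ + 1) * (1 + d)) / δ * M * 2 ^ (1 / μ - ((d : ℝ) - 2)) /
          (1 / μ - ((d : ℝ) - 2)) * Real.exp ((1 / μ - ((d : ℝ) - 2)) * Real.log (2 / δ)))

lemma one_lt_decayConst (d : ℕ) (δ c₀ C lam μ M : ℝ) : 1 < decayConst d δ c₀ C lam μ M := by
  rw [decayConst]
  exact lt_add_of_pos_right _ (Real.exp_pos _)

lemma exp_mul_rpow_mul_rpow {r z : ℝ} (hr : 0 < r) (hz : 0 < z) (e α β : ℝ) :
    Real.exp e * (r ^ α * z ^ β) = Real.exp (e + α * Real.log r + β * Real.log z) := by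
  rw [Real.rpow_def_of_pos hr, Real.rpow_def_of_pos hz, ← Real.exp_add, ← Real.exp_add]
  congr 1; ring

lemma exp_mul_mul_rpow {r z : ℝ} (hr : 0 < r) (hz : 0 < z) (e α : ℝ) :
    Real.exp e * (z * r ^ α) = Real.exp (e + Real.log z + α * Real.log r) := by
  rw [Real.rpow_def_of_pos hr, Real.exp_add, Real.exp_add, Real.exp_log hz, mul_assoc, mul_comm α]

section Bounds

variable {d : ℕ} {a μ δ c₀ C M lam N : ℝ} {ψ L : ℝ × ℝ → ℝ} {p : ℝ × ℝ} {Θ η : ℝ → ℝ}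

lemma exp_le_profileConst (hδ : 0 < δ) (hN : 0 ≤ N) :
    Real.exp (Real.log (2 / δ) + varConst δ c₀ C + 2 * Real.log (3 * d) + 2 * (1 + d) / δ ^ 3) ≤
      profileConst d δ c₀ C N := by
  have : 0 ≤ 4 * (2 / δ ^ 2 + (d / δ + 1) * N) := by positivity
  rw [profileConst]; linarith

lemma le_exp_logG (hb : ParameterBounds d a μ δ c₀) (hB : ProfileBounds d μ ψ δ c₀ C)
    (hp : p ∈ quadrant) : |logG d μ ψ p - (-(((d : ℝ) - 1) / (d * μ)) * Real.log p.1 +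
      -(1 / (d * μ)) * Real.log p.2)| ≤ Real.log (2 / δ) := by
  have h := hB.abs_log_w_sub_le hp
  have h1 := hb.one_div_le
  have hμ := hb.μ_pos
  have h2 : (0 : ℝ) ≤ 1 / (d * μ) := by positivity
  have e : logG d μ ψ p - (-(((d : ℝ) - 1) / (d * μ)) * Real.log p.1 +
      -(1 / (d * μ)) * Real.log p.2) =
      -(1 / (d * μ) * (Real.log (wFun μ ψ p) - Real.log p.2)) := by
    rw [logG]; ring
  rw [e, abs_neg, abs_mul, abs_of_nonneg h2]
  exact (mul_le_of_le_one_left (abs_nonneg _) h1).trans h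

/-- The first term is the comparison with G. For the second, points outside Γ₀ (τ ≥ 0) use b = a₁
and points inside use b = a, so one of the two summands always suffices. -/
lemma exp_le_upper_profile (hb : ParameterBounds d a μ δ c₀) (hψ : MemA0 d a μ ψ)
    (hB : ProfileBounds d μ ψ δ c₀ C) (hη : IsEta d η) (hΘ : IsTheta d μ Θ) (hlam : 0 < lam)
    (hN : 0 ≤ N) (hp : p ∈ quadrant) {y : ℝ → ℝ} (hy : y (ofQuad μ ψ p).1 = (ofQuad μ ψ p).2)
    (h : IsProfileAlong d μ lam Θ η ψ y fun s => L (s, y s)) :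
    Real.exp (L (ofQuad μ ψ p)) ≤ profileConst d δ c₀ C N *
      min (p.1 ^ (-(((d : ℝ) - 1) / (d * μ))) * p.2 ^ (-(1 / (d * μ))))
        (p.2 * p.1 ^ (-gammaExp d μ a) + p.2 * p.1 ^ (-gammaExp d μ (aOne d a))) := by
  obtain ⟨hr, hz⟩ := id hp
  have hδ := hB.δ_pos
  have hC := exp_le_profileConst (d := d) (c₀ := c₀) (C := C) hδ hN
  have hV := hB.varConst_nonneg
  have hd := hB.three_le_real
  have h3 : 0 ≤ Real.log (3 * d) := Real.log_nonneg (by linarith)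
  have hE : 0 ≤ 2 * (1 + d) / δ ^ 3 := by positivity
  have ha1 : 0 < aOne d a := hb.a_pos.trans_le hb.a_le_aOne
  rw [mul_min_of_nonneg _ _ ((Real.exp_pos _).le.trans hC)]
  refine le_min ?_ ?_
  · refine le_trans ?_ (mul_le_mul_of_nonneg_right hC (by positivity))
    rw [exp_mul_rpow_mul_rpow hr hz, Real.exp_le_exp]
    have h1 := hB.le_logG h hη hΘ hlam (ofQuad μ ψ p).1
    simp only [hy, Prod.mk.eta, hB.toQuad_ofQuad hp] at h1
    have h2 := (abs_le.1 (le_exp_logG hb hB hp)).2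
    linarith
  · refine le_trans ?_ (mul_le_mul_of_nonneg_right hC (by positivity))
    rw [mul_add]
    rcases le_total 0 (ofQuad μ ψ p).1 with ht | ht
    · refine le_trans ?_ (le_add_of_nonneg_left (by positivity))
      have h1 := hB.le_gamma_profile h hη hΘ hlam hb.one_div_le
        (hb.le_gammaExp ha1 le_rfl) (E := 0) (t := (ofQuad μ ψ p).1) (by
          rw [add_zero]
          exact hB.logG_sub_forward h.trajectory ha1
            (fun q hq => hψ.le_aOne q (quadrant_subset_closedQuadrant hq)) ht)
      simp only [hy, Prod.mk.eta, hB.toQuad_ofQuad hp] at h1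
      rw [exp_mul_mul_rpow hr hz, Real.exp_le_exp]
      linarith
    · refine le_trans ?_ (le_add_of_nonneg_right (by positivity))
      have h1 := hB.le_gamma_profile h hη hΘ hlam hb.one_div_le
        (hb.le_gammaExp hb.a_pos hb.a_le_aOne)
        (hB.logG_sub_backward h.trajectory hb.a_pos (fun q hq => hψ.abs_sub_le hb hq) ht)
      simp only [hy, Prod.mk.eta, hB.toQuad_ofQuad hp] at h1
      rw [exp_mul_mul_rpow hr hz, Real.exp_le_exp]
      linarith

/-- The characteristic is followed back to Γ₀. Since θ increases with τ, the starting angle is small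
enough for η = 1; since its total increase is bounded through the decay of ψ, the angle is large
enough for Θ(λ₀σ) = 1. The data then equals G on Γ₀, and the two-sided comparison applies. -/
lemma lower_profile_le_exp (hb : ParameterBounds d a μ δ c₀) (hψ : MemA d a μ M ψ) (hM : 1 < M)
    (hB : ProfileBounds d μ ψ δ c₀ C) (hη : IsEta d η) (hΘ : IsTheta d μ Θ)
    (hN : 0 ≤ N) (h2 : 2 < p.2) (hzr : p.2 < p.1) (hrz : p.1 < 2 * p.2) {y : ℝ → ℝ}
    (hy : y (ofQuad μ ψ p).1 = (ofQuad μ ψ p).2)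
    (h : IsProfileAlong d μ (dilation d δ μ M) Θ η ψ y fun s => L (s, y s)) :
    1 / profileConst d δ c₀ C N *
      (p.1 ^ (-(((d : ℝ) - 1) / (d * μ))) * p.2 ^ (-(1 / (d * μ)))) ≤
        Real.exp (L (ofQuad μ ψ p)) := by
  have hz : 0 < p.2 := by linarith
  have hr : 0 < p.1 := by linarith
  have hp : p ∈ quadrant := ⟨hr, hz⟩
  have hδ := hB.δ_pos
  have hd := hB.three_le_real
  have hμ := hB.μ_pos
  have hw := hB.w_pos hp
  have hC := exp_le_profileConst (d := d) (c₀ := c₀) (C := C) hδ hN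
  have h3 : 0 ≤ Real.log (3 * d) := Real.log_nonneg (by linarith)
  have hE : 0 ≤ 2 * (1 + d) / δ ^ 3 := by positivity
  have hκ : 0 < 1 / μ - ((d : ℝ) - 2) := sub_pos.2 hb.exp_decay
  have ht : 0 ≤ (ofQuad μ ψ p).1 := by
    rw [ofQuad]
    refine div_nonneg (Real.log_nonneg ?_) two_pos.le
    nlinarith [sq_nonneg (wFun μ ψ p)]
  have hdec : ∀ q ∈ quadrant, ψ q ≤ M * bracket q ^ (-(1 / μ - ((d : ℝ) - 2))) := fun q hq => by
    rw [neg_sub]; exact hψ.upper q (quadrant_subset_closedQuadrant hq)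
  have hvar := hB.abs_sub_le_of_decay hκ (zero_le_one.trans hM.le)
    (by positivity : (0 : ℝ) ≤ d / δ) hdec h.trajectory
    (fun t => by rw [abs_of_pos (hB.fField_pos _)]; exact hB.fField_le (t, y t)) ht
  rw [mul_zero, Real.exp_zero, mul_one, hy] at hvar
  have hmono : y 0 ≤ (ofQuad μ ψ p).2 := by
    rw [← hy]
    exact monotone_of_hasDerivAt_nonneg h.trajectory (fun t => (hB.fField_pos _).le) ht
  -- w ≤ 2 z < 2 r in the sector.
  have hθ : -Real.log 2 ≤ (ofQuad μ ψ p).2 := by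
    rw [ofQuad, ← Real.log_div hr.ne' hw.ne', ← Real.log_inv]
    refine Real.log_le_log (by norm_num) ?_
    rw [le_div_iff₀ hw, wFun]
    nlinarith [hB.k_le hp]
  have hangle : 1 ≤ dilation d δ μ M * angle (y 0) := by
    refine one_le_dilation_mul_angle (abs_nonneg _) ?_
    linarith [(abs_le.1 hvar).2, le_abs_self
      (d / δ * M * 2 ^ (1 / μ - ((d : ℝ) - 2)) / (1 / μ - ((d : ℝ) - 2)))]
  -- r / w < 2 / (μ + ψ) ≤ 2d, because dμ ≥ 1; this is where the threshold arctan (2d) is used.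
  have hηone : η (angle (y 0)) = 1 := by
    refine hη.eq_one _ (angle_mem _).1 (Real.arctan_strictMono.monotone ?_)
    refine (Real.exp_le_exp.2 hmono).trans ?_
    rw [ofQuad, Real.exp_sub, Real.exp_log hr, Real.exp_log hw, div_le_iff₀ hw, wFun]
    have h1 := hb.one_div_le
    rw [div_le_one (by positivity)] at h1
    have h4 := hB.pos p hp
    have h5 : 1 ≤ (d : ℝ) * (μ + ψ p) := by nlinarith
    nlinarith [mul_le_mul_of_nonneg_right h5 hz.le]
  have hV := (abs_le.1 (hB.abs_sub_logG_initial_le h hη hΘ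
    (zero_lt_one.trans (one_lt_dilation d δ μ M)) (ofQuad μ ψ p).1)).1
  have hχ : chi d μ η (angle (y 0)) = 1 := by rw [chi, hηone]; ring
  rw [hΘ.eq_one _ hangle, hχ, Real.log_one] at hV
  simp only [hy, Prod.mk.eta, hB.toQuad_ofQuad hp] at hV
  have hG := (abs_le.1 (le_exp_logG hb hB hp)).1
  calc 1 / profileConst d δ c₀ C N *
      (p.1 ^ (-(((d : ℝ) - 1) / (d * μ))) * p.2 ^ (-(1 / (d * μ))))
      ≤ 1 / Real.exp (Real.log (2 / δ) + varConst δ c₀ C + 2 * Real.log (3 * d) +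
          2 * (1 + d) / δ ^ 3) *
        (p.1 ^ (-(((d : ℝ) - 1) / (d * μ))) * p.2 ^ (-(1 / (d * μ)))) := by
        gcongr
    _ ≤ _ := by
      rw [one_div, ← Real.exp_neg, exp_mul_rpow_mul_rpow hr hz, Real.exp_le_exp]
      linarith

lemma exp_le_decay (hb : ParameterBounds d a μ δ c₀) (hψ : MemA d a μ M ψ) (hM : 1 < M)
    (hB : ProfileBounds d μ ψ δ c₀ C) (hη : IsEta d η) (hΘ : IsTheta d μ Θ) (hlam : 0 < lam)
    (hp : p ∈ quadrant) (h1 : 1 ≤ radius p) {y : ℝ → ℝ}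
    (hy : y (ofQuad μ ψ p).1 = (ofQuad μ ψ p).2)
    (h : IsProfileAlong d μ lam Θ η ψ y fun s => L (s, y s)) :
    Real.exp (L (ofQuad μ ψ p)) ≤
      decayConst d δ c₀ C lam μ M * p.2 * radius p ^ (-(1 / μ) - 1) := by
  have hκ : 0 < 1 / μ - ((d : ℝ) - 2) := sub_pos.2 hb.exp_decay
  have hdec : ∀ q ∈ quadrant, ψ q ≤ M * bracket q ^ (-(1 / μ - ((d : ℝ) - 2))) := fun q hq => by
    rw [neg_sub]; exact hψ.upper q (quadrant_subset_closedQuadrant hq)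
  have h2 := hB.le_decay_profile h hη hΘ hlam hb.one_div_le hκ (zero_le_one.trans hM.le) hdec
    (t := (ofQuad μ ψ p).1) (by rwa [hy, Prod.mk.eta, hB.toQuad_ofQuad hp])
  simp only [hy, Prod.mk.eta, hB.toQuad_ofQuad hp] at h2
  have hn := radius_pos hp
  rw [mul_assoc]
  have hpos : 0 ≤ p.2 * radius p ^ (-(1 / μ) - 1) := mul_nonneg hp.2.le (Real.rpow_nonneg hn.le _)
  rw [decayConst, add_mul]
  refine le_trans ?_ (le_add_of_nonneg_left (mul_nonneg zero_le_one hpos))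
  rw [exp_mul_mul_rpow hn hp.2, Real.exp_le_exp]
  linarith

end Bounds

end EulerProfile

end

/-! ### Choice of constants and assembly -/

theorem proposition2p3 (d : ℕ) (hd : 3 ≤ d) (a : ℝ) (ha : EulerProfile.AdmissibleA d a) :
    ∃ lam₀ M₁ : ℝ → ℝ → ℝ,
      ∀ η : ℝ → ℝ, EulerProfile.IsEta d η → ∀ K : ℝ,
        ∃ M₀ : ℝ, 1 < M₀ ∧
          ∀ μ : ℝ, EulerProfile.AdmissibleMu d a μ → ∀ M : ℝ, 1 < M →
            1 < lam₀ μ M ∧ 1 < M₁ μ M ∧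
            ∀ Θ : ℝ → ℝ, EulerProfile.IsTheta d μ Θ →
              (∀ s : ℝ, 0 < s → |s * deriv Θ s| ≤ K * Θ s) →
              ∀ ψ : ℝ × ℝ → ℝ, EulerProfile.MemA d a μ M ψ →
                ∃ f₀ : ℝ → ℝ,
                  ContDiffOn ℝ 1 f₀ (Set.Ioo 0 1) ∧
                  EulerProfile.initialCurve μ ψ = {p | p.1 ∈ Set.Ioo 0 1 ∧ p.2 = f₀ p.1} ∧
                  ∃ Ω : ℝ × ℝ → ℝ,
                    EulerProfile.IsTransportSolution d μ (lam₀ μ M) Θ η ψ f₀ Ω ∧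
                    (∀ Ω' : ℝ × ℝ → ℝ,
                      EulerProfile.IsTransportSolution d μ (lam₀ μ M) Θ η ψ f₀ Ω' →
                        Set.EqOn Ω' Ω EulerProfile.quadrant) ∧
                    EulerProfile.MemB d a μ M₀ Ω ∧
                    ∀ p ∈ EulerProfile.quadrant, 1 ≤ EulerProfile.radius p →
                      Ω p ≤ M₁ μ M * p.2 * EulerProfile.radius p ^ (-(1 / μ) - 1) := by
  open EulerProfile in
  obtain ⟨δ, c₀, hδ, hc₀, hc₀', hpar⟩ := exists_parameterBounds hd ha
  refine ⟨dilation d δ, fun μ M => decayConst d δ c₀ (16 / δ ^ 3) (dilation d δ μ M) μ M,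
    fun η hη K => ?_⟩
  obtain ⟨Cη, hCη0, hCη⟩ := exists_deriv_eta_bound hη (by omega)
  -- This bounds the slope of the logarithm of the data in θ. It involves neither μ nor λ₀, so
  -- neither does the constant for ℬ built from it; |K| keeps it nonnegative before any Θ is given.
  set N₀ := |K| + 1 / δ + 1 / δ + (Cη * (3 * d) ^ (1 + 1 / δ) + (1 + 1 / δ)) with hN₀
  set N := (1 + N₀) * Real.exp (3 * rateConst d δ (16 / δ ^ 3) * (Real.pi / c₀)) with hN
  have hN₀0 : 0 ≤ N₀ := by positivity
  have hN0 : 0 ≤ N := by positivity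
  have hNC : 0 ≤ 4 * (2 / δ ^ 2 + (d / δ + 1) * N) := by positivity
  refine ⟨profileConst d δ c₀ (16 / δ ^ 3) N, ?_, fun μ hμ M hM => ⟨one_lt_dilation d δ μ M,
    one_lt_decayConst _ _ _ _ _ _ _, fun Θ hΘ hK ψ hψ => ?_⟩⟩
  · have := Real.exp_pos (Real.log (2 / δ) + varConst δ c₀ (16 / δ ^ 3) + 2 * Real.log (3 * d) +
      2 * (1 + d) / δ ^ 3)
    rw [profileConst]; linarith
  have hb := hpar μ hμ
  have hB := hb.profileBounds hψ.toMemA0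
  have hlam : 0 < dilation d δ μ M := zero_lt_one.trans (one_lt_dilation d δ μ M)
  obtain ⟨L, hL, hsol, huniq, halong, hLz, hLt⟩ := hB.exists_solution hη hΘ hlam (N₀ := N₀)
    fun θ => (abs_deriv_logInitial_le hη hΘ (by omega) hδ hb.δ_le_μ hlam hK hCη0 hCη θ).trans (by
      rw [hN₀]
      gcongr
      exact le_abs_self K)
  refine ⟨initialHeight μ ψ, hB.contDiffOn_initialHeight, hB.initialCurve_eq, _, hsol, huniq,
    ⟨hsol.contDiffOn, fun p _ => Real.exp_pos _, fun p hp => ?_, fun p h2 hzr hrz => ?_,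
      fun p hp => ?_⟩, fun p hp h1 => ?_⟩
  · obtain ⟨y, hy, h⟩ := halong (ofQuad μ ψ p).1 (ofQuad μ ψ p).2
    exact exp_le_upper_profile hb hψ.toMemA0 hB hη hΘ hlam hN0 hp hy h
  · obtain ⟨y, hy, h⟩ := halong (ofQuad μ ψ p).1 (ofQuad μ ψ p).2
    exact lower_profile_le_exp hb hψ hM hB hη hΘ hN0 h2 hzr hrz hy h
  · refine (hB.logDeriv_le hL hLz hLt hp).trans
      (mul_le_mul_of_nonneg_right ?_ (Real.exp_pos _).le)
    have := Real.exp_pos (Real.log (2 / δ) + varConst δ c₀ (16 / δ ^ 3) + 2 * Real.log (3 * d) +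
      2 * (1 + d) / δ ^ 3)
    rw [profileConst]; linarith
  · obtain ⟨y, hy, h⟩ := halong (ofQuad μ ψ p).1 (ofQuad μ ψ p).2
    exact exp_le_decay hb hψ hM hB hη hΘ hlam hp h1 hy h
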